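/- Let $X$ be a (Hausdorff, second countable) complex manifold and let $\Omega\subset X$ be a relatively compact domain with smooth pseudoconvex boundary $M=b\Omega$. Here a defining function of $\Omega$ is a smooth real function $r$ on an open neighbourhood $U$ of $\overline\Omega$ with $\Omega=\{x\in U: r(x)<0\}$ and $dr\neq0$ on $M$; smoothness of $\Omega$ means that such an $r$ exists, and pseudoconvexity means that $\partial\overline\partial r\ge 0$ on $T^{1,0}M$. Assume that there is a smooth strictly plurisubharmonic function on a neighbourhood of $M$. Fix a smooth Hermitian metric $h$ on $T^{1,0}X$. Notation. $\mathcal N\subset T^{1,0}M$ is the Levi distribution: $\mathcal N_p$ is the null space of the Levi form $\partial\overline\partial r$ on $T^{1,0}_pM$. A D'Angelo form of $M$ is a real smooth one-form $\alpha$ on $M$ such that $\alpha(V)=\theta([T,V-\theta(V)T])$ for all vector fields $V$ on $M$, where $\theta$ is a nowhere vanishing real smooth one-form on $M$ annihilating $T^{1,0}M$ and $T$ is a smooth real vector field on $M$ with $\theta(T)\equiv1$; $\mathcal A_M$ is the set of D'Angelo forms. For $\alpha\in\mathcal A_M$, let $\overline\partial\alpha$ be the Hermitian form on $\mathcal N$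 defined by $\overline\partial(\tilde\alpha_{1,0})(Z,\overline Z)$ for any smooth real extension $\tilde\alpha$ of $\alpha$ to a neighbourhood of $M$ (wedge products being normalized by $(\varphi\wedge\psi)(Z,W)=\varphi(Z)\psi(W)-\varphi(W)\psi(Z)$), and put $$\mathfrak n(\alpha;\mathcal N)=\inf\{t>0:\ |\alpha(Z)|^2<t\,\overline\partial\alpha(Z,\overline Z)\ \text{ for all } p\in M,\ 0\ne Z\in\mathcal N_p\}\in[0,+\infty],$$ $$\|\alpha\|_{h,\mathcal N}=\sup\{|\alpha(Z)|:\ p\in M,\ Z\in\mathcal N_p,\ |Z|_h=1\},$$ $$\mathfrak n(\mathcal N)=\inf_{\alpha\in\mathcal A_M}\mathfrak n(\alpha;\mathcal N),\qquad \mathfrak n_K(\mathcal N)=\inf\{\mathfrak n(\alpha;\mathcal N):\ \alpha\in\mathcal A_M,\ \|\alpha\|_{h,\mathcal N}<K\}\quad(0<K<+\infty).$$ The Diederich--Fornæss index $\mathrm{DF}(\Omega)$ is the supremum of the $\delta\in(0,1]$ for which $-(-r)^\delta$ is plurisubharmonic on $\Omega$ for some defining function $r$ of $\Omega$. For defining functions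 $r_1,r_2$, let $f$ be the smooth function near $M$ with $r_2=e^fr_1$, and put $\sigma(r_1,r_2)=\sup\{|Zf|:\ p\in M,\ Z\in\mathcal N_p,\ |Z|_h=1\}$. One says that $\Omega$ has regularized Diederich--Fornæss index $1$ if there are $\delta_k\in(0,1]$ with $\delta_k\to1$ and defining functions $r_k$ of $\Omega$ such that every $-(-r_k)^{\delta_k}$ is plurisubharmonic on $\Omega$ and $\sup_{j,k}\sigma(r_j,r_k)<+\infty$. Theorem. With the convention $1/(1+\infty)=0$, $$\mathrm{DF}(\Omega)=\frac1{1+\mathfrak n(\mathcal N)}.$$ Moreover, $\Omega$ has regularized Diederich--Fornæss index $1$ if and only if there exists $K<+\infty$ such that $\mathfrak n_K(\mathcal N)=0$. -/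

import Mathlib

open Set Filter Bundle
open scoped Manifold ContDiff Topology ENNReal NNReal

noncomputable section

namespace DFIndex

/-! ### The underlying real structure of a complex manifold

`X` is a complex manifold modelled on a finite-dimensional complex vector space `E`. Its underlying
real smooth manifold is `X` with the model `𝓘(ℝ, E)`. A real tangent vector at `p` is an element of
`E` (its coordinates in the preferred chart at `p`), and the complex structure `J` of `T_p X` is
multiplication by `i`.

A vector `Z` of type `(1,0)` at `p` is encoded by the real tangent vector `v = Z + conj Z`, so that
`Z = (v - i J v) / 2`; in a holomorphic chart, `v ∈ E` is the vector of the coefficients `Z^j` of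
`Z = ∑ Z^j ∂_j`. This identifies `T^{1,0} X` with `(TX, J)` as complex vector bundles. -/

/-- A complex manifold is a real smooth manifold. -/
instance isManifold_real {E : Type*} [NormedAddCommGroup E] [NormedSpace ℂ E]
    {X : Type*} [TopologicalSpace X] [ChartedSpace E X] [IsManifold 𝓘(ℂ, E) ω X] :
    IsManifold 𝓘(ℝ, E) ∞ X := by
  apply isManifold_of_contDiffOn
  intro e e' he he'
  have h1 := ((contDiffGroupoid ω 𝓘(ℂ, E)).compatible he he')
  rw [contDiffGroupoid, mem_groupoid_of_pregroupoid] at h1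
  have h2 : ContDiffOn ℂ ω (𝓘(ℂ, E) ∘ (e.symm ≫ₕ e') ∘ 𝓘(ℂ, E).symm)
      (𝓘(ℂ, E).symm ⁻¹' (e.symm ≫ₕ e').source ∩ range 𝓘(ℂ, E)) := h1.1
  have h3 := (h2.of_le (m := ∞) le_top).restrict_scalars ℝ
  simpa using h3

section Definitions

variable {E : Type*} [NormedAddCommGroup E] [NormedSpace ℂ E]
  {X : Type*} [TopologicalSpace X] [ChartedSpace E X]

/-- The complex structure of `T_p X`: multiplication by `i` in a holomorphic chart. -/
def J (p : X) : TangentSpace 𝓘(ℝ, E) p →L[ℝ] TangentSpace 𝓘(ℝ, E) p :=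
  (Complex.I • ContinuousLinearMap.id ℝ E : E →L[ℝ] E)

/-- The differential of a real function at a point, as a real covector. -/
def diff (f : X → ℝ) (p : X) : TangentSpace 𝓘(ℝ, E) p →L[ℝ] ℝ :=
  mfderiv 𝓘(ℝ, E) 𝓘(ℝ, ℝ) f p

/-- The value `ℓ(Z)` of (the complex-linear extension of) a real covector `ℓ` on the `(1,0)`-vector
`Z = (v - i J v) / 2`. -/
def onHol {p : X} (l : TangentSpace 𝓘(ℝ, E) p →L[ℝ] ℝ) (v : TangentSpace 𝓘(ℝ, E) p) : ℂ :=
  ((l v : ℂ) - Complex.I * (l (J p v) : ℂ)) / 2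

/-- The complex Hessian (Levi form) `∂∂̄f(Z, W̄) = ∑ f_{jk̄} Z^j W̄^k` of a real function at `p`, with
`Z = (v - i J v) / 2`, `W = (w - i J w) / 2`, computed in the holomorphic chart at `p`. -/
def complexHessian (f : X → ℝ) (p : X) (v w : TangentSpace 𝓘(ℝ, E) p) : ℂ :=
  let F : E → ℝ := f ∘ (extChartAt 𝓘(ℝ, E) p).symm
  let D : E → E → ℝ := fun a b => fderiv ℝ (fderiv ℝ F) (extChartAt 𝓘(ℝ, E) p p) a b
  ((D v w + D (J p v) (J p w) : ℝ) + Complex.I * (D v (J p w) - D (J p v) w : ℝ)) / 4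

variable (E) in
/-- A smooth function on the open set `U` is plurisubharmonic if its complex Hessian is nonnegative
at every point of `U`. -/
def IsSmoothPlurisubharmonicOn (f : X → ℝ) (U : Set X) : Prop :=
  ContMDiffOn 𝓘(ℝ, E) 𝓘(ℝ, ℝ) ∞ f U ∧
    ∀ p ∈ U, ∀ v : TangentSpace 𝓘(ℝ, E) p, 0 ≤ (complexHessian f p v v).re

variable (E) in
/-- A smooth function on the open set `U` is strictly plurisubharmonic if its complex Hessian is
positive definite at every point of `U`. -/
def IsSmoothStrictlyPlurisubharmonicOn (f : X → ℝ) (U : Set X) : Prop :=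
  ContMDiffOn 𝓘(ℝ, E) 𝓘(ℝ, ℝ) ∞ f U ∧
    ∀ p ∈ U, ∀ v : TangentSpace 𝓘(ℝ, E) p, v ≠ 0 → 0 < (complexHessian f p v v).re

/-! ### Defining functions and the boundary -/

variable (E) in
/-- `r` is a defining function of `Ω`: it is smooth on an open neighbourhood `U` of the closure of
`Ω`, `Ω = {r < 0}` in `U`, and `dr ≠ 0` on the boundary. Values outside `U` are irrelevant. -/
def IsDefiningFunction (Ω : Set X) (r : X → ℝ) : Prop :=
  ∃ U : Set X, IsOpen U ∧ closure Ω ⊆ U ∧ ContMDiffOn 𝓘(ℝ, E) 𝓘(ℝ, ℝ) ∞ r U ∧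
    Ω = {x ∈ U | r x < 0} ∧ ∀ p ∈ frontier Ω, (diff r p : TangentSpace 𝓘(ℝ, E) p →L[ℝ] ℝ) ≠ 0

/-- The real tangent space `T_p M` of `M = bΩ`: the common kernel of the differentials of all
defining functions (which are nonzero multiples of each other at `p`). -/
def boundaryTangent (Ω : Set X) (p : X) : Set (TangentSpace 𝓘(ℝ, E) p) :=
  {v | ∀ r : X → ℝ, IsDefiningFunction E Ω r → diff r p v = 0}

/-- `T^{1,0}_p M` for `M = bΩ` (encoded by real vectors): the maximal complex subspace
`H_p(M) = T_p M ∩ J T_p M`. -/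
def holTangent (Ω : Set X) (p : X) : Set (TangentSpace 𝓘(ℝ, E) p) :=
  {v | v ∈ boundaryTangent Ω p ∧ J p v ∈ boundaryTangent Ω p}

variable (E) in
/-- `Ω` has smooth pseudoconvex boundary: there is a smooth defining function whose Levi form is
nonnegative on `T^{1,0} M`, `M = bΩ`. -/
def IsSmoothPseudoconvex (Ω : Set X) : Prop :=
  ∃ r : X → ℝ, IsDefiningFunction E Ω r ∧
    ∀ p ∈ frontier Ω, ∀ v ∈ holTangent (E := E) Ω p, 0 ≤ (complexHessian r p v v).re

/-- The Levi distribution `𝒩` of `M = bΩ`: the fibre at `p` is the null space of the Levi form on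
`T^{1,0}_p M`. It does not depend on the defining function. -/
def leviDistribution (Ω : Set X) (p : X) : Set (TangentSpace 𝓘(ℝ, E) p) :=
  {v | v ∈ holTangent Ω p ∧ ∀ r : X → ℝ, IsDefiningFunction E Ω r →
    ∀ w ∈ holTangent Ω p, complexHessian r p v w = 0}

/-! ### Vector fields, one-forms, D'Angelo forms

Vector fields and one-forms on the compact hypersurface `M = bΩ` are represented by smooth
extensions to `X`; a vector field on `X` represents one on `M` if it is tangent to `M` along `M`,
and then Lie brackets along `M` may be computed in `X`. -/

section Fields

variable [IsManifold 𝓘(ℂ, E) ω X]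

/-- Smoothness of a real vector field on `X`. -/
def IsSmoothVectorField (V : Π p : X, TangentSpace 𝓘(ℝ, E) p) : Prop :=
  ContMDiff 𝓘(ℝ, E) (𝓘(ℝ, E).prod 𝓘(ℝ, E)) ∞
    (fun p : X => (TotalSpace.mk' E p (V p) : TangentBundle 𝓘(ℝ, E) X))

/-- Smoothness of a real one-form on `X`. -/
def IsSmoothOneForm (α : Π p : X, TangentSpace 𝓘(ℝ, E) p →L[ℝ] ℝ) : Prop :=
  ContMDiff 𝓘(ℝ, E) (𝓘(ℝ, E).prod 𝓘(ℝ, E →L[ℝ] ℝ)) ∞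
    (fun p : X => TotalSpace.mk' (E →L[ℝ] ℝ)
      (E := fun q : X => TangentSpace 𝓘(ℝ, E) q →L[ℝ] Bundle.Trivial X ℝ q) p (α p))

/-- `V` is (a smooth extension of) a smooth vector field of `M = bΩ`. -/
def IsBoundaryField (Ω : Set X) (V : Π p : X, TangentSpace 𝓘(ℝ, E) p) : Prop :=
  IsSmoothVectorField V ∧ ∀ p ∈ frontier Ω, V p ∈ boundaryTangent Ω p

/-- `θ` is (a smooth extension of) a pseudo-Hermitian structure of `M = bΩ`: a real one-form on `M`
that has no zero and annihilates `H(M)`. -/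
def IsPseudoHermitian (Ω : Set X) (θ : Π p : X, TangentSpace 𝓘(ℝ, E) p →L[ℝ] ℝ) : Prop :=
  IsSmoothOneForm θ ∧ ∀ p ∈ frontier Ω,
    (∀ v ∈ holTangent Ω p, θ p v = 0) ∧ ∃ v ∈ boundaryTangent Ω p, θ p v ≠ 0

/-- `α` is (a smooth extension of) a D'Angelo form of `M = bΩ`: there are a pseudo-Hermitian
structure `θ` and a vector field `T` on `M` with `θ(T) = 1` such that
`α(V) = θ([T, V - θ(V) T])` for every vector field `V` on `M`. -/
def IsDAngeloForm (Ω : Set X) (α : Π p : X, TangentSpace 𝓘(ℝ, E) p →L[ℝ] ℝ) : Prop :=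
  IsSmoothOneForm α ∧
  ∃ (θ : Π p : X, TangentSpace 𝓘(ℝ, E) p →L[ℝ] ℝ) (T : Π p : X, TangentSpace 𝓘(ℝ, E) p),
    IsPseudoHermitian Ω θ ∧ IsBoundaryField Ω T ∧ (∀ p ∈ frontier Ω, θ p (T p) = 1) ∧
    ∀ V : Π p : X, TangentSpace 𝓘(ℝ, E) p, IsBoundaryField Ω V → ∀ p ∈ frontier Ω,
      α p (V p) = θ p (VectorField.mlieBracket 𝓘(ℝ, E) T (fun q => V q - θ q (V q) • T q) p)

variable (E X) in
/-- A smooth Hermitian metric `h` on `T^{1,0} X`, given by its real part: a smooth Riemannian metric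
on `TX` for which `J` is orthogonal. For `Z = (v - i J v) / 2` one has `|Z|² = inner p v v`. -/
structure HermitianMetric extends
    ContMDiffRiemannianMetric 𝓘(ℝ, E) ∞ E (fun p : X => TangentSpace 𝓘(ℝ, E) p) where
  inner_J : ∀ (p : X) (v w : TangentSpace 𝓘(ℝ, E) p), inner p (J p v) (J p w) = inner p v w

end Fields

/-- The Hermitian form `∂̄α(Z, Z̄)`, `Z = (v - i J v) / 2`, of a real one-form `α`, that is
`(∂̄α_{1,0})(Z, Z̄) = - ∑ (∂a_j / ∂z̄_k) Z^j Z̄^k` where `α_{1,0} = ∑ a_j dz_j` in the holomorphic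
chart at `p` (the real part is taken; the form is Hermitian on the Levi distribution when `α` is
a D'Angelo form). Wedge products are normalized by
`(φ ∧ ψ)(Z, W) = φ(Z) ψ(W) - φ(W) ψ(Z)`. Below, `a y` is the covector `α` at the
point with coordinate `y`, expressed in the chart. -/
def dbar (α : Π p : X, TangentSpace 𝓘(ℝ, E) p →L[ℝ] ℝ) (p : X)
    (v : TangentSpace 𝓘(ℝ, E) p) : ℝ :=
  let a : E → E →L[ℝ] ℝ := fun y =>
    (α ((extChartAt 𝓘(ℝ, E) p).symm y)).comp
      (mfderiv 𝓘(ℝ, E) 𝓘(ℝ, E) (extChartAt 𝓘(ℝ, E) p).symm y)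
  let Da : E → E → ℝ := fun w u => fderiv ℝ a (extChartAt 𝓘(ℝ, E) p p) w u
  (-(Da v v + Da (J p v) (J p v)) / 4)

/-- `𝔫(α; 𝒟)`: the infimum of the `t > 0` such that
`conj α_{0,1} ∧ α_{0,1} < t ∂̄α` on `𝒟`, as Hermitian forms (`∞` if there is none). Here
`(conj α_{0,1} ∧ α_{0,1})(Z, Z̄) = |α(Z)|²`. -/
def nForm (Ω : Set X) (𝒟 : Π p : X, Set (TangentSpace 𝓘(ℝ, E) p))
    (α : Π p : X, TangentSpace 𝓘(ℝ, E) p →L[ℝ] ℝ) : ℝ≥0∞ :=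
  ⨅ (t : ℝ) (_ : 0 < t)
    (_ : ∀ p ∈ frontier Ω, ∀ v ∈ 𝒟 p, v ≠ 0 → ‖onHol (α p) v‖ ^ 2 < t * dbar α p v),
    ENNReal.ofReal t

section Invariants

variable [IsManifold 𝓘(ℂ, E) ω X]

/-- The size `‖α‖_{h,𝒟} = sup |α(Z)|` over the unit vectors `Z` of `𝒟`. -/
def size (h : HermitianMetric E X) (Ω : Set X) (𝒟 : Π p : X, Set (TangentSpace 𝓘(ℝ, E) p))
    (α : Π p : X, TangentSpace 𝓘(ℝ, E) p →L[ℝ] ℝ) : ℝ≥0∞ :=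
  ⨆ (p : X) (_ : p ∈ frontier Ω) (v : TangentSpace 𝓘(ℝ, E) p) (_ : v ∈ 𝒟 p)
    (_ : h.inner p v v = 1), ENNReal.ofReal ‖onHol (α p) v‖

/-- `𝔫(𝒟) = inf 𝔫(α; 𝒟)` over all D'Angelo forms `α` of `bΩ`. -/
def nTotal (Ω : Set X) (𝒟 : Π p : X, Set (TangentSpace 𝓘(ℝ, E) p)) : ℝ≥0∞ :=
  ⨅ (α : Π p : X, TangentSpace 𝓘(ℝ, E) p →L[ℝ] ℝ) (_ : IsDAngeloForm Ω α), nForm Ω 𝒟 α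

/-- `𝔫_K(𝒟) = inf 𝔫(α; 𝒟)` over the D'Angelo forms `α` of `bΩ` with `‖α‖_{h,𝒩} < K`, where `𝒩` is
the Levi distribution. -/
def nBounded (h : HermitianMetric E X) (Ω : Set X) (K : ℝ≥0∞)
    (𝒟 : Π p : X, Set (TangentSpace 𝓘(ℝ, E) p)) : ℝ≥0∞ :=
  ⨅ (α : Π p : X, TangentSpace 𝓘(ℝ, E) p →L[ℝ] ℝ) (_ : IsDAngeloForm Ω α)
    (_ : size h Ω (leviDistribution Ω) α < K), nForm Ω 𝒟 α

/-! ### Diederich–Fornæss index -/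

variable (E) in
/-- `-(-r)^δ` is plurisubharmonic on `Ω`. -/
def IsDFPair (Ω : Set X) (δ : ℝ) (r : X → ℝ) : Prop :=
  IsDefiningFunction E Ω r ∧ IsSmoothPlurisubharmonicOn E (fun x => -(-r x) ^ δ) Ω

variable (E) in
/-- The Diederich–Fornæss index: the supremum of the `δ ∈ (0, 1]` such that `-(-r)^δ` is
plurisubharmonic on `Ω` for some defining function `r`. -/
def dfIndex (Ω : Set X) : ℝ≥0∞ :=
  ⨆ (δ : ℝ) (_ : δ ∈ Ioc (0 : ℝ) 1) (_ : ∃ r : X → ℝ, IsDFPair E Ω δ r), ENNReal.ofReal δ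

variable (E) in
/-- `f` is a smooth function near `bΩ` with `r₂ = e^f r₁` there. Its germ along `bΩ` is determined
by `r₁` and `r₂`. -/
def IsLogRatio (Ω : Set X) (r₁ r₂ f : X → ℝ) : Prop :=
  ∃ V : Set X, IsOpen V ∧ frontier Ω ⊆ V ∧ ContMDiffOn 𝓘(ℝ, E) 𝓘(ℝ, ℝ) ∞ f V ∧
    ∀ x ∈ V, r₂ x = Real.exp (f x) * r₁ x

/-- The pseudodistance `σ(r₁, r₂) = sup |Z f|` over the `h`-unit vectors `Z` of the Levi
distribution, where `r₂ = e^f r₁`. (The infimum is over a family with a single value.) -/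
def sigma (h : HermitianMetric E X) (Ω : Set X) (r₁ r₂ : X → ℝ) : ℝ≥0∞ :=
  ⨅ (f : X → ℝ) (_ : IsLogRatio E Ω r₁ r₂ f), size h Ω (leviDistribution Ω) (fun p => diff f p)

/-- `Ω` has regularized Diederich–Fornæss index `1`: there are `δ_k ∈ (0, 1]` with `δ_k → 1` and
defining functions `r_k` forming a `σ`-bounded family such that `-(-r_k)^{δ_k}` is
plurisubharmonic on `Ω`. -/
def HasRegularizedDFIndexOne (h : HermitianMetric E X) (Ω : Set X) : Prop :=
  ∃ (δ : ℕ → ℝ) (r : ℕ → X → ℝ),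
    (∀ k, δ k ∈ Ioc (0 : ℝ) 1) ∧ Tendsto δ atTop (𝓝 1) ∧ (∀ k, IsDFPair E Ω (δ k) (r k)) ∧
    ∃ C : ℝ≥0, ∀ j k, sigma h Ω (r j) (r k) ≤ C

end Invariants

end Definitions

end DFIndex

end

/-!
Everything is reduced to a pointwise comparison of two quadratic forms on the Levi distribution,
carried out in a holomorphic chart on the model space `E`. Let `F` be a defining function read in
the chart, and `n` a vector with `dF(n) = -1` and `dF(i n) = 0` at a boundary point.

**D'Angelo forms.** For the pair `(θ, T)` with `θ = -dr ∘ J` the bracket `θ([T, V - θ(V) T])`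
equals `-4 Re ∂∂̄r(V, JT)` (`pseudoHermitian_lieBracket`); this one-form is `danForm r T`. Every
pseudo-Hermitian structure is, up to a sign, of this type for some defining function `e^f r`, so
that every D'Angelo form is locally of this type (`IsDAngeloForm.exists_exp_mul`). Moreover,
passing from `r` to `e^f r` adds `df` to the form along the Levi distribution
(`danForm_eq_add_diff`).

**The identity behind the theorem.** Let `v` represent a null vector `Z` of the Levi form, and let
`α` agree with the D'Angelo form of `F`, `n` on the vectors tangent to `{F = 0}`. Then
`4 |α(Z)|² = leviSq F x n v`, and differentiating `α` along the boundary yields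
`4 ∂̄α(Z, Z̄) = normalVariation F x n v - leviSq F x n v` (`dbar_eq`). Hence, with
`δ = 1 / (1 + t)`, the inequality `|α(Z)|² < t ∂̄α(Z, Z̄)` says that
`normalVariation - leviSq / (1 - δ)` is positive.

**The same quantity in the plurisubharmonicity of `-(-F)^δ`.** The complex Hessian of `-(-F)^δ` is
a positive multiple of the form `dfForm F δ = 4 (∂∂̄F + (1 - δ) |∂F|² / (-F))`. Moving inwards
from the boundary point along `n` while correcting `v` to first order, and optimizing over the
corrections, `dfForm F δ`, divided by the distance, tends to `normalVariation - leviSq / (1 - δ)`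
(`le_normalVariation_of_dfForm`). Conversely, if this quantity is positive on the nonzero null
vectors, then `dfForm F δ` is nonnegative on `{F < 0}` near the point
(`eventually_dfForm_nonneg`): vectors with negative values at points approaching the boundary
would have, after rescaling, a limit that is a null vector with a nonpositive value.

**Global part.** If `-(-r)^δ` is plurisubharmonic, then multiplying `r` by `e^{-εψ}`, where `ψ` is
strictly plurisubharmonic near the boundary, makes the inequality strict at the cost of a smaller
exponent (`dfForm_exp_mul`, `nForm_danForm_le`), which gives D'Angelo forms `α` with `𝔫(α)` below
any bound greater than `(1 - δ) / δ`. Conversely, a D'Angelo form with `|α|² < t ∂̄α` gives a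
defining function for which `-(-r)^{1/(1+t)}` is plurisubharmonic near the boundary, and
composition with a convex function extends this to all of `Ω` (`exists_isDFPair_of_near_frontier`,
`exists_isDFPair_of_lt`). Under both constructions the forms of two defining functions differ by
the differential of the logarithm of their ratio, up to a bounded term, so that bounds on the size
of the forms correspond to bounds on the pseudodistance of the defining functions; this is the
regularized statement.
-/

noncomputable section

namespace DFIndex

/-! ### Real and complex Hessians on the model space -/

section LocalCalculus

set_option synthInstance.maxHeartbeats 400000

variable {E : Type*} [NormedAddCommGroup E] [NormedSpace ℂ E]

-- Shortcut instances: the search for these structures on bilinear forms is slow otherwise.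
instance : NormedAddCommGroup (E →L[ℝ] E →L[ℝ] ℝ) := inferInstance
instance : NormedSpace ℝ (E →L[ℝ] E →L[ℝ] ℝ) := inferInstance
instance : AddCommGroup (E →L[ℝ] E →L[ℝ] ℝ) := inferInstance

/-- The real Hessian of a function on the model space. -/
def hess (F : E → ℝ) (y : E) : E →L[ℝ] E →L[ℝ] ℝ := fderiv ℝ (fderiv ℝ F) y

variable (E) in
/-- Multiplication by `i` as a real-linear map. -/
def mulI : E →L[ℝ] E := Complex.I • ContinuousLinearMap.id ℝ E

@[simp] lemma mulI_apply (v : E) : mulI E v = Complex.I • v := rfl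

lemma I_smul_I_smul (v : E) : Complex.I • Complex.I • v = -v := by
  rw [smul_smul, Complex.I_mul_I, neg_one_smul]

/-- `B ↦ B + B(i·, i·)` on real bilinear forms; it maps the real Hessian to four times the real
part of the complex Hessian. -/
def hermPart : (E →L[ℝ] E →L[ℝ] ℝ) →L[ℝ] (E →L[ℝ] E →L[ℝ] ℝ) :=
  ContinuousLinearMap.id ℝ _ +
    ((ContinuousLinearMap.compL ℝ E (E →L[ℝ] ℝ) (E →L[ℝ] ℝ)
        ((ContinuousLinearMap.compL ℝ E E ℝ).flip (mulI E))).comp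
      ((ContinuousLinearMap.compL ℝ E E (E →L[ℝ] ℝ)).flip (mulI E)))

@[simp] lemma hermPart_apply (B : E →L[ℝ] E →L[ℝ] ℝ) (v w : E) :
    hermPart B v w = B v w + B (Complex.I • v) (Complex.I • w) := by
  simp [hermPart]

/-- Four times the real part of the complex Hessian, as a real bilinear form. -/
def leviB (F : E → ℝ) (y : E) : E →L[ℝ] E →L[ℝ] ℝ := hermPart (hess F y)

lemma leviB_apply (F : E → ℝ) (y v w : E) :
    leviB F y v w = hess F y v w + hess F y (Complex.I • v) (Complex.I • w) := by
  simp [leviB]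

lemma leviB_I_right (F : E → ℝ) (y v w : E) :
    leviB F y v (Complex.I • w) = -leviB F y (Complex.I • v) w := by
  simp [leviB_apply, I_smul_I_smul]

/-- Four times the squared modulus of `∂F(Z)`, `Z = (v - i J v) / 2`. -/
def gradSq (F : E → ℝ) (y v : E) : ℝ :=
  (fderiv ℝ F y v) ^ 2 + (fderiv ℝ F y (Complex.I • v)) ^ 2

/-- The third derivative. -/
def third (F : E → ℝ) (y : E) : E →L[ℝ] E →L[ℝ] E →L[ℝ] ℝ := fderiv ℝ (hess F) y

/-- `v` encodes a `(1,0)`-vector at `y` that is tangent to the level set of `F` and lies in the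
null space of its Levi form. -/
def IsNull (F : E → ℝ) (y v : E) : Prop :=
  fderiv ℝ F y v = 0 ∧ fderiv ℝ F y (Complex.I • v) = 0 ∧
    ∀ w, fderiv ℝ F y w = 0 → fderiv ℝ F y (Complex.I • w) = 0 → leviB F y v w = 0

/-- The first order variation of the Levi form of `F` in the direction of a normal vector `n`, at a
null vector `v` that is corrected to first order so as to remain complex tangential to the level
sets. For `δ < 1`, the minimum over all first order corrections `v + s u` of the limit of
`dfForm F δ (y + s n) (v + s u) / s` as `s → 0+` is
`normalVariation F y n v - leviSq F y n v / (1 - δ)`. -/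
def normalVariation (F : E → ℝ) (y n v : E) : ℝ :=
  hermPart (third F y n) v v + 2 * (leviB F y v n * hess F y v n
    + leviB F y (Complex.I • v) n * hess F y (Complex.I • v) n)

/-- Four times `|α(Z)|²`, `Z = (v - i J v) / 2`, for the D'Angelo form `α = -4 Re ∂∂̄F(·, n)`. -/
def leviSq (F : E → ℝ) (y n v : E) : ℝ :=
  (leviB F y v n) ^ 2 + (leviB F y (Complex.I • v) n) ^ 2

variable {F G : E → ℝ} {y : E}

lemma hess_symm (hF : ContDiffAt ℝ 2 F y) (v w : E) : hess F y v w = hess F y w v :=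
  (hF.isSymmSndFDerivAt (by simp)) v w

lemma leviB_symm (hF : ContDiffAt ℝ 2 F y) (v w : E) : leviB F y v w = leviB F y w v := by
  simp only [leviB_apply, hess_symm hF v w, hess_symm hF (Complex.I • v)]

lemma contDiffAt_fderiv {n : ℕ} (hF : ContDiffAt ℝ (n + 1) F y) :
    ContDiffAt ℝ n (fderiv ℝ F) y := hF.fderiv_right le_rfl

lemma contDiffAt_hess {n : ℕ} (hF : ContDiffAt ℝ (n + 2) F y) : ContDiffAt ℝ n (hess F) y := by
  have h1 : ContDiffAt ℝ ((n + 1 : ℕ) : WithTop ℕ∞) (fderiv ℝ F) y :=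
    hF.fderiv_right (by push_cast; rw [add_assoc]; norm_num)
  exact h1.fderiv_right (by push_cast; exact le_rfl)

lemma hasFDerivAt_fderiv (hF : ContDiffAt ℝ 2 F y) :
    HasFDerivAt (fderiv ℝ F) (hess F y) y :=
  ((contDiffAt_fderiv (n := 1) (by norm_num; exact hF)).differentiableAt (by simp)).hasFDerivAt

lemma hasStrictFDerivAt_fderiv (hF : ContDiffAt ℝ 2 F y) :
    HasStrictFDerivAt (fderiv ℝ F) (hess F y) y :=
  (contDiffAt_fderiv (n := 1) (by norm_num; exact hF)).hasStrictFDerivAt (by simp)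

lemma hasStrictFDerivAt_hess (hF : ContDiffAt ℝ 3 F y) :
    HasStrictFDerivAt (hess F) (third F y) y :=
  (contDiffAt_hess (n := 1) (by norm_num; exact hF)).hasStrictFDerivAt (by simp)

lemma hasStrictFDerivAt_leviB (hF : ContDiffAt ℝ 3 F y) :
    HasStrictFDerivAt (leviB F) (hermPart.comp (third F y)) y :=
  hermPart.hasStrictFDerivAt.comp y (hasStrictFDerivAt_hess hF)

lemma continuousAt_leviB (hF : ContDiffAt ℝ 2 F y) : ContinuousAt (leviB F) y :=
  hermPart.continuous.continuousAt.comp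
    (contDiffAt_hess (n := 0) (by norm_num; exact hF)).continuousAt

lemma third_symm_right (hF : ContDiffAt ℝ 3 F y) (u v w : E) :
    third F y u v w = third F y u w v := by
  have h2 : ∀ᶠ z in 𝓝 y, hess F z v w = hess F z w v := by
    filter_upwards [hF.eventually (by decide)] with z hz
    exact hess_symm (hz.of_le (by norm_num)) v w
  have hd := (hasStrictFDerivAt_hess hF).hasFDerivAt
  have h3 := (hd.clm_apply (hasFDerivAt_const v y)).clm_apply (hasFDerivAt_const w y)
  have h4 := (hd.clm_apply (hasFDerivAt_const w y)).clm_apply (hasFDerivAt_const v y)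
  have := h3.unique (h4.congr_of_eventuallyEq h2)
  simpa using DFunLike.congr_fun this u

lemma third_symm_left (hF : ContDiffAt ℝ 3 F y) (u v w : E) :
    third F y u v w = third F y v u w := by
  have h := ((contDiffAt_fderiv (n := 2) (by norm_num; exact hF)).isSymmSndFDerivAt (by simp)) u v
  exact DFunLike.congr_fun h w

/-- Second derivative of `g ∘ F` for a function `g` of one variable. -/
lemma hess_comp_real {g g' : ℝ → ℝ} {g'' : ℝ} (hF : ContDiffAt ℝ 2 F y)
    (hg : ∀ᶠ t in 𝓝 (F y), HasDerivAt g (g' t) t) (hg' : HasDerivAt g' g'' (F y)) (v w : E) :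
    hess (fun z => g (F z)) y v w =
      g' (F y) * hess F y v w + g'' * (fderiv ℝ F y v * fderiv ℝ F y w) := by
  have h1 : fderiv ℝ (fun z => g (F z)) =ᶠ[𝓝 y] fun z => g' (F z) • fderiv ℝ F z := by
    filter_upwards [hF.continuousAt.eventually hg, hF.eventually (by decide)] with z hz hFz
    exact (hz.comp_hasFDerivAt z (hFz.differentiableAt (by simp)).hasFDerivAt).fderiv
  have h2 := (hg'.comp_hasFDerivAt y (hF.differentiableAt (by simp)).hasFDerivAt).smul
    (hasFDerivAt_fderiv hF)
  rw [hess, (h2.congr_of_eventuallyEq h1).fderiv]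
  simp [mul_assoc]

lemma fderiv_comp_real {g : ℝ → ℝ} {g' : ℝ} (hF : DifferentiableAt ℝ F y)
    (hg : HasDerivAt g g' (F y)) (v : E) :
    fderiv ℝ (fun z => g (F z)) y v = g' * fderiv ℝ F y v := by
  have h := (hg.comp_hasFDerivAt y hF.hasFDerivAt).fderiv
  have h' : fderiv ℝ (fun z => g (F z)) y = g' • fderiv ℝ F y := h
  rw [h']; simp

/-- Second derivative of a product. -/
lemma hess_mul (hF : ContDiffAt ℝ 2 F y) (hG : ContDiffAt ℝ 2 G y) (v w : E) :
    hess (fun z => G z * F z) y v w = G y * hess F y v w + fderiv ℝ G y v * fderiv ℝ F y w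
      + fderiv ℝ F y v * fderiv ℝ G y w + F y * hess G y v w := by
  have h1 : fderiv ℝ (fun z => G z * F z) =ᶠ[𝓝 y]
      fun z => G z • fderiv ℝ F z + F z • fderiv ℝ G z := by
    filter_upwards [hG.eventually (by decide), hF.eventually (by decide)] with z hGz hFz
    exact ((hGz.differentiableAt (by simp)).hasFDerivAt.mul
      (hFz.differentiableAt (by simp)).hasFDerivAt).fderiv
  have h2 := ((hG.differentiableAt (by simp)).hasFDerivAt.smul (hasFDerivAt_fderiv hF)).add
    ((hF.differentiableAt (by simp)).hasFDerivAt.smul (hasFDerivAt_fderiv hG))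
  rw [hess, (h2.congr_of_eventuallyEq h1).fderiv]
  simp; ring

lemma leviB_comp_real {g g' : ℝ → ℝ} {g'' : ℝ} (hF : ContDiffAt ℝ 2 F y)
    (hg : ∀ᶠ t in 𝓝 (F y), HasDerivAt g (g' t) t) (hg' : HasDerivAt g' g'' (F y)) (v : E) :
    leviB (fun z => g (F z)) y v v = g' (F y) * leviB F y v v + g'' * gradSq F y v := by
  simp only [leviB_apply, hess_comp_real hF hg hg', gradSq]; ring

/-- The complex Hessian is invariant under a holomorphic change of coordinates. -/
lemma leviB_comp_holomorphic {φ : E → E} (hφ : ContDiffAt ℝ 2 φ y)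
    (hφI : ∀ᶠ z in 𝓝 y, ∀ v, fderiv ℝ φ z (Complex.I • v) = Complex.I • fderiv ℝ φ z v)
    (hF : ContDiffAt ℝ 2 F (φ y)) (v w : E) :
    leviB (F ∘ φ) y v w = leviB F (φ y) (fderiv ℝ φ y v) (fderiv ℝ φ y w) := by
  have h1 : fderiv ℝ (F ∘ φ) =ᶠ[𝓝 y] fun z => (fderiv ℝ F (φ z)).comp (fderiv ℝ φ z) := by
    filter_upwards [hφ.continuousAt.eventually (hF.eventually (by decide)),
      hφ.eventually (by decide)] with z hFz hφz
    exact fderiv_comp z (hFz.differentiableAt (by simp)) (hφz.differentiableAt (by simp))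
  have hφ2 : HasFDerivAt (fderiv ℝ φ) (fderiv ℝ (fderiv ℝ φ) y) y :=
    ((hφ.fderiv_right (m := 1) (by norm_num)).differentiableAt (by simp)).hasFDerivAt
  have h2 := ((hasFDerivAt_fderiv hF).comp y
    (hφ.differentiableAt (by simp)).hasFDerivAt).clm_comp hφ2
  have h3 : ∀ a b, hess (F ∘ φ) y a b = fderiv ℝ F (φ y) (fderiv ℝ (fderiv ℝ φ) y a b)
      + hess F (φ y) (fderiv ℝ φ y a) (fderiv ℝ φ y b) := by
    intro a b
    rw [hess, (h2.congr_of_eventuallyEq h1).fderiv]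
    simp
  have h4 : ∀ a b, fderiv ℝ (fderiv ℝ φ) y a (Complex.I • b)
      = Complex.I • fderiv ℝ (fderiv ℝ φ) y a b := by
    intro a b
    have e1 := hφ2.clm_apply (hasFDerivAt_const (Complex.I • b) y)
    have e2 := (mulI E).hasFDerivAt.comp y (hφ2.clm_apply (hasFDerivAt_const b y))
    have e3 : (fun z => fderiv ℝ φ z (Complex.I • b)) =ᶠ[𝓝 y]
        (mulI E) ∘ fun z => fderiv ℝ φ z b := by
      filter_upwards [hφI] with z hz using by simp [hz]
    simpa using DFunLike.congr_fun (e1.unique (e2.congr_of_eventuallyEq e3)) a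
  have h5 : ∀ a b, fderiv ℝ (fderiv ℝ φ) y a b = fderiv ℝ (fderiv ℝ φ) y b a :=
    fun a b => (hφ.isSymmSndFDerivAt (by simp)) a b
  have h6 := hφI.self_of_nhds
  simp only [leviB_apply, h3, h6]
  rw [h4, h5 (Complex.I • v), h4, I_smul_I_smul, h5 w]
  simp; ring

lemma isNull_I {v : E} (hv : IsNull F y v) : IsNull F y (Complex.I • v) := by
  refine ⟨hv.2.1, by simp [I_smul_I_smul, hv.1], fun w hw hw' => ?_⟩
  have := hv.2.2 (Complex.I • w) hw' (by simp [I_smul_I_smul, hw])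
  rw [leviB_I_right] at this; linarith

/-- Along a null vector, the Levi form is determined by its values on one normal vector. -/
lemma IsNull.leviB_eq {v n : E} (hv : IsNull F y v) (hn : fderiv ℝ F y n = -1)
    (hIn : fderiv ℝ F y (Complex.I • n) = 0) (u : E) :
    leviB F y v u = -fderiv ℝ F y u * leviB F y v n
      - fderiv ℝ F y (Complex.I • u) * leviB F y (Complex.I • v) n := by
  have h := hv.2.2 (u + fderiv ℝ F y u • n - fderiv ℝ F y (Complex.I • u) • Complex.I • n)
    (by simp [hn, hIn]) (by
      have : Complex.I • (u + fderiv ℝ F y u • n - fderiv ℝ F y (Complex.I • u) • Complex.I • n)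
        = Complex.I • u + fderiv ℝ F y u • Complex.I • n + fderiv ℝ F y (Complex.I • u) • n := by
        rw [smul_sub, smul_add, smul_comm Complex.I, smul_comm Complex.I, I_smul_I_smul]
        simp
      rw [this]; simp [hn, hIn])
  simp [leviB_I_right] at h
  linarith

end LocalCalculus

/-! ### Comparison of defining functions, and `∂̄α` for a D'Angelo form -/

section LocalLemmas

set_option synthInstance.maxHeartbeats 400000

variable {E : Type*} [NormedAddCommGroup E] [NormedSpace ℂ E] {F G : E → ℝ} {x : E}

/-- The derivative of a function that vanishes on a regular level set `{F = 0}` vanishes on vectors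
tangent to it. -/
lemma tangential_deriv_eq_zero [CompleteSpace E] {F' g' : E →L[ℝ] ℝ} {g : E → ℝ}
    (hF : HasStrictFDerivAt F F' x) (hF0 : F x = 0) (hF' : F' ≠ 0) (hg : HasStrictFDerivAt g g' x)
    (h : ∀ᶠ y in 𝓝 x, F y = 0 → g y = 0) {w : E} (hw : F' w = 0) : g' w = 0 := by
  have hx := h.self_of_nhds hF0
  have hext : IsLocalExtrOn g {y | F y = F x} x := by
    left
    refine eventually_nhdsWithin_iff.2 ?_
    filter_upwards [h] with y hy hy'
    rw [hx, hy (by rw [← hF0]; exact hy')]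
  obtain ⟨a, b, hab, h2⟩ := hext.exists_multipliers_of_hasStrictFDerivAt_1d hF hg
  have h3 := DFunLike.congr_fun h2 w
  simp [hw] at h3
  rcases h3 with h3 | h3
  · subst h3
    simp at h2
    rcases h2 with h2 | h2
    · simp [h2] at hab
    · exact absurd h2 hF'
  · exact h3

lemma hasDerivAt_comp_curve {K : E → ℝ} {c : ℝ → E} {c' : E} {t : ℝ}
    (hK : DifferentiableAt ℝ K (c t)) (hc : HasDerivAt c c' t) :
    HasDerivAt (fun s => K (c s)) (fderiv ℝ K (c t) c') t :=
  hK.hasFDerivAt.comp_hasDerivAt t hc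

lemma eventually_neg_of_deriv_neg {φ : ℝ → ℝ} {m : ℝ} (h0 : φ 0 = 0) (h : HasDerivAt φ m 0)
    (hm : m < 0) : ∀ᶠ t in 𝓝[>] (0 : ℝ), φ t < 0 := by
  have h1 := h.tendsto_slope_zero_right.eventually (eventually_lt_nhds hm)
  filter_upwards [h1, self_mem_nhdsWithin] with t ht (ht0 : 0 < t)
  simp only [zero_add, h0, sub_zero, smul_eq_mul] at ht
  by_contra! hc
  exact absurd ht (not_lt.2 (by positivity))

/-- A function with vanishing value and derivative at `0` and negative second derivative there is
negative to the right of `0`. -/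
lemma eventually_neg_of_second_deriv_neg {φ φ' : ℝ → ℝ} {m : ℝ} (h0 : φ 0 = 0) (h1 : φ' 0 = 0)
    (hφ : ∀ᶠ t in 𝓝 (0 : ℝ), HasDerivAt φ (φ' t) t) (h : HasDerivAt φ' m 0)
    (hm : m < 0) : ∀ᶠ t in 𝓝[>] (0 : ℝ), φ t < 0 := by
  have h2 := eventually_neg_of_deriv_neg h1 h hm
  rw [eventually_nhdsWithin_iff] at h2 ⊢
  obtain ⟨ε, hε, hb⟩ := Metric.eventually_nhds_iff.1 (h2.and hφ)
  filter_upwards [Metric.ball_mem_nhds (0 : ℝ) hε] with t ht (ht0 : 0 < t)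
  have hb' : ∀ s, 0 ≤ s → s ≤ t → HasDerivAt φ (φ' s) s := fun s hs hs' => (hb (by
    simp [abs_of_pos ht0] at ht
    simp [abs_of_nonneg hs]; linarith)).2
  obtain ⟨s, hs, hs2⟩ := exists_hasDerivAt_eq_slope φ φ' ht0
    (fun s hs => (hb' s hs.1 hs.2).continuousAt.continuousWithinAt)
    (fun s hs => hb' s hs.1.le hs.2.le)
  have h3 := (hb (y := s) (by
    simp [abs_of_pos ht0] at ht
    simp [abs_of_pos hs.1]; linarith [hs.2])).1 hs.1
  rw [hs2, h0, sub_zero, sub_zero] at h3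
  by_contra! hc
  exact absurd h3 (not_lt.2 (by positivity))

/-- If `F` and `G` cut out the same domain near a common regular boundary point, their differentials
are positively proportional there. -/
lemma fderiv_proportional (hF : DifferentiableAt ℝ F x) (hG : DifferentiableAt ℝ G x)
    (hF0 : F x = 0) (hG0 : G x = 0) (hF' : fderiv ℝ F x ≠ 0) (hG' : fderiv ℝ G x ≠ 0)
    (h : ∀ᶠ y in 𝓝 x, F y < 0 → G y < 0) : ∃ c : ℝ, 0 < c ∧ fderiv ℝ G x = c • fderiv ℝ F x := by
  have key : ∀ v, fderiv ℝ F x v < 0 → fderiv ℝ G x v ≤ 0 := by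
    intro v hv
    by_contra! hc
    have hcur : HasDerivAt (fun t : ℝ => x + t • v) v 0 := by
      simpa using ((hasDerivAt_id (0 : ℝ)).smul_const v).const_add x
    have ht : Tendsto (fun t : ℝ => x + t • v) (𝓝[>] 0) (𝓝 x) := by
      simpa using hcur.continuousAt.tendsto.mono_left nhdsWithin_le_nhds
    have h1 := eventually_neg_of_deriv_neg (φ := fun t : ℝ => F (x + t • v)) (by simp [hF0])
      (hasDerivAt_comp_curve (by simpa using hF) hcur) (by simpa using hv)
    have h2 := eventually_neg_of_deriv_neg (φ := fun t : ℝ => -G (x + t • v)) (by simp [hG0])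
      (hasDerivAt_comp_curve (by simpa using hG) hcur).neg (by simpa using hc)
    obtain ⟨t, ht1, ht2, ht3⟩ := (h1.and (h2.and (ht.eventually h))).exists
    linarith [ht3 ht1]
  obtain ⟨n, hn⟩ : ∃ n, fderiv ℝ F x n = -1 := by
    obtain ⟨n, hn⟩ : ∃ n, fderiv ℝ F x n ≠ 0 := by
      by_contra! hc
      exact hF' (ContinuousLinearMap.ext hc)
    exact ⟨-(fderiv ℝ F x n)⁻¹ • n, by simp [hn]⟩
  have hker : ∀ v, fderiv ℝ F x v = 0 → fderiv ℝ G x v = 0 := by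
    have : ∀ v, fderiv ℝ F x v = 0 → fderiv ℝ G x v ≤ 0 := by
      intro v hv
      by_contra! hc
      have := key (n + (|fderiv ℝ G x n| / fderiv ℝ G x v + 1) • v) (by simp [hn, hv])
      simp only [map_add, map_smul, smul_eq_mul] at this
      rw [add_mul, div_mul_cancel₀ _ hc.ne'] at this
      linarith [neg_abs_le (fderiv ℝ G x n)]
    intro v hv
    have h1 := this v hv
    have h2 := this (-v) (by simp [hv])
    simp at h2
    linarith
  have heq : fderiv ℝ G x = (-fderiv ℝ G x n) • fderiv ℝ F x := by
    ext v
    have := hker (v + fderiv ℝ F x v • n) (by simp [hn])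
    simp at this ⊢
    linarith
  refine ⟨-fderiv ℝ G x n, ?_, heq⟩
  have h1 := key n (by simp [hn])
  rcases h1.lt_or_eq with h1 | h1
  · linarith
  · rw [h1] at heq; simp at heq; exact absurd heq hG'

/-- If `{F < 0} ⊆ {G < 0}` near a common boundary point, the Hessians compare on tangent vectors: a
parabola that enters `{F < 0}` enters `{G < 0}`. -/
lemma hess_le_of_subset (hF : ContDiffAt ℝ 2 F x) (hG : ContDiffAt ℝ 2 G x)
    (hF0 : F x = 0) (hG0 : G x = 0) (hF' : fderiv ℝ F x ≠ 0) {c : ℝ} (hc : 0 < c)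
    (hFG : fderiv ℝ G x = c • fderiv ℝ F x) (h : ∀ᶠ y in 𝓝 x, F y < 0 → G y < 0)
    {v : E} (hv : fderiv ℝ F x v = 0) : hess G x v v ≤ c * hess F x v v := by
  obtain ⟨n, hn⟩ : ∃ n, fderiv ℝ F x n = -1 := by
    obtain ⟨n, hn⟩ : ∃ n, fderiv ℝ F x n ≠ 0 := by
      by_contra! hc
      exact hF' (ContinuousLinearMap.ext hc)
    exact ⟨-(fderiv ℝ F x n)⁻¹ • n, by simp [hn]⟩
  have main : ∀ s, hess F x v v < 2 * s → hess G x v v ≤ c * (2 * s) := by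
    intro s hs
    by_contra! hcon
    -- a parabola along which `F` is negative to second order
    have hcur : ∀ t : ℝ, HasDerivAt (fun t : ℝ => x + t • v + (s * t ^ 2) • n)
        (v + (2 * s * t) • n) t := by
      intro t
      have h1 := ((hasDerivAt_id t).smul_const v).const_add x
      have h2 := (((hasDerivAt_id t).pow 2).const_mul s).smul_const n
      refine (h1.add h2).congr_deriv ?_
      rw [one_smul]
      congr 2
      simp; ring
    have hcont : Tendsto (fun t : ℝ => x + t • v + (s * t ^ 2) • n) (𝓝 0) (𝓝 x) := by
      simpa using (hcur 0).continuousAt.tendsto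
    have second : ∀ {K : E → ℝ}, ContDiffAt ℝ 2 K x →
        (∀ᶠ t in 𝓝 (0 : ℝ), HasDerivAt (fun t : ℝ => K (x + t • v + (s * t ^ 2) • n))
          (fderiv ℝ K (x + t • v + (s * t ^ 2) • n) (v + (2 * s * t) • n)) t) ∧
        HasDerivAt (fun t : ℝ => fderiv ℝ K (x + t • v + (s * t ^ 2) • n) (v + (2 * s * t) • n))
          (hess K x v v + 2 * s * fderiv ℝ K x n) 0 := by
      intro K hK
      constructor
      · filter_upwards [hcont.eventually (hK.eventually (by decide))] with t ht
        exact hasDerivAt_comp_curve (c := fun t : ℝ => x + t • v + (s * t ^ 2) • n)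
          (ht.differentiableAt (by simp)) (hcur t)
      · have h1 : HasFDerivAt (fderiv ℝ K) (hess K x)
            (x + (0 : ℝ) • v + (s * (0 : ℝ) ^ 2) • n) := by
          simpa using hasFDerivAt_fderiv hK
        have h2 := h1.comp_hasDerivAt (f := fun t : ℝ => x + t • v + (s * t ^ 2) • n) 0 (hcur 0)
        have h3 : HasDerivAt (fun t : ℝ => v + (2 * s * t) • n) ((2 * s) • n) 0 := by
          simpa using (((hasDerivAt_id (0 : ℝ)).const_mul (2 * s)).smul_const n).const_add v
        simpa using h2.clm_apply h3
    have h1 := eventually_neg_of_second_deriv_neg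
      (φ := fun t : ℝ => F (x + t • v + (s * t ^ 2) • n))
      (by simp [hF0]) (by simp [hv]) (second hF).1 (second hF).2 (by rw [hn]; linarith)
    have h2 := eventually_neg_of_second_deriv_neg
      (φ := fun t : ℝ => -G (x + t • v + (s * t ^ 2) • n))
      (by simp [hG0]) (by simp [hv, hFG]) ((second hG).1.mono fun t ht => ht.neg)
      (second hG).2.neg (by simp [hFG, hn]; linarith)
    obtain ⟨t, ht1, ht2, ht3⟩ := (h1.and (h2.and
      ((hcont.mono_left nhdsWithin_le_nhds).eventually h))).exists
    linarith [ht3 ht1]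
  by_contra! hcon
  have := main ((hess F x v v + hess G x v v / c) / 4) (by
    have : hess F x v v < hess G x v v / c := by rw [lt_div_iff₀ hc]; linarith
    linarith)
  have h2 : c * (2 * ((hess F x v v + hess G x v v / c) / 4))
    = (c * hess F x v v + hess G x v v) / 2 := by field_simp; ring
  linarith

/-- Two defining functions of the same domain have, up to a common positive factor, the same
differential at a boundary point and the same Hessian on tangent vectors. -/
lemma second_order_proportional (hF : ContDiffAt ℝ 2 F x) (hG : ContDiffAt ℝ 2 G x)
    (hF0 : F x = 0) (hG0 : G x = 0) (hF' : fderiv ℝ F x ≠ 0) (hG' : fderiv ℝ G x ≠ 0)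
    (h : ∀ᶠ y in 𝓝 x, F y < 0 ↔ G y < 0) :
    ∃ c : ℝ, 0 < c ∧ fderiv ℝ G x = c • fderiv ℝ F x ∧
      ∀ v w, fderiv ℝ F x v = 0 → fderiv ℝ F x w = 0 → hess G x v w = c * hess F x v w := by
  obtain ⟨c, hc, hFG⟩ := fderiv_proportional (hF.differentiableAt (by simp))
    (hG.differentiableAt (by simp)) hF0 hG0 hF' hG' (h.mono fun y hy => hy.1)
  refine ⟨c, hc, hFG, ?_⟩
  have hGF : fderiv ℝ F x = c⁻¹ • fderiv ℝ G x := by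
    rw [hFG, smul_smul, inv_mul_cancel₀ hc.ne', one_smul]
  have hq : ∀ v, fderiv ℝ F x v = 0 → hess G x v v = c * hess F x v v := by
    intro v hv
    apply le_antisymm (hess_le_of_subset hF hG hF0 hG0 hF' hc hFG (h.mono fun y hy => hy.1) hv)
    have := hess_le_of_subset hG hF hG0 hF0 hG' (inv_pos.2 hc) hGF (h.mono fun y hy => hy.2)
      (v := v) (by simp [hFG, hv])
    rwa [inv_mul_eq_div, le_div_iff₀ hc, mul_comm] at this
  intro v w hv hw
  have h1 := hq v hv
  have h2 := hq w hw
  have h3 := hq (v + w) (by simp [hv, hw])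
  have h4 := hess_symm hF v w
  have h5 := hess_symm hG v w
  simp only [map_add, add_apply] at h3
  rw [← h4, ← h5] at h3
  linarith

/-- A one-form `a` that agrees on `{F = 0}`, on tangent vectors, with the D'Angelo form attached to
`F` and `n`: the Hermitian form `∂̄a` at a null vector of the Levi form. -/
lemma dbar_eq [CompleteSpace E] (hF : ContDiffAt ℝ 3 F x) (hF0 : F x = 0) {a : E → E →L[ℝ] ℝ}
    {n : E → E} (ha : ContDiffAt ℝ 1 a x) (hn : ContDiffAt ℝ 1 n x)
    (hdn : ∀ᶠ y in 𝓝 x, F y = 0 → fderiv ℝ F y (n y) = -1)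
    (hdIn : ∀ᶠ y in 𝓝 x, F y = 0 → fderiv ℝ F y (Complex.I • n y) = 0)
    (hag : ∀ᶠ y in 𝓝 x, F y = 0 → ∀ u, fderiv ℝ F y u = 0 → a y u = -leviB F y u (n y))
    {v : E} (hv : IsNull F x v) :
    -(fderiv ℝ a x v v + fderiv ℝ a x (Complex.I • v) (Complex.I • v)) =
      normalVariation F x (n x) v - leviSq F x (n x) v := by
  have hF2 : ContDiffAt ℝ 2 F x := hF.of_le (by norm_num)
  have sF : HasStrictFDerivAt F (fderiv ℝ F x) x := hF.hasStrictFDerivAt (by simp)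
  have sdF := hasStrictFDerivAt_fderiv hF2
  have sB := hasStrictFDerivAt_leviB hF
  have sa : HasStrictFDerivAt a (fderiv ℝ a x) x := ha.hasStrictFDerivAt (by simp)
  have sn : HasStrictFDerivAt n (fderiv ℝ n x) x := hn.hasStrictFDerivAt (by simp)
  have hn1 := hdn.self_of_nhds hF0
  have hn2 := hdIn.self_of_nhds hF0
  have hF' : fderiv ℝ F x ≠ 0 := fun h => by rw [h] at hn1; simp at hn1
  -- derivatives of the normalization of `n`
  have d1 : ∀ w, fderiv ℝ F x w = 0 → fderiv ℝ F x (fderiv ℝ n x w) = - hess F x w (n x) := by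
    intro w hw
    have := tangential_deriv_eq_zero sF hF0 hF' ((sdF.clm_apply sn).add_const 1)
      (by filter_upwards [hdn] with y hy hy0 using by simp [hy hy0]) hw
    simp at this; linarith
  have d2 : ∀ w, fderiv ℝ F x w = 0 → fderiv ℝ F x (Complex.I • fderiv ℝ n x w)
      = - hess F x w (Complex.I • n x) := by
    intro w hw
    have := tangential_deriv_eq_zero sF hF0 hF'
      (sdF.clm_apply ((mulI E).hasStrictFDerivAt.comp x sn))
      (by filter_upwards [hdIn] with y hy hy0 using by simpa using hy hy0) hw
    simp at this; linarith
  -- `u + dF(u) n` is tangent, so the one-form is known up to a multiple of `dF`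
  obtain ⟨c', sc⟩ : ∃ c', HasStrictFDerivAt (fun y => a y (n y) + leviB F y (n y) (n y)) c' x :=
    ⟨_, (sa.clm_apply sn).add ((sB.clm_apply sn).clm_apply sn)⟩
  have d3 : ∀ w, fderiv ℝ F x w = 0 → fderiv ℝ a x w w = -(hermPart (third F x w) w (n x)
      + leviB F x w (fderiv ℝ n x w))
      - (a x (n x) + leviB F x (n x) (n x)) * hess F x w w := by
    intro w hw
    have := tangential_deriv_eq_zero sF hF0 hF'
      (((sa.clm_apply (hasStrictFDerivAt_const w x)).add
        ((sB.clm_apply (hasStrictFDerivAt_const w x)).clm_apply sn)).add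
        ((sdF.clm_apply (hasStrictFDerivAt_const w x)).mul sc))
      (by
        filter_upwards [hdn, hag] with y hy hya hy0
        have := hya hy0 (w + fderiv ℝ F y w • n y) (by simp [hy hy0])
        simp at this ⊢
        linarith) hw
    simp [hw] at this
    simp; linarith
  have hv' := isNull_I hv
  have e1 := hv.leviB_eq hn1 hn2 (fderiv ℝ n x v)
  have e2 := hv'.leviB_eq hn1 hn2 (fderiv ℝ n x (Complex.I • v))
  rw [d1 v hv.1, d2 v hv.1] at e1
  rw [d1 _ hv'.1, d2 _ hv'.1] at e2
  rw [d3 v hv.1, d3 _ hv'.1, e1, e2]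
  have e3 := hv.2.2 v hv.1 hv.2.1
  have s := third_symm_left hF
  have s' := third_symm_right hF
  have e4 : hermPart (third F x v) v (n x) + hermPart (third F x (Complex.I • v)) (Complex.I • v)
      (n x) = hermPart (third F x (n x)) v v := by
    simp only [hermPart_apply, I_smul_I_smul]
    rw [s (n x) v v, s' v (n x) v, s (n x) (Complex.I • v) (Complex.I • v),
      s' (Complex.I • v) (n x), s v (Complex.I • v)]
    simp
    ring
  simp only [leviB_apply, I_smul_I_smul, normalVariation, leviSq, map_neg,
    neg_apply] at e3 e4 ⊢
  linear_combination e4 + (a x (n x) + (hess F x (n x) (n x)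
    + hess F x (Complex.I • n x) (Complex.I • n x))) * e3

end LocalLemmas

/-! ### The bracket formula, and plurisubharmonicity of `-(-F)^δ` -/

section LocalPlurisubharmonicity

set_option synthInstance.maxHeartbeats 400000

variable {E : Type*} [NormedAddCommGroup E] [NormedSpace ℂ E] {F G : E → ℝ} {x : E}

/-- The D'Angelo form attached to a pseudo-Hermitian structure that agrees up to a sign `ε` with
`-dF ∘ i` along `{F = 0}`. -/
lemma pseudoHermitian_lieBracket [CompleteSpace E] (hF : ContDiffAt ℝ 2 F x) (hF0 : F x = 0)
    {θ : E → E →L[ℝ] ℝ} {T V : E → E} {ε : ℝ} (hθ : ContDiffAt ℝ 1 θ x)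
    (hT : ContDiffAt ℝ 1 T x) (hV : ContDiffAt ℝ 1 V x)
    (hdT : ∀ᶠ y in 𝓝 x, F y = 0 → fderiv ℝ F y (T y) = 0)
    (hdV : ∀ᶠ y in 𝓝 x, F y = 0 → fderiv ℝ F y (V y) = 0)
    (hθT : ∀ᶠ y in 𝓝 x, F y = 0 → θ y (T y) = 1)
    (hθF : ∀ᶠ y in 𝓝 x, F y = 0 → ∀ u, fderiv ℝ F y u = 0 →
      θ y u = -(ε * fderiv ℝ F y (Complex.I • u))) :
    θ x (VectorField.lieBracket ℝ T (fun y => V y - θ y (V y) • T y) x) =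
      -(ε * leviB F x (V x) (Complex.I • T x)) := by
  have sF : HasStrictFDerivAt F (fderiv ℝ F x) x := hF.hasStrictFDerivAt (by simp)
  have sdF := hasStrictFDerivAt_fderiv hF
  have sT : HasStrictFDerivAt T (fderiv ℝ T x) x := hT.hasStrictFDerivAt (by simp)
  set W : E → E := fun y => V y - θ y (V y) • T y with hW
  have hWc : ContDiffAt ℝ 1 W x := hV.sub ((hθ.clm_apply hV).smul hT)
  have sW : HasStrictFDerivAt W (fderiv ℝ W x) x := hWc.hasStrictFDerivAt (by simp)
  have T0 := hdT.self_of_nhds hF0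
  have V0 := hdV.self_of_nhds hF0
  have T1 := hθT.self_of_nhds hF0
  have hε : -(ε * fderiv ℝ F x (Complex.I • T x)) = 1 := by
    rw [← hθF.self_of_nhds hF0 _ T0, T1]
  have hε0 : ε ≠ 0 := fun h => by simp [h] at hε
  have hF' : fderiv ℝ F x ≠ 0 := fun h => by rw [h] at hε; simp at hε
  have hWt : ∀ᶠ y in 𝓝 x, F y = 0 → fderiv ℝ F y (W y) = 0 := by
    filter_upwards [hdT, hdV] with y h1 h2 h0
    simp [hW, h1 h0, h2 h0]
  have W0 := hWt.self_of_nhds hF0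
  have a1 : hess F x (T x) (W x) + fderiv ℝ F x (fderiv ℝ W x (T x)) = 0 := by
    have := tangential_deriv_eq_zero sF hF0 hF' (sdF.clm_apply sW) hWt T0
    simp at this; linarith
  have a2 : hess F x (W x) (T x) + fderiv ℝ F x (fderiv ℝ T x (W x)) = 0 := by
    have := tangential_deriv_eq_zero sF hF0 hF' (sdF.clm_apply sT) hdT W0
    simp at this; linarith
  have a3 : hess F x (T x) (Complex.I • W x)
      + fderiv ℝ F x (Complex.I • fderiv ℝ W x (T x)) = 0 := by
    have := tangential_deriv_eq_zero sF hF0 hF'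
      (sdF.clm_apply ((mulI E).hasStrictFDerivAt.comp x sW)) (by
        filter_upwards [hθT, hθF, hWt] with y h1 h2 h3 h0
        have h4 : θ y (W y) = 0 := by simp [hW, h1 h0]
        have h5 := h2 h0 _ (h3 h0)
        rw [h4] at h5
        simpa [hε0] using h5) T0
    simp at this; linarith
  have a4 : hess F x (W x) (Complex.I • T x)
      + fderiv ℝ F x (Complex.I • fderiv ℝ T x (W x)) = 0 := by
    have := tangential_deriv_eq_zero sF hF0 hF'
      (((sdF.clm_apply ((mulI E).hasStrictFDerivAt.comp x sT)).const_mul ε).add_const 1) (by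
        filter_upwards [hθT, hθF, hdT] with y h1 h2 h3 h0
        have h5 := h2 h0 _ (h3 h0)
        rw [h1 h0] at h5
        simp; linarith) W0
    simp at this
    rw [← mul_add] at this
    have := (mul_eq_zero.1 this).resolve_left hε0
    linarith
  have hs := hess_symm hF
  rw [VectorField.lieBracket, hθF.self_of_nhds hF0 _ (by
    rw [map_sub]; rw [hs (W x)] at a2; linarith)]
  have e1 : leviB F x (V x) (Complex.I • T x) = leviB F x (W x) (Complex.I • T x) := by
    have : leviB F x (T x) (Complex.I • T x) = 0 := by
      have h1 := leviB_I_right F x (T x) (T x)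
      have h2 := leviB_symm hF (T x) (Complex.I • T x)
      linarith
    simp [hW, this]
  rw [e1, leviB_apply, I_smul_I_smul, smul_sub, map_sub, map_neg, hs _ (T x)]
  linear_combination ε * a4 - ε * a3

/-- Multiplying a defining function by a positive function with logarithm `f` adds `df` to the
D'Angelo form on null vectors. -/
lemma leviB_exp_mul {f : E → ℝ} (hF : ContDiffAt ℝ 2 F x) (hf : ContDiffAt ℝ 2 f x)
    (hF0 : F x = 0) {v n n' : E} (hv : IsNull F x v) (hn : fderiv ℝ F x n = -1)
    (hIn : fderiv ℝ F x (Complex.I • n) = 0)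
    (hn' : fderiv ℝ (fun z => Real.exp (f z) * F z) x n' = -1)
    (hIn' : fderiv ℝ (fun z => Real.exp (f z) * F z) x (Complex.I • n') = 0) :
    leviB (fun z => Real.exp (f z) * F z) x v n' = leviB F x v n - fderiv ℝ f x v := by
  have hfd := hf.differentiableAt (by simp)
  have he : ContDiffAt ℝ 2 (fun z => Real.exp (f z)) x := hf.exp
  have hfe : ∀ u, fderiv ℝ (fun z => Real.exp (f z)) x u = Real.exp (f x) * fderiv ℝ f x u := by
    intro u; rw [fderiv_exp hfd]; simp
  have hd : ∀ u, fderiv ℝ (fun z => Real.exp (f z) * F z) x u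
      = Real.exp (f x) * fderiv ℝ F x u := by
    intro u
    rw [fderiv_fun_mul (he.differentiableAt (by simp)) (hF.differentiableAt (by simp))]
    simp [hF0]
  rw [hd] at hn' hIn'
  have h2 := hv.leviB_eq hn hIn n'
  have h0 : fderiv ℝ F x (Complex.I • n') = 0 := by simpa using hIn'
  rw [h0] at h2
  rw [leviB_apply, hess_mul hF he, hess_mul hF he, hfe, hfe, hv.1, hv.2.1, h0, hF0]
  rw [leviB_apply] at h2
  linear_combination Real.exp (f x) * h2 + (fderiv ℝ f x v - leviB F x v n) * hn'

/-- Plurisubharmonicity of `-(-F)^δ` at a point of `{F < 0}` is nonnegativity of this quadratic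
form. -/
def dfForm (F : E → ℝ) (δ : ℝ) (y v : E) : ℝ := leviB F y v v + (1 - δ) / (-F y) * gradSq F y v

/-- The powers of `-F` enter the Hessian of `-(-F)^δ` only through a common positive factor. -/
lemma leviB_neg_rpow {δ : ℝ} (hF : ContDiffAt ℝ 2 F x) (hx : F x < 0) (v : E) :
    leviB (fun z => -(-F z) ^ δ) x v v = δ * (-F x) ^ (δ - 1) * dfForm F δ x v := by
  have h1 : ∀ (a t : ℝ), t < 0 → HasDerivAt (fun t : ℝ => (-t) ^ a) (-(a * (-t) ^ (a - 1))) t := by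
    intro a t ht
    have := (hasDerivAt_id t).neg.rpow_const (p := a) (Or.inl (by simp; exact ht.ne))
    refine this.congr_deriv ?_
    simp
  have h2 := leviB_comp_real (g := fun t => -(-t) ^ δ) (g' := fun t => δ * (-t) ^ (δ - 1))
    (g'' := -(δ * ((δ - 1) * (-F x) ^ (δ - 1 - 1)))) hF (by
      filter_upwards [eventually_lt_nhds hx] with t ht
      exact (h1 δ t ht).neg.congr_deriv (neg_neg _)) (by
      exact ((h1 (δ - 1) (F x) hx).const_mul δ).congr_deriv (by ring)) v
  rw [h2, dfForm, Real.rpow_sub_one (by linarith : -F x ≠ 0) (δ - 1)]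
  field_simp
  ring

lemma leviB_neg_rpow_nonneg_iff {δ : ℝ} (hδ : 0 < δ) (hF : ContDiffAt ℝ 2 F x) (hx : F x < 0)
    (v : E) : 0 ≤ leviB (fun z => -(-F z) ^ δ) x v v ↔ 0 ≤ dfForm F δ x v := by
  have : 0 < δ * (-F x) ^ (δ - 1) := mul_pos hδ (Real.rpow_pos_of_pos (by linarith) _)
  rw [leviB_neg_rpow hF hx, mul_nonneg_iff_of_pos_left this]

/-- Multiplying by `exp (-ε ψ)` with `ψ` plurisubharmonic and `|∂ψ|² ≤ ∂∂̄ψ` makes the form strictly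
positive at the cost of lowering the exponent by `2 ε`. -/
lemma dfForm_exp_mul {ψ : E → ℝ} {δ ε : ℝ} (hF : ContDiffAt ℝ 2 F x) (hψ : ContDiffAt ℝ 2 ψ x)
    (hx : F x < 0) (hδ : δ ≤ 1) (hε : 0 < ε) (hεδ : 2 * ε < δ) {v : E}
    (h : 0 ≤ dfForm F δ x v) (hg : gradSq ψ x v ≤ leviB ψ x v v) :
    -(Real.exp (-ε * ψ x) * F x) * (ε / 2 * leviB ψ x v v) ≤
      dfForm (fun z => Real.exp (-ε * ψ z) * F z) (δ - 2 * ε) x v := by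
  have hψd := hψ.differentiableAt (by simp)
  have he : ContDiffAt ℝ 2 (fun z => Real.exp (-ε * ψ z)) x := (contDiffAt_const.mul hψ).exp
  have h1 : ∀ t, HasDerivAt (fun t => Real.exp (-ε * t)) (-ε * Real.exp (-ε * t)) t := by
    intro t
    have := ((hasDerivAt_id t).const_mul (-ε)).exp
    simpa [mul_comm] using this
  have hfe := fderiv_comp_real (g := fun t => Real.exp (-ε * t)) hψd (h1 _)
  have hle := fun v => leviB_comp_real (g := fun t => Real.exp (-ε * t))
    (g' := fun t => -ε * Real.exp (-ε * t)) hψ (Eventually.of_forall h1)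
    ((h1 (ψ x)).const_mul (-ε)) v
  have hd : ∀ u, fderiv ℝ (fun z => Real.exp (-ε * ψ z) * F z) x u
      = Real.exp (-ε * ψ x) * (fderiv ℝ F x u - ε * F x * fderiv ℝ ψ x u) := by
    intro u
    rw [fderiv_fun_mul (he.differentiableAt (by simp)) (hF.differentiableAt (by simp))]
    simp only [add_apply, smul_apply, hfe, smul_eq_mul]; ring
  have hB : leviB (fun z => Real.exp (-ε * ψ z) * F z) x v v = Real.exp (-ε * ψ x) *
      (leviB F x v v - 2 * ε * (fderiv ℝ F x v * fderiv ℝ ψ x v +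
        fderiv ℝ F x (Complex.I • v) * fderiv ℝ ψ x (Complex.I • v))
        - ε * F x * leviB ψ x v v + ε ^ 2 * F x * gradSq ψ x v) := by
    have h3 : leviB (fun z => Real.exp (-ε * ψ z) * F z) x v v =
        Real.exp (-ε * ψ x) * leviB F x v v + 2 * (fderiv ℝ (fun z => Real.exp (-ε * ψ z)) x v *
          fderiv ℝ F x v + fderiv ℝ (fun z => Real.exp (-ε * ψ z)) x (Complex.I • v) *
          fderiv ℝ F x (Complex.I • v)) + F x * leviB (fun z => Real.exp (-ε * ψ z)) x v v := by
      simp only [leviB_apply, hess_mul hF he]; ring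
    rw [h3, hle, hfe, hfe]; ring
  set e := Real.exp (-ε * ψ x) with he'
  have hepos : 0 < e := Real.exp_pos _
  simp only [dfForm, gradSq, hd] at *
  rw [hB]
  generalize fderiv ℝ F x v = a at *
  generalize fderiv ℝ F x (Complex.I • v) = a' at *
  generalize fderiv ℝ ψ x v = b at *
  generalize fderiv ℝ ψ x (Complex.I • v) = b' at *
  generalize leviB F x v v = L at *
  generalize leviB ψ x v v = K at *
  obtain ⟨s, hs⟩ : ∃ s, s = -F x := ⟨_, rfl⟩
  have hs0 : 0 < s := by linarith
  rw [show F x = -s by linarith] at h ⊢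
  -- express the differential of `F` relative to `-F`
  obtain ⟨A, rfl⟩ : ∃ A, a = s * A := ⟨a / s, by field_simp⟩
  obtain ⟨A', rfl⟩ : ∃ A', a' = s * A' := ⟨a' / s, by field_simp⟩
  have hL : -(s * (1 - δ) * (A ^ 2 + A' ^ 2)) ≤ L := by
    have : (1 - δ) / - -s * ((s * A) ^ 2 + (s * A') ^ 2) = s * (1 - δ) * (A ^ 2 + A' ^ 2) := by
      field_simp
    linarith
  have hQ : ∀ A b : ℝ, 0 ≤ 2 * A ^ 2 - 2 * (δ - 2 * ε) * (A * b)
      + (1 / 2 - (δ - 2 * ε) * ε) * b ^ 2 := by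
    intro A b
    nlinarith [sq_nonneg (2 * A - (δ - 2 * ε) * b), sq_nonneg b,
      mul_nonneg (sub_nonneg.2 hδ) (sq_nonneg b),
      mul_nonneg (mul_nonneg (sub_nonneg.2 hδ) (by linarith : 0 ≤ δ - 2 * ε)) (sq_nonneg b)]
  have key : e * s * (ε / 2 * K) ≤ e * (-(s * (1 - δ) * (A ^ 2 + A' ^ 2))
      - 2 * ε * (s * A * b + s * A' * b') + ε * s * K - ε ^ 2 * s * (b ^ 2 + b' ^ 2))
      + e * s * ((1 - (δ - 2 * ε)) * ((A + ε * b) ^ 2 + (A' + ε * b') ^ 2)) := by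
    have h5 : 0 ≤ e * s * ε * ((2 * A ^ 2 - 2 * (δ - 2 * ε) * (A * b)
      + (1 / 2 - (δ - 2 * ε) * ε) * b ^ 2) + (2 * A' ^ 2 - 2 * (δ - 2 * ε) * (A' * b')
      + (1 / 2 - (δ - 2 * ε) * ε) * b' ^ 2) + (K - (b ^ 2 + b' ^ 2)) / 2) := by
      have := hQ A b
      have := hQ A' b'
      have : 0 ≤ (K - (b ^ 2 + b' ^ 2)) / 2 := by linarith
      positivity
    linarith
  have e1 : (1 - (δ - 2 * ε)) / -(e * -s) * ((e * (s * A - ε * -s * b)) ^ 2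
      + (e * (s * A' - ε * -s * b')) ^ 2)
      = e * s * ((1 - (δ - 2 * ε)) * ((A + ε * b) ^ 2 + (A' + ε * b') ^ 2)) := by
    field_simp
    ring
  rw [e1]
  have := mul_le_mul_of_nonneg_left hL hepos.le
  linarith

end LocalPlurisubharmonicity

/-! ### From plurisubharmonicity to a boundary inequality -/

section BoundaryLimit

set_option synthInstance.maxHeartbeats 400000

variable {E : Type*} [NormedAddCommGroup E] [NormedSpace ℂ E] {F : E → ℝ} {x : E}

lemma hasDerivAt_along_line {W : Type*} [NormedAddCommGroup W] [NormedSpace ℝ W] {f : E → W}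
    {f' : E →L[ℝ] W} (hf : HasFDerivAt f f' x) (n : E) :
    HasDerivAt (fun s : ℝ => f (x + s • n)) (f' n) 0 := by
  have hc : HasDerivAt (fun s : ℝ => x + s • n) n 0 := by
    simpa using ((hasDerivAt_id (0 : ℝ)).smul_const n).const_add x
  have : HasFDerivAt f f' (x + (0 : ℝ) • n) := by simpa using hf
  exact this.comp_hasDerivAt 0 hc

/-- A lower bound for the plurisubharmonicity form near a boundary point yields, in the limit along
an inner normal, a bound for the normal variation of the Levi form on null vectors. -/
lemma le_normalVariation_of_dfForm {n v : E} {δ : ℝ} {κ : E → E → ℝ} (hF : ContDiffAt ℝ 3 F x)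
    (hF0 : F x = 0) (hn : fderiv ℝ F x n = -1) (hIn : fderiv ℝ F x (Complex.I • n) = 0)
    (hδ1 : δ < 1) (hv : IsNull F x v) (hκ : ContinuousAt (Function.uncurry κ) (x, v))
    (h : ∀ᶠ q in 𝓝 x, F q < 0 → ∀ Z, -F q * κ q Z ≤ dfForm F δ q Z) :
    κ x v ≤ normalVariation F x n v - leviSq F x n v / (1 - δ) := by
  have hF2 : ContDiffAt ℝ 2 F x := hF.of_le (by norm_num)
  have h1δ : 0 < 1 - δ := by linarith
  set P := leviB F x v n with hP
  set Q := leviB F x (Complex.I • v) n with hQ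
  -- the correction of `v` that minimizes the limiting quadratic form
  set a := hess F x n v - P / (1 - δ) with ha
  set b := Q / (1 - δ) - hess F x n (Complex.I • v) with hb
  set u : E := a • n + b • Complex.I • n with hu
  have hdu : fderiv ℝ F x u = -a := by simp [hu, hn, hIn]
  have hIu : Complex.I • u = a • Complex.I • n - b • n := by
    rw [hu, smul_add, smul_comm Complex.I, smul_comm Complex.I, I_smul_I_smul]
    simp [sub_eq_add_neg]
  have hdIu : fderiv ℝ F x (Complex.I • u) = b := by rw [hIu]; simp [hn, hIn]
  have hc : HasDerivAt (fun s : ℝ => x + s • n) n 0 := by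
    simpa using ((hasDerivAt_id (0 : ℝ)).smul_const n).const_add x
  have hz : HasDerivAt (fun s : ℝ => v + s • u) u 0 := by
    simpa using ((hasDerivAt_id (0 : ℝ)).smul_const u).const_add v
  have hIz : HasDerivAt (fun s : ℝ => Complex.I • (v + s • u)) (Complex.I • u) 0 :=
    (mulI E).hasFDerivAt.comp_hasDerivAt (0 : ℝ) hz
  have x0 : x + (0 : ℝ) • n = x := by simp
  have v0 : v + (0 : ℝ) • u = v := by simp
  have dF : HasDerivAt (fun s : ℝ => F (x + s • n)) (-1) 0 := by
    rw [← hn]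
    exact hasDerivAt_along_line (hF.differentiableAt (by simp)).hasFDerivAt n
  have ddF : HasDerivAt (fun s : ℝ => fderiv ℝ F (x + s • n)) (hess F x n) 0 :=
    hasDerivAt_along_line (hasFDerivAt_fderiv hF2) n
  have dB : HasDerivAt (fun s : ℝ => leviB F (x + s • n)) (hermPart (third F x n)) 0 := by
    have := hasDerivAt_along_line (hasStrictFDerivAt_leviB hF).hasFDerivAt n
    rwa [ContinuousLinearMap.comp_apply] at this
  have t1 := (ddF.clm_apply hz).tendsto_slope_zero_right
  have t2 := (ddF.clm_apply hIz).tendsto_slope_zero_right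
  have t3 := ((dB.clm_apply hz).clm_apply hz).tendsto_slope_zero_right
  have t4 := dF.tendsto_slope_zero_right
  have hB0 : leviB F x v v = 0 := hv.2.2 v hv.1 hv.2.1
  simp only [zero_add, x0, v0, hF0, hB0, hv.1, hv.2.1, sub_zero, smul_eq_mul] at t1 t2 t3 t4
  have tκ : Tendsto (fun s : ℝ => κ (x + s • n) (v + s • u)) (𝓝[>] 0) (𝓝 (κ x v)) := by
    have h1 : Tendsto (fun s : ℝ => (x + s • n, v + s • u)) (𝓝[>] 0) (𝓝 (x, v)) := by
      have := (hc.continuousAt.prodMk hz.continuousAt).tendsto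
      rw [x0, v0] at this
      exact this.mono_left nhdsWithin_le_nhds
    exact hκ.tendsto.comp h1
  have tq : Tendsto (fun s : ℝ => x + s • n) (𝓝[>] 0) (𝓝 x) := by
    have := hc.continuousAt.tendsto
    rw [x0] at this
    exact this.mono_left nhdsWithin_le_nhds
  have hneg : ∀ᶠ s in 𝓝[>] (0 : ℝ), F (x + s • n) < 0 :=
    eventually_neg_of_deriv_neg (φ := fun s : ℝ => F (x + s • n)) (by simp [hF0]) dF (by norm_num)
  have hL := (t4.neg).mul tκ
  have hR := t3.add ((t4.neg.inv₀ (by norm_num)).const_mul (1 - δ) |>.mul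
    ((t1.pow 2).add (t2.pow 2)))
  have hfin := le_of_tendsto_of_tendsto hL hR (by
    filter_upwards [hneg, tq.eventually h, self_mem_nhdsWithin] with s hs hs2 (hs0 : 0 < s)
    have h3 := hs2 hs (v + s • u)
    rw [dfForm, gradSq] at h3
    have hs1 : -F (x + s • n) ≠ 0 := by linarith
    have h4 := mul_le_mul_of_nonneg_left h3 (inv_pos.2 hs0).le
    calc -(s⁻¹ * F (x + s • n)) * κ (x + s • n) (v + s • u)
        = s⁻¹ * (-F (x + s • n) * κ (x + s • n) (v + s • u)) := by ring
      _ ≤ _ := h4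
      _ = _ := by
        field_simp)
  have hsym : hess F x n v = hess F x v n := hess_symm hF2 n v
  have hsymI := hess_symm hF2 n (Complex.I • v)
  have hBu : leviB F x v u = a * P - b * Q := by
    rw [hv.leviB_eq hn hIn u, hdu, hdIu]; ring
  have hBu' : leviB F x u v = a * P - b * Q := by rw [leviB_symm hF2, hBu]
  simp only [add_apply, neg_neg, inv_one, mul_one, one_mul,
    hdu, hdIu, hBu, hBu'] at hfin
  rw [normalVariation, leviSq, ← hP, ← hQ, ← hsym, ← hsymI]
  have e1 : (P ^ 2 + Q ^ 2) / (1 - δ) = (1 - δ) * ((P / (1 - δ)) ^ 2 + (Q / (1 - δ)) ^ 2) := by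
    field_simp
  have e2 : P ^ 2 + Q ^ 2 = (1 - δ) * (P * (P / (1 - δ)) + Q * (Q / (1 - δ))) := by
    field_simp
  have e3 : P * (P / (1 - δ)) + Q * (Q / (1 - δ)) = (P ^ 2 + Q ^ 2) / (1 - δ) := by
    field_simp
  rw [ha, hb] at hfin
  refine hfin.trans_eq ?_
  linear_combination (-2 : ℝ) * e3 - e1

/-- Where the Levi form is nonnegative, the vectors on which its diagonal vanishes are null vectors
(Cauchy–Schwarz). -/
lemma isNull_of_leviB_self_eq_zero (hF : ContDiffAt ℝ 2 F x)
    (hpos : ∀ v, fderiv ℝ F x v = 0 → fderiv ℝ F x (Complex.I • v) = 0 → 0 ≤ leviB F x v v)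
    {v : E} (hv : fderiv ℝ F x v = 0) (hIv : fderiv ℝ F x (Complex.I • v) = 0)
    (h0 : leviB F x v v = 0) : IsNull F x v := by
  refine ⟨hv, hIv, fun w hw hIw => ?_⟩
  -- a quadratic polynomial in `t` without constant term, hence without linear term
  have key : ∀ t : ℝ, 0 ≤ 2 * t * leviB F x v w + t ^ 2 * leviB F x w w := by
    intro t
    have h1 := hpos (v + t • w) (by simp [hv, hw]) (by
      rw [smul_add, smul_comm]; simp [hIv, hIw])
    simp only [map_add, map_smul, add_apply, smul_apply, smul_eq_mul, h0,
      leviB_symm hF w v] at h1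
    linarith
  by_contra hne
  have hww := hpos w hw hIw
  have := key (-leviB F x v w / (leviB F x w w + 1))
  have h3 : 2 * (-leviB F x v w / (leviB F x w w + 1)) * leviB F x v w
      + (-leviB F x v w / (leviB F x w w + 1)) ^ 2 * leviB F x w w
      = -(leviB F x v w ^ 2 * (leviB F x w w + 2)) / (leviB F x w w + 1) ^ 2 := by
    field_simp; ring
  rw [h3] at this
  have h4 : 0 < leviB F x v w ^ 2 * (leviB F x w w + 2) / (leviB F x w w + 1) ^ 2 := by
    positivity
  rw [neg_div] at this
  linarith

/-- Difference quotients with a moving base point; strict differentiability makes them converge. -/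
lemma tendsto_slope_of_hasStrictFDerivAt {W : Type*} [NormedAddCommGroup W] [NormedSpace ℝ W]
    {f : E → W} {f' : E →L[ℝ] W} (hf : HasStrictFDerivAt f f' x) {ι : Type*} {l : Filter ι}
    {p : ι → E} {σ : ι → ℝ} {n : E} (hp : Tendsto p l (𝓝 x)) (hσ : Tendsto σ l (𝓝 0))
    (hσ0 : ∀ᶠ i in l, 0 < σ i) :
    Tendsto (fun i => (σ i)⁻¹ • (f (p i + σ i • n) - f (p i))) l (𝓝 (f' n)) := by
  have hq : Tendsto (fun i => p i + σ i • n) l (𝓝 x) := by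
    simpa using hp.add (hσ.smul_const n)
  have h1 := (hasStrictFDerivAt_iff_isLittleO.1 hf).comp_tendsto (hq.prodMk_nhds hp)
  have h2 : (fun i => f (p i + σ i • n) - f (p i) - f' (σ i • n)) =o[l] σ := by
    have h3 : (fun i => σ i • n) =O[l] σ := by
      apply Asymptotics.IsBigO.of_bound ‖n‖
      filter_upwards with i
      rw [norm_smul, mul_comm]
    simp only [Function.comp_def, add_sub_cancel_left] at h1
    exact h1.trans_isBigO h3
  have h3 := h2.tendsto_inv_smul_nhds_zero
  rw [← tendsto_sub_nhds_zero_iff]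
  refine h3.congr' ?_
  filter_upwards [hσ0] with i hi
  rw [smul_sub, map_smul, smul_smul, inv_mul_cancel₀ hi.ne', one_smul]

end BoundaryLimit

/-! ### From the boundary inequality to plurisubharmonicity nearby -/

section NearBoundary

set_option synthInstance.maxHeartbeats 400000

variable {E : Type*} [NormedAddCommGroup E] [NormedSpace ℂ E] {F : E → ℝ} {x : E}

lemma _root_.Filter.Tendsto.clm_apply' {W V ι : Type*} [NormedAddCommGroup W] [NormedSpace ℝ W]
    [NormedAddCommGroup V] [NormedSpace ℝ V] {l : Filter ι} {f : ι → W →L[ℝ] V} {f₀ : W →L[ℝ] V}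
    {g : ι → W} {g₀ : W} (hf : Tendsto f l (𝓝 f₀)) (hg : Tendsto g l (𝓝 g₀)) :
    Tendsto (fun i => f i (g i)) l (𝓝 (f₀ g₀)) :=
  (isBoundedBilinearMap_apply.continuous.tendsto (f₀, g₀)).comp (hf.prodMk_nhds hg)

/-- Limit of a family of vectors, based at points `p i + σ i • n` tending to a boundary point, on
which the plurisubharmonicity form is negative: the limit is a null vector of the Levi form, and the
rescaled limit of the form is nonpositive. Here `X` and `Y` are the components of `∂F` rescaled by
the distance `σ` to the boundary. -/
lemma limit_of_dfForm_neg {ι : Type*} {l : Filter ι} [l.NeBot] {n z : E} {δ a b : ℝ}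
    {p Z : ι → E} {σ X Y : ι → ℝ}
    (hF : ContDiffAt ℝ 3 F x) (hF0 : F x = 0) (hn : fderiv ℝ F x n = -1)
    (hIn : fderiv ℝ F x (Complex.I • n) = 0) (hδ1 : δ < 1)
    (hpsc : ∀ᶠ y in 𝓝 x, F y = 0 → ∀ v, fderiv ℝ F y v = 0 → fderiv ℝ F y (Complex.I • v) = 0 →
      0 ≤ leviB F y v v)
    (hp : Tendsto p l (𝓝 x)) (hσ : Tendsto σ l (𝓝 0)) (hσ0 : ∀ᶠ i in l, 0 < σ i)
    (hFp : ∀ᶠ i in l, F (p i) = 0) (hneg : ∀ᶠ i in l, F (p i + σ i • n) < 0)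
    (hX : ∀ᶠ i in l, fderiv ℝ F (p i + σ i • n) (Z i) = σ i * X i)
    (hY : ∀ᶠ i in l, fderiv ℝ F (p i + σ i • n) (Complex.I • Z i) = σ i * Y i)
    (hbad : ∀ᶠ i in l, dfForm F δ (p i + σ i • n) (Z i) < 0)
    (hZ : Tendsto Z l (𝓝 z)) (hXa : Tendsto X l (𝓝 a)) (hYb : Tendsto Y l (𝓝 b)) :
    IsNull F x z ∧ normalVariation F x n z - 2 * (leviB F x z n * a +
      leviB F x (Complex.I • z) n * b) + (1 - δ) * (a ^ 2 + b ^ 2) ≤ 0 := by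
  have hF2 : ContDiffAt ℝ 2 F x := hF.of_le (by norm_num)
  have h1δ : 0 < 1 - δ := by linarith
  have hq : Tendsto (fun i => p i + σ i • n) l (𝓝 x) := by
    simpa using hp.add (hσ.smul_const n)
  have hIZ : Tendsto (fun i => Complex.I • Z i) l (𝓝 (Complex.I • z)) :=
    (mulI E).continuous.continuousAt.tendsto.comp hZ
  have cdF : ContinuousAt (fderiv ℝ F) x := (hasFDerivAt_fderiv hF2).continuousAt
  have cB : ContinuousAt (leviB F) x := continuousAt_leviB hF2
  have tdq := cdF.tendsto.comp hq
  have tdp := cdF.tendsto.comp hp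
  have tBq := cB.tendsto.comp hq
  have tBp := cB.tendsto.comp hp
  -- the limit is complex tangential
  have hz1 : fderiv ℝ F x z = 0 := by
    have h1 := tdq.clm_apply' hZ
    have h2 := hσ.mul hXa
    rw [zero_mul] at h2
    exact tendsto_nhds_unique (h1.congr' (by filter_upwards [hX] with i hi using hi)) h2
  have hz2 : fderiv ℝ F x (Complex.I • z) = 0 := by
    have h1 := tdq.clm_apply' hIZ
    have h2 := hσ.mul hYb
    rw [zero_mul] at h2
    exact tendsto_nhds_unique (h1.congr' (by filter_upwards [hY] with i hi using hi)) h2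
  have hz0 : leviB F x z z ≤ 0 := by
    refine le_of_tendsto ((tBq.clm_apply' hZ).clm_apply' hZ) ?_
    filter_upwards [hbad, hneg] with i hi hi2
    rw [dfForm] at hi
    have : 0 ≤ (1 - δ) / (-F (p i + σ i • n)) * gradSq F (p i + σ i • n) (Z i) := by
      apply mul_nonneg (div_nonneg h1δ.le (by linarith))
      rw [gradSq]; positivity
    simp only [Function.comp]
    linarith
  have hpx := hpsc.self_of_nhds hF0
  have hnull : IsNull F x z := isNull_of_leviB_self_eq_zero hF2 hpx hz1 hz2
    (le_antisymm hz0 (hpx z hz1 hz2))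
  refine ⟨hnull, ?_⟩
  have tA := tendsto_slope_of_hasStrictFDerivAt (hasStrictFDerivAt_leviB hF) hp hσ hσ0 (n := n)
  have tD := tendsto_slope_of_hasStrictFDerivAt (hasStrictFDerivAt_fderiv hF2) hp hσ hσ0 (n := n)
  have tρ := tendsto_slope_of_hasStrictFDerivAt (hF.hasStrictFDerivAt (by simp)) hp hσ hσ0 (n := n)
  rw [ContinuousLinearMap.comp_apply] at tA
  rw [hn] at tρ
  set ν : ι → ℝ := fun i => fderiv ℝ F (p i) n
  set μ : ι → ℝ := fun i => fderiv ℝ F (p i) (Complex.I • n)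
  have tν : Tendsto ν l (𝓝 (-1)) := by rw [← hn]; exact tdp.clm_apply' tendsto_const_nhds
  have tμ : Tendsto μ l (𝓝 0) := by rw [← hIn]; exact tdp.clm_apply' tendsto_const_nhds
  set D : ι → E →L[ℝ] ℝ := fun i => (σ i)⁻¹ • (fderiv ℝ F (p i + σ i • n) - fderiv ℝ F (p i))
  set ξ : ι → ℝ := fun i => X i - D i (Z i)
  set η : ι → ℝ := fun i => Y i - D i (Complex.I • Z i)
  have tξ : Tendsto ξ l (𝓝 (a - hess F x n z)) := hXa.sub (tD.clm_apply' hZ)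
  have tη : Tendsto η l (𝓝 (b - hess F x n (Complex.I • z))) := hYb.sub (tD.clm_apply' hIZ)
  -- Compare `Z i` with its projection `Z i - σ i • u i` to the complex tangent space at `p i`,
  -- where the Levi form is nonnegative by pseudoconvexity; here `u i = c i • n + d i • (i n)`.
  set c : ι → ℝ := fun i => (ξ i * ν i + η i * μ i) / (ν i ^ 2 + μ i ^ 2)
  set d : ι → ℝ := fun i => (ξ i * μ i - η i * ν i) / (ν i ^ 2 + μ i ^ 2)
  have tden := ((tν.pow 2).add (tμ.pow 2))
  have tc : Tendsto c l (𝓝 (hess F x n z - a)) := by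
    have := ((tξ.mul tν).add (tη.mul tμ)).div tden (by norm_num)
    simpa [Pi.div_def] using this
  have td : Tendsto d l (𝓝 (b - hess F x n (Complex.I • z))) := by
    have := ((tξ.mul tμ).sub (tη.mul tν)).div tden (by norm_num)
    simpa [Pi.div_def] using this
  set u : ι → E := fun i => c i • n + d i • Complex.I • n
  have tu : Tendsto u l (𝓝 ((hess F x n z - a) • n
      + (b - hess F x n (Complex.I • z)) • Complex.I • n)) :=
    (tc.smul_const n).add (td.smul_const _)
  have hlim := (((tA.clm_apply' hZ).clm_apply' hZ).add
    (((tBp.clm_apply' hZ).clm_apply' tu).const_mul 2)).sub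
    (hσ.mul ((tBp.clm_apply' tu).clm_apply' tu)) |>.add
    ((tρ.neg.inv₀ (by norm_num)).const_mul (1 - δ) |>.mul ((hXa.pow 2).add (hYb.pow 2)))
  have hfin := le_of_tendsto hlim (b := 0) (by
    have hden : ∀ᶠ i in l, 0 < ν i ^ 2 + μ i ^ 2 :=
      tden.eventually (lt_mem_nhds (by norm_num))
    filter_upwards [hden, hσ0, hFp, hneg, hX, hY, hbad, hp.eventually hpsc,
      hp.eventually (hF2.eventually (by decide))]
      with i hi hs h0 hng hXi hYi hb hpi hFi
    have hs' := hs.ne'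
    have e1 : fderiv ℝ F (p i) (Z i) = σ i * ξ i := by
      simp only [ξ, D, smul_apply, sub_apply, smul_eq_mul, mul_sub, mul_inv_cancel_left₀ hs', hXi]
      ring
    have e2 : fderiv ℝ F (p i) (Complex.I • Z i) = σ i * η i := by
      simp only [η, D, smul_apply, sub_apply, smul_eq_mul, mul_sub, mul_inv_cancel_left₀ hs', hYi]
      ring
    have hIu : Complex.I • u i = c i • Complex.I • n - d i • n := by
      simp only [u]
      rw [smul_add, smul_comm Complex.I, smul_comm Complex.I, I_smul_I_smul]
      simp [sub_eq_add_neg]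
    have e3 : fderiv ℝ F (p i) (u i) = ξ i := by
      have : fderiv ℝ F (p i) (u i) = c i * ν i + d i * μ i := by simp [u, ν, μ]
      rw [this]; simp only [c, d]; field_simp; ring
    have e4 : fderiv ℝ F (p i) (Complex.I • u i) = η i := by
      have : fderiv ℝ F (p i) (Complex.I • u i) = c i * μ i - d i * ν i := by
        rw [hIu]; simp [ν, μ]
      rw [this]; simp only [c, d]; field_simp; ring
    have h5 := hpi h0 (Z i - σ i • u i) (by simp [e1, e3]) (by
      rw [smul_sub, smul_comm]; simp [e2, e4])
    simp only [map_sub, map_smul, sub_apply, smul_apply, smul_eq_mul,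
      leviB_symm hFi (u i) (Z i)] at h5
    rw [dfForm, gradSq, hXi, hYi] at hb
    have hng' : -F (p i + σ i • n) ≠ 0 := by linarith
    have h6 : (σ i)⁻¹ * (leviB F (p i + σ i • n) (Z i) (Z i)
        + (1 - δ) / -F (p i + σ i • n) * ((σ i * X i) ^ 2 + (σ i * Y i) ^ 2)) ≤ 0 :=
      mul_nonpos_of_nonneg_of_nonpos (inv_pos.2 hs).le hb.le
    have h7 := mul_nonneg (inv_pos.2 hs).le h5
    simp only [Function.comp, smul_apply, sub_apply, smul_eq_mul, h0, sub_zero]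
    have h8 : (1 - δ) * (-((σ i)⁻¹ * F (p i + σ i • n)))⁻¹ * (X i ^ 2 + Y i ^ 2)
      = (σ i)⁻¹ * ((1 - δ) / -F (p i + σ i • n) * ((σ i * X i) ^ 2 + (σ i * Y i) ^ 2)) := by
      field_simp
    rw [h8]
    rw [mul_add] at h6
    have h9 : (σ i)⁻¹ * (leviB F (p i) (Z i) (Z i) - σ i * leviB F (p i) (Z i) (u i)
        - σ i * (leviB F (p i) (Z i) (u i) - σ i * leviB F (p i) (u i) (u i)))
        = (σ i)⁻¹ * leviB F (p i) (Z i) (Z i) - 2 * leviB F (p i) (Z i) (u i)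
          + σ i * leviB F (p i) (u i) (u i) := by
      field_simp; ring
    rw [h9] at h7
    rw [mul_sub]
    linarith)
  have hBu := hnull.leviB_eq hn hIn ((hess F x n z - a) • n
      + (b - hess F x n (Complex.I • z)) • Complex.I • n)
  have hIu : Complex.I • ((hess F x n z - a) • n
      + (b - hess F x n (Complex.I • z)) • Complex.I • n) = (hess F x n z - a) • Complex.I • n -
        (b - hess F x n (Complex.I • z)) • n := by
    rw [smul_add, smul_comm Complex.I, smul_comm Complex.I, I_smul_I_smul]
    simp [sub_eq_add_neg]
  rw [hIu] at hBu
  simp only [map_add, map_sub, map_smul, smul_eq_mul, hn, hIn] at hBu hfin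
  rw [hBu] at hfin
  rw [normalVariation, ← hess_symm hF2 n z, ← hess_symm hF2 n (Complex.I • z)]
  refine le_of_eq_of_le ?_ hfin
  norm_num
  ring

/-- Points of `{F < 0}` near a boundary point are reached from the boundary along `n`. -/
lemma exists_boundary_point {n : E} (hF : ContDiffAt ℝ 1 F x) (hF0 : F x = 0)
    (hn : fderiv ℝ F x n = -1) {ε : ℝ} (hε : 0 < ε) :
    ∀ᶠ q in 𝓝 x, F q < 0 → ∃ σ, 0 < σ ∧ σ < ε ∧ F (q - σ • n) = 0 := by
  obtain ⟨r, hr, hcont⟩ : ∃ r > 0, ∀ y ∈ Metric.ball x r, ContDiffAt ℝ 1 F y :=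
    Metric.eventually_nhds_iff_ball.1 (hF.eventually (by decide))
  have h1 : ∀ᶠ s in 𝓝[>] (0 : ℝ), -F (x + s • (-n)) < 0 := by
    have := hasDerivAt_along_line (hF.differentiableAt (by simp)).hasFDerivAt (-n)
    exact eventually_neg_of_deriv_neg (by simp [hF0]) this.neg (by simp [hn])
  have h2 : ∀ᶠ s in 𝓝[>] (0 : ℝ), s < ε ∧ s * ‖n‖ < r / 2 := by
    have : Tendsto (fun s : ℝ => s * ‖n‖) (𝓝[>] 0) (𝓝 0) := by
      have : Tendsto (fun s : ℝ => s * ‖n‖) (𝓝 0) (𝓝 (0 * ‖n‖)) := tendsto_id.mul_const _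
      rw [zero_mul] at this
      exact this.mono_left nhdsWithin_le_nhds
    exact ((eventually_lt_nhds hε).filter_mono nhdsWithin_le_nhds).and
      (this.eventually (eventually_lt_nhds (by positivity)))
  obtain ⟨s, hs1, ⟨hs2, hs3⟩, hs0⟩ := (h1.and (h2.and self_mem_nhdsWithin)).exists
  have hs0 : 0 < s := hs0
  have hxs : x + s • (-n) ∈ Metric.ball x r := by
    simp [norm_smul, abs_of_pos hs0]; linarith
  have h3 : ∀ᶠ q in 𝓝 x, 0 < F (q + s • (-n)) := by
    have : Tendsto (fun q => F (q + s • (-n))) (𝓝 x) (𝓝 (F (x + s • (-n)))) :=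
      (hcont _ hxs).continuousAt.tendsto.comp
        ((continuous_id.add continuous_const).continuousAt (x := x))
    exact this.eventually (lt_mem_nhds (by linarith))
  filter_upwards [h3, Metric.ball_mem_nhds x (half_pos hr)] with q hq hqb hqn
  have hcq : ContinuousOn (fun t : ℝ => F (q - t • n)) (Icc 0 s) := by
    intro t ht
    have hmem : q - t • n ∈ Metric.ball x r := by
      rw [mem_ball_iff_norm] at hqb ⊢
      calc ‖q - t • n - x‖ = ‖(q - x) - t • n‖ := by congr 1; abel
        _ ≤ ‖q - x‖ + ‖t • n‖ := norm_sub_le _ _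
        _ < r / 2 + r / 2 := by
          have : ‖t • n‖ ≤ s * ‖n‖ := by
            rw [norm_smul, Real.norm_eq_abs, abs_of_nonneg ht.1]
            exact mul_le_mul_of_nonneg_right ht.2 (norm_nonneg _)
          linarith
        _ = r := by ring
    have h4 : ContinuousAt (fun t : ℝ => q - t • n) t := by fun_prop
    exact (ContinuousAt.comp (g := F) (f := fun t : ℝ => q - t • n) (x := t)
      (hcont _ hmem).continuousAt h4).continuousWithinAt
  have hsq : F (q - s • n) = F (q + s • (-n)) := by rw [smul_neg, sub_eq_add_neg]
  obtain ⟨t, ht, ht0⟩ := intermediate_value_Icc hs0.le hcq (show (0 : ℝ) ∈ Icc _ _ by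
    simp only [zero_smul, sub_zero, hsq]; exact ⟨hqn.le, hq.le⟩)
  refine ⟨t, lt_of_le_of_ne ht.1 ?_, lt_of_le_of_lt ht.2 hs2, ht0⟩
  rintro rfl
  simp at ht0; linarith

lemma dfForm_smul (δ t : ℝ) (v : E) : dfForm F δ x (t • v) = t ^ 2 * dfForm F δ x v := by
  simp only [dfForm, gradSq, smul_comm Complex.I t, map_smul, smul_apply, smul_eq_mul]; ring

/-- If the normal variation of the Levi form dominates the D'Angelo form on null vectors, then
`-(-F)^δ` is plurisubharmonic on `{F < 0}` near the boundary point. Otherwise there are points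
tending to the boundary with negative vectors; these are normalized together with the components of
`∂F` rescaled by the distance to the boundary, so that `limit_of_dfForm_neg` applies to a
subsequence. -/
lemma eventually_dfForm_nonneg [ProperSpace E] {n : E} {δ : ℝ}
    (hF : ContDiffAt ℝ 3 F x) (hF0 : F x = 0) (hn : fderiv ℝ F x n = -1)
    (hIn : fderiv ℝ F x (Complex.I • n) = 0) (hδ1 : δ < 1)
    (hpsc : ∀ᶠ y in 𝓝 x, F y = 0 → ∀ v, fderiv ℝ F y v = 0 → fderiv ℝ F y (Complex.I • v) = 0 →
      0 ≤ leviB F y v v)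
    (hpos : ∀ v, v ≠ 0 → IsNull F x v →
      0 < normalVariation F x n v - leviSq F x n v / (1 - δ)) :
    ∀ᶠ q in 𝓝 x, F q < 0 → ∀ Z, 0 ≤ dfForm F δ q Z := by
  by_contra hcon
  have h1δ : 0 < 1 - δ := by linarith
  have hfr : ∃ᶠ q in 𝓝 x, F q < 0 ∧ ∃ Z, dfForm F δ q Z < 0 := by
    refine (not_eventually.1 hcon).mono fun q hq => ?_
    push Not at hq
    exact hq
  have hseq : ∀ k : ℕ, ∃ (q : E) (σ : ℝ) (w : E × ℝ × ℝ), dist q x < 1 / (k + 1 : ℝ) ∧ 0 < σ ∧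
      σ < 1 / (k + 1 : ℝ) ∧ F (q - σ • n) = 0 ∧ F q < 0 ∧ fderiv ℝ F q w.1 = σ * w.2.1 ∧
      fderiv ℝ F q (Complex.I • w.1) = σ * w.2.2 ∧ dfForm F δ q w.1 < 0 ∧
      w ∈ Metric.sphere (0 : E × ℝ × ℝ) 1 := by
    intro k
    have hk : (0 : ℝ) < 1 / (k + 1) := by positivity
    obtain ⟨q, ⟨hq1, Z, hZ⟩, hq2, hq3⟩ := (hfr.and_eventually
      ((exists_boundary_point (hF.of_le (by norm_num)) hF0 hn hk).and
        (Metric.ball_mem_nhds x hk))).exists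
    obtain ⟨σ, hσ, hσ2, hσ3⟩ := hq2 hq1
    set w : E × ℝ × ℝ := (Z, fderiv ℝ F q Z / σ, fderiv ℝ F q (Complex.I • Z) / σ) with hw
    have hw0 : w ≠ 0 := by
      intro h
      have : Z = 0 := congrArg Prod.fst h
      rw [this] at hZ
      simp [dfForm, gradSq] at hZ
    have hwn : 0 < ‖w‖ := norm_pos_iff.2 hw0
    refine ⟨q, σ, ‖w‖⁻¹ • w, hq3, hσ, hσ2, hσ3, hq1, ?_, ?_, ?_, ?_⟩
    · simp only [hw, Prod.smul_fst, Prod.smul_snd, map_smul, smul_eq_mul]; field_simp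
    · simp only [hw, Prod.smul_fst, Prod.smul_snd, smul_comm Complex.I, map_smul, smul_eq_mul]
      field_simp
    · rw [Prod.smul_fst, dfForm_smul]
      exact mul_neg_of_pos_of_neg (by positivity) hZ
    · rw [mem_sphere_zero_iff_norm, norm_smul, norm_inv, norm_norm, inv_mul_cancel₀ hwn.ne']
  choose q σ w hq hσ hσ1 hF1 hF2 hX hY hbad hw using hseq
  obtain ⟨w0, hw0, φ, hφ, hlim⟩ := (isCompact_sphere (0 : E × ℝ × ℝ) 1).tendsto_subseq hw
  have hto : Tendsto (fun k => 1 / ((φ k : ℕ) + 1 : ℝ)) atTop (𝓝 0) :=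
    tendsto_one_div_add_atTop_nhds_zero_nat.comp hφ.tendsto_atTop
  have tσ : Tendsto (σ ∘ φ) atTop (𝓝 0) :=
    squeeze_zero (fun k => (hσ _).le) (fun k => (hσ1 _).le) hto
  have tq : Tendsto (q ∘ φ) atTop (𝓝 x) := tendsto_iff_dist_tendsto_zero.2
    (squeeze_zero (fun k => dist_nonneg) (fun k => (hq _).le) hto)
  have tp : Tendsto (fun k => q (φ k) - σ (φ k) • n) atTop (𝓝 x) := by
    simpa using tq.sub (tσ.smul_const n)
  have hc1 := (continuous_fst.tendsto w0).comp hlim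
  have hc2 := ((continuous_fst.comp continuous_snd).tendsto w0).comp hlim
  have hc3 := ((continuous_snd.comp continuous_snd).tendsto w0).comp hlim
  obtain ⟨hnull, hle⟩ := limit_of_dfForm_neg (δ := δ) (l := atTop) (σ := σ ∘ φ)
    (p := fun k => q (φ k) - σ (φ k) • n) hF hF0 hn hIn hδ1 hpsc tp tσ
    (Eventually.of_forall fun k => hσ _) (Eventually.of_forall fun k => hF1 _)
    (Eventually.of_forall fun k => by simpa using hF2 _)
    (Eventually.of_forall fun k => by simpa using hX _)
    (Eventually.of_forall fun k => by simpa using hY _)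
    (Eventually.of_forall fun k => by simpa using hbad _) hc1 hc2 hc3
  simp only [Function.comp] at hle
  by_cases hz : w0.1 = 0
  · rw [hz] at hle
    simp [normalVariation] at hle
    have h3 : w0.2.1 ^ 2 + w0.2.2 ^ 2 ≤ 0 := by
      by_contra! h
      exact absurd hle (not_le.2 (mul_pos h1δ h))
    have h4 : w0.2.1 = 0 := by nlinarith [sq_nonneg w0.2.1, sq_nonneg w0.2.2]
    have h5 : w0.2.2 = 0 := by nlinarith [sq_nonneg w0.2.1, sq_nonneg w0.2.2]
    have : w0 = 0 := Prod.ext hz (Prod.ext h4 h5)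
    rw [this] at hw0
    simp at hw0
  · have h1 := hpos _ hz hnull
    rw [leviSq] at h1
    set P := leviB F x w0.1 n
    set Q := leviB F x (Complex.I • w0.1) n
    -- complete the square
    have h2 : 0 ≤ (1 - δ) * ((w0.2.1 - P / (1 - δ)) ^ 2 + (w0.2.2 - Q / (1 - δ)) ^ 2) := by
      positivity
    have h3 : (1 - δ) * ((w0.2.1 - P / (1 - δ)) ^ 2 + (w0.2.2 - Q / (1 - δ)) ^ 2) =
        (1 - δ) * (w0.2.1 ^ 2 + w0.2.2 ^ 2) - 2 * (P * w0.2.1 + Q * w0.2.2)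
          + (P ^ 2 + Q ^ 2) / (1 - δ) := by
      field_simp; ring
    linarith

end NearBoundary

/-! ### Calculus in holomorphic charts -/

section Charts

set_option synthInstance.maxHeartbeats 400000

variable {E : Type*} [NormedAddCommGroup E] [NormedSpace ℂ E]
  {X : Type*} [TopologicalSpace X] [ChartedSpace E X]

/-- The coordinate expression of a function in the preferred chart at `p`. -/
def inChart (p : X) (f : X → ℝ) : E → ℝ := f ∘ (extChartAt 𝓘(ℝ, E) p).symm

/-- The differential of the preferred chart at `p`, at a point `q` of its domain. -/
def chartD (p q : X) : E →L[ℝ] E :=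
  mfderiv 𝓘(ℝ, E) 𝓘(ℝ, E) (extChartAt 𝓘(ℝ, E) p) q

/-- The differential of the inverse of the preferred chart at `p`. -/
def symmD (p : X) (y : E) : E →L[ℝ] E :=
  mfderiv 𝓘(ℝ, E) 𝓘(ℝ, E) (extChartAt 𝓘(ℝ, E) p).symm y

/-- The coordinate expression of a vector field in the preferred chart at `p`. -/
def fieldInChart (p : X) (V : Π q : X, TangentSpace 𝓘(ℝ, E) q) : E → E := fun y =>
  chartD p ((extChartAt 𝓘(ℝ, E) p).symm y) (V ((extChartAt 𝓘(ℝ, E) p).symm y) : E)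

/-- The coordinate expression of a one-form in the preferred chart at `p`. -/
def formInChart (p : X) (α : Π q : X, TangentSpace 𝓘(ℝ, E) q →L[ℝ] ℝ) : E → E →L[ℝ] ℝ := fun y =>
  ((α ((extChartAt 𝓘(ℝ, E) p).symm y) : E →L[ℝ] ℝ)).comp (symmD p y)

lemma eventually_source (p : X) : ∀ᶠ q in 𝓝 p, q ∈ (extChartAt 𝓘(ℝ, E) p).source :=
  extChartAt_source_mem_nhds p

lemma eventually_target (p : X) :
    ∀ᶠ y in 𝓝 (extChartAt 𝓘(ℝ, E) p p), y ∈ (extChartAt 𝓘(ℝ, E) p).target :=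
  extChartAt_target_mem_nhds p

lemma inChart_eventuallyEq {p q : X} (hq : q ∈ (extChartAt 𝓘(ℝ, E) p).source) (f : X → ℝ) :
    f ∘ (extChartAt 𝓘(ℝ, E) q).symm =ᶠ[𝓝 (extChartAt 𝓘(ℝ, E) q q)]
      inChart p f ∘ (extChartAt 𝓘(ℝ, E) p ∘ (extChartAt 𝓘(ℝ, E) q).symm) := by
  have h1 : ContinuousAt (extChartAt 𝓘(ℝ, E) q).symm (extChartAt 𝓘(ℝ, E) q q) :=
    continuousAt_extChartAt_symm q
  have h2 : ∀ᶠ z in 𝓝 ((extChartAt 𝓘(ℝ, E) q).symm (extChartAt 𝓘(ℝ, E) q q)),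
      z ∈ (extChartAt 𝓘(ℝ, E) p).source := by
    rw [extChartAt_to_inv]
    exact (isOpen_extChartAt_source p).mem_nhds hq
  filter_upwards [h1.eventually h2] with z hz
  simp only [Function.comp, inChart]
  rw [(extChartAt 𝓘(ℝ, E) p).left_inv hz]

lemma complexHessian_eq_self (f : X → ℝ) (p : X) (v w : E) :
    complexHessian f p v w = ((leviB (inChart p f) (extChartAt 𝓘(ℝ, E) p p) v w : ℝ)
      + Complex.I * (leviB (inChart p f) (extChartAt 𝓘(ℝ, E) p p) v (Complex.I • w) : ℝ)) / 4
      := by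
  have h1 : leviB (inChart p f) (extChartAt 𝓘(ℝ, E) p p) v w =
      fderiv ℝ (fderiv ℝ (inChart p f)) (extChartAt 𝓘(ℝ, E) p p) v w +
      fderiv ℝ (fderiv ℝ (inChart p f)) (extChartAt 𝓘(ℝ, E) p p) (J p v) (J p w) :=
    leviB_apply _ _ _ _
  have h2 : leviB (inChart p f) (extChartAt 𝓘(ℝ, E) p p) v (Complex.I • w) =
      fderiv ℝ (fderiv ℝ (inChart p f)) (extChartAt 𝓘(ℝ, E) p p) v (J p w) -
      fderiv ℝ (fderiv ℝ (inChart p f)) (extChartAt 𝓘(ℝ, E) p p) (J p v) w := by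
    rw [leviB_apply, I_smul_I_smul, map_neg]; rfl
  rw [h1, h2]; rfl

lemma complexHessian_self_re (f : X → ℝ) (p : X) (v : E) :
    (complexHessian f p v v).re = leviB (inChart p f) (extChartAt 𝓘(ℝ, E) p p) v v / 4 := by
  rw [complexHessian_eq_self]
  simp

lemma diff_eq_self (f : X → ℝ) {p : X} (hf : ContMDiffAt 𝓘(ℝ, E) 𝓘(ℝ, ℝ) 1 f p) :
    (diff f p : E →L[ℝ] ℝ) = fderiv ℝ (f ∘ (extChartAt 𝓘(ℝ, E) p).symm)
      (extChartAt 𝓘(ℝ, E) p p) := by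
  refine (hf.mdifferentiableAt (by simp)).mfderiv.trans ?_
  simp only [writtenInExtChartAt, modelWithCornersSelf_coe, range_id, fderivWithin_univ]
  rfl

variable [IsManifold 𝓘(ℂ, E) ω X]

instance isManifold_real_one : IsManifold 𝓘(ℝ, E) 1 X := IsManifold.of_le (n := ∞) (by simp)

lemma chartD_symmD {p : X} {y : E} (hy : y ∈ (extChartAt 𝓘(ℝ, E) p).target) (v : E) :
    chartD p ((extChartAt 𝓘(ℝ, E) p).symm y) (symmD p y v) = v := by
  have := mfderiv_extChartAt_comp_mfderivWithin_extChartAt_symm (I := 𝓘(ℝ, E)) hy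
  simp only [modelWithCornersSelf_coe, range_id, mfderivWithin_univ] at this
  exact DFunLike.congr_fun this v

lemma symmD_chartD {p q : X} (hq : q ∈ (extChartAt 𝓘(ℝ, E) p).source)
    (v : E) : symmD p (extChartAt 𝓘(ℝ, E) p q) (chartD p q v) = v := by
  have := mfderivWithin_extChartAt_symm_comp_mfderiv_extChartAt' (I := 𝓘(ℝ, E)) hq
  simp only [modelWithCornersSelf_coe, range_id, mfderivWithin_univ] at this
  exact DFunLike.congr_fun this v

lemma chartD_self (p : X) (v : E) : chartD p p v = v := by
  have := mfderiv_extChartAt_self (I := 𝓘(ℝ, E)) (x := p)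
  exact DFunLike.congr_fun this v

lemma chartD_eq_fderiv {p q : X} (hq : q ∈ (extChartAt 𝓘(ℝ, E) p).source) :
    chartD p q = fderiv ℝ (extChartAt 𝓘(ℝ, E) p ∘ (extChartAt 𝓘(ℝ, E) q).symm)
      (extChartAt 𝓘(ℝ, E) q q) := by
  have h : MDifferentiableAt 𝓘(ℝ, E) 𝓘(ℝ, E) (extChartAt 𝓘(ℝ, E) p) q :=
    mdifferentiableAt_extChartAt (by simpa using hq)
  rw [chartD]
  refine h.mfderiv.trans ?_
  simp only [writtenInExtChartAt, modelWithCornersSelf_coe, range_id, fderivWithin_univ]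
  rfl

/-- Coordinate changes are smooth with complex-linear differential. -/
lemma coordChange_holomorphic {p q : X} (hq : q ∈ (extChartAt 𝓘(ℝ, E) p).source) :
    ContDiffAt ℝ ∞ (extChartAt 𝓘(ℝ, E) p ∘ (extChartAt 𝓘(ℝ, E) q).symm)
      (extChartAt 𝓘(ℝ, E) q q) ∧
    ∀ᶠ z in 𝓝 (extChartAt 𝓘(ℝ, E) q q), ∀ v,
      fderiv ℝ (extChartAt 𝓘(ℝ, E) p ∘ (extChartAt 𝓘(ℝ, E) q).symm) z (Complex.I • v) =
        Complex.I • fderiv ℝ (extChartAt 𝓘(ℝ, E) p ∘ (extChartAt 𝓘(ℝ, E) q).symm) z v := by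
  have h1 : ContDiffWithinAt ℂ ω (extChartAt 𝓘(ℂ, E) p ∘ (extChartAt 𝓘(ℂ, E) q).symm)
      (range 𝓘(ℂ, E)) (extChartAt 𝓘(ℂ, E) q q) := by
    apply contDiffWithinAt_ext_coord_change
    rw [PartialEquiv.trans_source'', PartialEquiv.symm_symm, PartialEquiv.symm_target]
    exact mem_image_of_mem _ ⟨mem_extChartAt_source q, by simpa using hq⟩
  have h2 : ContDiffAt ℂ ω (extChartAt 𝓘(ℝ, E) p ∘ (extChartAt 𝓘(ℝ, E) q).symm)
      (extChartAt 𝓘(ℝ, E) q q) := by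
    simp only [modelWithCornersSelf_coe, range_id, contDiffWithinAt_univ] at h1
    exact h1
  refine ⟨(h2.of_le (by simp)).restrict_scalars ℝ, ?_⟩
  have h3 : ContDiffAt ℂ 1 (extChartAt 𝓘(ℝ, E) p ∘ (extChartAt 𝓘(ℝ, E) q).symm)
      (extChartAt 𝓘(ℝ, E) q q) := h2.of_le (by simp)
  filter_upwards [h3.eventually (by decide)] with z hz v
  rw [(hz.differentiableAt (by simp)).fderiv_restrictScalars ℝ]
  simp

lemma chartD_J {p q : X} (hq : q ∈ (extChartAt 𝓘(ℝ, E) p).source)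
    (v : E) : chartD p q (Complex.I • v) = Complex.I • chartD p q v := by
  rw [chartD_eq_fderiv hq]
  exact (coordChange_holomorphic hq).2.self_of_nhds v

lemma inChart_contDiffAt {p q : X} (hq : q ∈ (extChartAt 𝓘(ℝ, E) p).source) {f : X → ℝ}
    {n : ℕ∞} (hf : ContMDiffAt 𝓘(ℝ, E) 𝓘(ℝ, ℝ) n f q) :
    ContDiffAt ℝ n (inChart p f) (extChartAt 𝓘(ℝ, E) p q) := by
  rw [← contMDiffAt_iff_contDiffAt]
  have h1 : ContMDiffAt 𝓘(ℝ, E) 𝓘(ℝ, E) n (extChartAt 𝓘(ℝ, E) p).symm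
      (extChartAt 𝓘(ℝ, E) p q) :=
    ((contMDiffOn_extChartAt_symm (n := ∞) p).contMDiffAt
      ((isOpen_extChartAt_target p).mem_nhds ((extChartAt 𝓘(ℝ, E) p).map_source hq))).of_le
      (by exact_mod_cast le_top)
  exact ContMDiffAt.comp (g := f) (extChartAt 𝓘(ℝ, E) p q)
    (by rwa [(extChartAt 𝓘(ℝ, E) p).left_inv hq]) h1

/-- Converse of `inChart_contDiffAt`. -/
lemma contMDiffAt_of_comp_chart {W : Type*} [NormedAddCommGroup W] [NormedSpace ℝ W]
    {p q : X} (hq : q ∈ (extChartAt 𝓘(ℝ, E) p).source) {g : E → W}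
    {n : ℕ∞} (hg : ContDiffAt ℝ n g (extChartAt 𝓘(ℝ, E) p q)) :
    ContMDiffAt 𝓘(ℝ, E) 𝓘(ℝ, W) n (fun z => g (extChartAt 𝓘(ℝ, E) p z)) q := by
  have h1 : ContMDiffAt 𝓘(ℝ, E) 𝓘(ℝ, E) n (extChartAt 𝓘(ℝ, E) p) q :=
    (contMDiffAt_extChartAt' (n := ∞) (by simpa using hq)).of_le (by exact_mod_cast le_top)
  exact ContMDiffAt.comp q (contMDiffAt_iff_contDiffAt.2 hg) h1

/-- The differential of a function in the chart at `p`. -/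
lemma diff_eq {p q : X} (hq : q ∈ (extChartAt 𝓘(ℝ, E) p).source) {f : X → ℝ}
    (hf : ContMDiffAt 𝓘(ℝ, E) 𝓘(ℝ, ℝ) 1 f q) (v : E) :
    diff f q v = fderiv ℝ (inChart p f) (extChartAt 𝓘(ℝ, E) p q) (chartD p q v) := by
  have h0 : extChartAt 𝓘(ℝ, E) p ((extChartAt 𝓘(ℝ, E) q).symm (extChartAt 𝓘(ℝ, E) q q)) =
    extChartAt 𝓘(ℝ, E) p q := by rw [extChartAt_to_inv]
  have h1 : DifferentiableAt ℝ (inChart p f)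
      ((extChartAt 𝓘(ℝ, E) p ∘ (extChartAt 𝓘(ℝ, E) q).symm) (extChartAt 𝓘(ℝ, E) q q)) := by
    rw [Function.comp_apply, h0]
    exact (inChart_contDiffAt (n := 1) hq hf).differentiableAt (by simp)
  have h2 := (coordChange_holomorphic hq).1.differentiableAt (by simp)
  have h3 : diff f q v = (fderiv ℝ (f ∘ (extChartAt 𝓘(ℝ, E) q).symm) (extChartAt 𝓘(ℝ, E) q q)) v :=
    DFunLike.congr_fun (diff_eq_self f hf) v
  rw [h3, (inChart_eventuallyEq hq f).fderiv_eq, fderiv_comp _ h1 h2,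
    chartD_eq_fderiv hq, Function.comp_apply, h0]
  rfl

/-- The complex Hessian of a function in the chart at `p`. -/
lemma leviB_inChart_eq {p q : X} (hq : q ∈ (extChartAt 𝓘(ℝ, E) p).source) {f : X → ℝ}
    (hf : ContMDiffAt 𝓘(ℝ, E) 𝓘(ℝ, ℝ) 2 f q) (v w : E) :
    leviB (inChart q f) (extChartAt 𝓘(ℝ, E) q q) v w =
      leviB (inChart p f) (extChartAt 𝓘(ℝ, E) p q) (chartD p q v) (chartD p q w) := by
  have h0 : extChartAt 𝓘(ℝ, E) p ((extChartAt 𝓘(ℝ, E) q).symm (extChartAt 𝓘(ℝ, E) q q)) =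
    extChartAt 𝓘(ℝ, E) p q := by rw [extChartAt_to_inv]
  have h1 : ContDiffAt ℝ 2 (inChart p f)
      ((extChartAt 𝓘(ℝ, E) p ∘ (extChartAt 𝓘(ℝ, E) q).symm) (extChartAt 𝓘(ℝ, E) q q)) := by
    rw [Function.comp_apply, h0]
    exact inChart_contDiffAt (n := 2) hq hf
  have h2 := coordChange_holomorphic hq
  have h3 := leviB_comp_holomorphic (h2.1.of_le (by norm_cast)) h2.2 h1 v w
  have h4 : leviB (inChart q f) (extChartAt 𝓘(ℝ, E) q q) =
      leviB (inChart p f ∘ (extChartAt 𝓘(ℝ, E) p ∘ (extChartAt 𝓘(ℝ, E) q).symm))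
        (extChartAt 𝓘(ℝ, E) q q) := by
    have h5 : inChart q f =ᶠ[𝓝 (extChartAt 𝓘(ℝ, E) q q)]
      inChart p f ∘ (extChartAt 𝓘(ℝ, E) p ∘ (extChartAt 𝓘(ℝ, E) q).symm) :=
      inChart_eventuallyEq hq f
    rw [leviB, leviB, hess, hess, h5.fderiv.fderiv_eq]
  rw [h4, h3, Function.comp_apply, h0, chartD_eq_fderiv hq]

end Charts

/-! ### Vector fields, one-forms and Lie brackets in charts -/

section Sections

set_option synthInstance.maxHeartbeats 400000

variable {E : Type*} [NormedAddCommGroup E] [NormedSpace ℂ E]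
  {X : Type*} [TopologicalSpace X] [ChartedSpace E X]

lemma dbar_eq_formInChart (p : X) (α : Π q : X, TangentSpace 𝓘(ℝ, E) q →L[ℝ] ℝ) (v : E) :
    dbar α p v = -(fderiv ℝ (formInChart p α) (extChartAt 𝓘(ℝ, E) p p) v v +
      fderiv ℝ (formInChart p α) (extChartAt 𝓘(ℝ, E) p p) (Complex.I • v) (Complex.I • v)) / 4 :=
  rfl

variable [IsManifold 𝓘(ℂ, E) ω X]

lemma tangent_trivializationAt_snd {p q : X} (hq : q ∈ (extChartAt 𝓘(ℝ, E) p).source)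
    (v : TangentSpace 𝓘(ℝ, E) q) :
    (trivializationAt E (TangentSpace 𝓘(ℝ, E)) p ⟨q, v⟩).2 = chartD (E := E) p q v := by
  have hq' : q ∈ (chartAt E p).source := by simpa using hq
  have hb : q ∈ (trivializationAt E (TangentSpace 𝓘(ℝ, E)) p).baseSet := by simpa using hq'
  exact (Trivialization.continuousLinearMapAt_apply_of_mem (R := ℝ)
    (trivializationAt E (TangentSpace 𝓘(ℝ, E)) p) hb v).symm.trans
    (DFunLike.congr_fun (TangentBundle.continuousLinearMapAt_trivializationAt hq') v)

/-- Smoothness of a vector field near `p` is smoothness of its coordinates in the chart at `p`. -/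
lemma contMDiffAt_field_iff {p q : X} (hq : q ∈ (extChartAt 𝓘(ℝ, E) p).source)
    (V : Π q : X, TangentSpace 𝓘(ℝ, E) q) :
    ContMDiffAt 𝓘(ℝ, E) (𝓘(ℝ, E).prod 𝓘(ℝ, E)) ∞
      (fun p : X => (TotalSpace.mk' E p (V p) : TangentBundle 𝓘(ℝ, E) X)) q ↔
    ContMDiffAt 𝓘(ℝ, E) 𝓘(ℝ, E) ∞ (fun z => chartD (E := E) p z (V z)) q := by
  have hq' : q ∈ (chartAt E p).source := by simpa using hq
  rw [Trivialization.contMDiffAt_section_iff (IB := 𝓘(ℝ, E)) (n := ∞) (s := V)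
    (trivializationAt E (TangentSpace 𝓘(ℝ, E)) p) (by simpa using hq')]
  apply Filter.EventuallyEq.contMDiffAt_iff
  filter_upwards [(isOpen_extChartAt_source p).mem_nhds hq] with z hz
  exact tangent_trivializationAt_snd hz _

lemma form_trivializationAt_snd {p q : X} (hq : q ∈ (extChartAt 𝓘(ℝ, E) p).source)
    (l : E →L[ℝ] ℝ) :
    (trivializationAt (E →L[ℝ] ℝ)
      (fun q : X => TangentSpace 𝓘(ℝ, E) q →L[ℝ] Bundle.Trivial X ℝ q) p ⟨q, l⟩).2 =
    l.comp (symmD p (extChartAt 𝓘(ℝ, E) p q)) := by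
  have hq' : q ∈ (chartAt E p).source := by simpa using hq
  rw [hom_trivializationAt_apply]
  simp only [ContinuousLinearMap.inCoordinates]
  rw [TangentBundle.symmL_trivializationAt hq']
  simp only [modelWithCornersSelf_coe, range_id, mfderivWithin_univ]
  have h1 := Bundle.Trivial.continuousLinearMapAt_trivialization ℝ X ℝ q
  exact congrArg (fun m : ℝ →L[ℝ] ℝ => m.comp (l.comp (symmD p (extChartAt 𝓘(ℝ, E) p q)))) h1

/-- Smoothness of a one-form near `p` is smoothness of its coordinates in the chart at `p`. -/
lemma contMDiffAt_form_iff {p q : X} (hq : q ∈ (extChartAt 𝓘(ℝ, E) p).source)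
    (α : Π q : X, TangentSpace 𝓘(ℝ, E) q →L[ℝ] ℝ) :
    ContMDiffAt 𝓘(ℝ, E) (𝓘(ℝ, E).prod 𝓘(ℝ, E →L[ℝ] ℝ)) ∞
      (fun p : X => TotalSpace.mk' (E →L[ℝ] ℝ)
        (E := fun q : X => TangentSpace 𝓘(ℝ, E) q →L[ℝ] Bundle.Trivial X ℝ q) p (α p)) q ↔
    ContMDiffAt 𝓘(ℝ, E) 𝓘(ℝ, E →L[ℝ] ℝ) ∞
      (fun z => (α z : E →L[ℝ] ℝ).comp (symmD p (extChartAt 𝓘(ℝ, E) p z))) q := by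
  have hq' : q ∈ (chartAt E p).source := by simpa using hq
  rw [Trivialization.contMDiffAt_section_iff (IB := 𝓘(ℝ, E)) (n := ∞)
    (E := fun q : X => TangentSpace 𝓘(ℝ, E) q →L[ℝ] Bundle.Trivial X ℝ q) (s := α)
    (trivializationAt (E →L[ℝ] ℝ)
      (fun q : X => TangentSpace 𝓘(ℝ, E) q →L[ℝ] Bundle.Trivial X ℝ q) p) (by simpa using hq')]
  apply Filter.EventuallyEq.contMDiffAt_iff
  filter_upwards [(isOpen_extChartAt_source p).mem_nhds hq] with z hz
  exact form_trivializationAt_snd hz _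

lemma contDiffAt_comp_symm {W : Type*} [NormedAddCommGroup W] [NormedSpace ℝ W] {p : X}
    {g : X → W} (hg : ContMDiffAt 𝓘(ℝ, E) 𝓘(ℝ, W) ∞ g p) :
    ContDiffAt ℝ ∞ (fun y => g ((extChartAt 𝓘(ℝ, E) p).symm y)) (extChartAt 𝓘(ℝ, E) p p) := by
  rw [← contMDiffAt_iff_contDiffAt]
  have h1 : ContMDiffAt 𝓘(ℝ, E) 𝓘(ℝ, E) ∞ (extChartAt 𝓘(ℝ, E) p).symm
      (extChartAt 𝓘(ℝ, E) p p) :=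
    (contMDiffOn_extChartAt_symm (n := ∞) p).contMDiffAt (eventually_target p)
  exact ContMDiffAt.comp (g := g) (extChartAt 𝓘(ℝ, E) p p)
    (by rwa [extChartAt_to_inv]) h1

lemma IsSmoothVectorField.fieldInChart_contDiffAt {V : Π q : X, TangentSpace 𝓘(ℝ, E) q}
    (hV : IsSmoothVectorField V) (p : X) :
    ContDiffAt ℝ ∞ (fieldInChart p V) (extChartAt 𝓘(ℝ, E) p p) :=
  contDiffAt_comp_symm (g := fun z => chartD (E := E) p z (V z))
    ((contMDiffAt_field_iff (mem_extChartAt_source p) V).1 (hV p))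

lemma IsSmoothOneForm.formInChart_contDiffAt {α : Π q : X, TangentSpace 𝓘(ℝ, E) q →L[ℝ] ℝ}
    (hα : IsSmoothOneForm α) (p : X) :
    ContDiffAt ℝ ∞ (formInChart p α) (extChartAt 𝓘(ℝ, E) p p) := by
  have h := contDiffAt_comp_symm (g := fun z => (α z : E →L[ℝ] ℝ).comp
    (symmD p (extChartAt 𝓘(ℝ, E) p z)))
    ((contMDiffAt_form_iff (mem_extChartAt_source p) α).1 (hα p))
  refine h.congr_of_eventuallyEq ?_
  filter_upwards [eventually_target p] with y hy
  rw [(extChartAt 𝓘(ℝ, E) p).right_inv hy]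
  rfl

lemma fieldInChart_self (p : X) (V : Π q : X, TangentSpace 𝓘(ℝ, E) q) :
    fieldInChart p V (extChartAt 𝓘(ℝ, E) p p) = V p := by
  rw [fieldInChart, extChartAt_to_inv]
  exact chartD_self p _

lemma formInChart_apply {p q : X} (hq : q ∈ (extChartAt 𝓘(ℝ, E) p).source)
    (α : Π q : X, TangentSpace 𝓘(ℝ, E) q →L[ℝ] ℝ) (v : E) :
    formInChart p α (extChartAt 𝓘(ℝ, E) p q) (chartD p q v) = α q v := by
  change (α ((extChartAt 𝓘(ℝ, E) p).symm (extChartAt 𝓘(ℝ, E) p q)) : E →L[ℝ] ℝ)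
    (symmD p (extChartAt 𝓘(ℝ, E) p q) (chartD p q v)) = (α q : E →L[ℝ] ℝ) v
  rw [symmD_chartD hq]
  exact congrArg (fun z => (α z : E →L[ℝ] ℝ) v) ((extChartAt 𝓘(ℝ, E) p).left_inv hq)

lemma formInChart_self (p : X) (α : Π q : X, TangentSpace 𝓘(ℝ, E) q →L[ℝ] ℝ) (v : E) :
    formInChart p α (extChartAt 𝓘(ℝ, E) p p) v = α p v := by
  have := formInChart_apply (mem_extChartAt_source p) α v
  rwa [chartD_self] at this

/-- The Lie bracket at `p`, computed in the chart at `p`. -/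
lemma mlieBracket_eq [CompleteSpace E] (p : X) (V W : Π q : X, TangentSpace 𝓘(ℝ, E) q) :
    (VectorField.mlieBracket 𝓘(ℝ, E) V W p : E) =
      VectorField.lieBracket ℝ (fieldInChart p V) (fieldInChart p W) (extChartAt 𝓘(ℝ, E) p p) := by
  have key : ∀ V : Π q : X, TangentSpace 𝓘(ℝ, E) q,
      VectorField.mpullbackWithin 𝓘(ℝ, E) 𝓘(ℝ, E) (extChartAt 𝓘(ℝ, E) p).symm V univ
        =ᶠ[𝓝 (extChartAt 𝓘(ℝ, E) p p)] fieldInChart p V := by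
    intro V
    filter_upwards [eventually_target p] with y hy
    have h1 := isInvertible_mfderivWithin_extChartAt_symm (I := 𝓘(ℝ, E)) hy
    have h2 := mfderivWithin_extChartAt_symm_comp_mfderiv_extChartAt (I := 𝓘(ℝ, E)) hy
    simp only [modelWithCornersSelf_coe, range_id] at h1 h2
    rw [VectorField.mpullbackWithin_apply]
    obtain ⟨e, he⟩ := h1
    rw [← he, ContinuousLinearMap.inverse_equiv]
    apply e.injective
    have h3 := DFunLike.congr_fun h2 (V ((extChartAt 𝓘(ℝ, E) p).symm y))
    rw [← he] at h3
    refine (e.apply_symm_apply _).trans ?_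
    exact h3.symm
  have hid : (mfderiv 𝓘(ℝ, E) 𝓘(ℝ, E) (extChartAt 𝓘(ℝ, E) p) p : E →L[ℝ] E).inverse =
      ContinuousLinearMap.id ℝ E := by
    rw [show (mfderiv 𝓘(ℝ, E) 𝓘(ℝ, E) (extChartAt 𝓘(ℝ, E) p) p : E →L[ℝ] E) =
      ContinuousLinearMap.id ℝ E from mfderiv_extChartAt_self]
    exact ContinuousLinearMap.inverse_id
  have h := Filter.EventuallyEq.lieBracket_vectorField_eq (𝕜 := ℝ) (key V) (key W)
  refine Eq.trans ?_ h
  have h2 := VectorField.mlieBracketWithin_apply (I := 𝓘(ℝ, E)) (V := V) (W := W) (s := univ)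
    (x₀ := p)
  simp only [modelWithCornersSelf_coe, range_id, preimage_univ, inter_univ] at h2
  have h3 := h2.trans (DFunLike.congr_fun hid _)
  exact h3.trans (congrFun (VectorField.lieBracketWithin_univ (𝕜 := ℝ) (E := E)) _)

end Sections

/-! ### Boundary geometry and defining functions -/

section Boundary

set_option synthInstance.maxHeartbeats 400000

variable {E : Type*} [NormedAddCommGroup E] [NormedSpace ℂ E]
  {X : Type*} [TopologicalSpace X] [ChartedSpace E X] {Ω : Set X} {r : X → ℝ} {p : X}

lemma IsDefiningFunction.eventually_contMDiffAt (hr : IsDefiningFunction E Ω r)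
    (hp : p ∈ closure Ω) : ∀ᶠ q in 𝓝 p, ContMDiffAt 𝓘(ℝ, E) 𝓘(ℝ, ℝ) ∞ r q := by
  obtain ⟨U, hU, hΩU, hs, -⟩ := hr
  filter_upwards [hU.mem_nhds (hΩU hp)] with q hq
  exact hs.contMDiffAt (hU.mem_nhds hq)

lemma IsDefiningFunction.contMDiffAt (hr : IsDefiningFunction E Ω r)
    (hp : p ∈ closure Ω) : ContMDiffAt 𝓘(ℝ, E) 𝓘(ℝ, ℝ) ∞ r p :=
  (hr.eventually_contMDiffAt hp).self_of_nhds

lemma IsDefiningFunction.eventually_mem_iff (hr : IsDefiningFunction E Ω r)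
    (hp : p ∈ closure Ω) : ∀ᶠ q in 𝓝 p, (q ∈ Ω ↔ r q < 0) := by
  obtain ⟨U, hU, hΩU, -, hΩ, -⟩ := hr
  filter_upwards [hU.mem_nhds (hΩU hp)] with q hq
  rw [hΩ]
  exact ⟨fun h => h.2, fun h => ⟨hq, h⟩⟩

lemma IsDefiningFunction.eq_zero (hr : IsDefiningFunction E Ω r) (hΩ : IsOpen Ω)
    (hp : p ∈ frontier Ω) : r p = 0 := by
  have hc := frontier_subset_closure hp
  have h1 := hr.eventually_mem_iff hc
  have h2 : p ∉ Ω := fun h => by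
    rw [hΩ.frontier_eq] at hp; exact hp.2 h
  apply le_antisymm
  · by_contra! hpos
    have h3 : ∀ᶠ q in 𝓝 p, 0 < r q :=
      (hr.contMDiffAt hc).continuousAt.eventually (lt_mem_nhds hpos)
    obtain ⟨q, ⟨hq1, hq2⟩, hq3⟩ := mem_closure_iff_nhds.1 hc _ (h1.and h3)
    exact absurd (hq1.1 hq3) (not_lt.2 hq2.le)
  · by_contra! h
    exact h2 (h1.self_of_nhds.2 h)

lemma IsDefiningFunction.inChart_eq_zero (hr : IsDefiningFunction E Ω r) (hΩ : IsOpen Ω)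
    (hp : p ∈ frontier Ω) : inChart p r (extChartAt 𝓘(ℝ, E) p p) = 0 := by
  rw [inChart, Function.comp_apply, extChartAt_to_inv]
  exact hr.eq_zero hΩ hp

lemma diff_eq_inChart {f : X → ℝ} (hf : ContMDiffAt 𝓘(ℝ, E) 𝓘(ℝ, ℝ) ∞ f p) (v : E) :
    diff f p v = fderiv ℝ (inChart p f) (extChartAt 𝓘(ℝ, E) p p) v :=
  DFunLike.congr_fun (diff_eq_self f (hf.of_le (by simp))) v

lemma IsDefiningFunction.fderiv_inChart_ne_zero (hr : IsDefiningFunction E Ω r)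
    (hp : p ∈ frontier Ω) : fderiv ℝ (inChart p r) (extChartAt 𝓘(ℝ, E) p p) ≠ 0 := by
  have h1 := hr.contMDiffAt (frontier_subset_closure hp)
  have h2 := diff_eq_self r (h1.of_le (by simp))
  obtain ⟨U, -, -, -, -, hd⟩ := hr
  intro h0
  exact hd p hp (h2.trans h0)

lemma eventually_extChartAt_symm {P : X → Prop} (h : ∀ᶠ q in 𝓝 p, P q) :
    ∀ᶠ y in 𝓝 (extChartAt 𝓘(ℝ, E) p p), P ((extChartAt 𝓘(ℝ, E) p).symm y) := by
  have h1 : ContinuousAt (extChartAt 𝓘(ℝ, E) p).symm (extChartAt 𝓘(ℝ, E) p p) :=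
    continuousAt_extChartAt_symm p
  apply h1.eventually
  rwa [extChartAt_to_inv]

lemma eventually_extChartAt {P : E → Prop} (h : ∀ᶠ y in 𝓝 (extChartAt 𝓘(ℝ, E) p p), P y) :
    ∀ᶠ q in 𝓝 p, P (extChartAt 𝓘(ℝ, E) p q) :=
  (continuousAt_extChartAt p).eventually h

lemma complexHessian_eq_zero_iff (f : X → ℝ) (p : X) (v w : E) :
    complexHessian f p v w = 0 ↔ leviB (inChart p f) (extChartAt 𝓘(ℝ, E) p p) v w = 0 ∧
      leviB (inChart p f) (extChartAt 𝓘(ℝ, E) p p) v (Complex.I • w) = 0 := by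
  rw [complexHessian_eq_self, Complex.ext_iff]
  simp

variable [IsManifold 𝓘(ℂ, E) ω X]

lemma IsDefiningFunction.contDiffAt_inChart (hr : IsDefiningFunction E Ω r)
    (hp : p ∈ closure Ω) : ContDiffAt ℝ ∞ (inChart p r) (extChartAt 𝓘(ℝ, E) p p) :=
  inChart_contDiffAt (n := ⊤) (mem_extChartAt_source p) (hr.contMDiffAt hp)

lemma IsDefiningFunction.eventually_frontier_iff (hr : IsDefiningFunction E Ω r) (hΩ : IsOpen Ω)
    (hp : p ∈ frontier Ω) : ∀ᶠ q in 𝓝 p, (q ∈ frontier Ω ↔ r q = 0) := by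
  have hc := frontier_subset_closure hp
  have h1 : ∀ᶠ y in 𝓝 (extChartAt 𝓘(ℝ, E) p p), fderiv ℝ (inChart p r) y ≠ 0 := by
    have := ((hr.contDiffAt_inChart hc).fderiv_right (m := 0) (by simp)).continuousAt
    exact this.eventually (isOpen_ne.mem_nhds (hr.fderiv_inChart_ne_zero hp))
  filter_upwards [eventually_extChartAt (E := E) h1, (hr.eventually_mem_iff hc).eventually_nhds,
    eventually_source (E := E) p] with q h1 h2 hq
  refine ⟨hr.eq_zero hΩ, fun h0 => ?_⟩
  rw [hΩ.frontier_eq]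
  refine ⟨?_, fun h => ?_⟩
  · by_contra hcl
    apply h1
    apply IsLocalMin.fderiv_eq_zero
    have h3 : ∀ᶠ z in 𝓝 q, 0 ≤ r z := by
      filter_upwards [h2, isClosed_closure.isOpen_compl.mem_nhds hcl] with z hz hz'
      by_contra! hlt
      exact hz' (subset_closure (hz.2 hlt))
    have h4 : ContinuousAt (extChartAt 𝓘(ℝ, E) p).symm (extChartAt 𝓘(ℝ, E) p q) :=
      continuousAt_extChartAt_symm' hq
    have h5 := h4.eventually (p := fun z => 0 ≤ r z)
      (by rwa [(extChartAt 𝓘(ℝ, E) p).left_inv hq])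
    filter_upwards [h5] with y hy
    change r _ ≤ r _
    rw [(extChartAt 𝓘(ℝ, E) p).left_inv hq, h0]
    exact hy
  · exact absurd (h2.self_of_nhds.1 h) (by rw [h0]; exact lt_irrefl _)

/-- Two defining functions agree to second order along `T^{1,0} M`, up to a positive factor. -/
lemma IsDefiningFunction.second_order_proportional (hr : IsDefiningFunction E Ω r) {s : X → ℝ}
    (hs : IsDefiningFunction E Ω s) (hΩ : IsOpen Ω) (hp : p ∈ frontier Ω) :
    ∃ c : ℝ, 0 < c ∧ fderiv ℝ (inChart p s) (extChartAt 𝓘(ℝ, E) p p) =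
        c • fderiv ℝ (inChart p r) (extChartAt 𝓘(ℝ, E) p p) ∧
      ∀ v w, fderiv ℝ (inChart p r) (extChartAt 𝓘(ℝ, E) p p) v = 0 →
        fderiv ℝ (inChart p r) (extChartAt 𝓘(ℝ, E) p p) w = 0 →
        hess (inChart p s) (extChartAt 𝓘(ℝ, E) p p) v w =
          c * hess (inChart p r) (extChartAt 𝓘(ℝ, E) p p) v w := by
  have hc := frontier_subset_closure hp
  apply DFIndex.second_order_proportional
    ((hr.contDiffAt_inChart hc).of_le (by norm_cast))
    ((hs.contDiffAt_inChart hc).of_le (by norm_cast)) (hr.inChart_eq_zero hΩ hp)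
    (hs.inChart_eq_zero hΩ hp) (hr.fderiv_inChart_ne_zero hp) (hs.fderiv_inChart_ne_zero hp)
  filter_upwards [eventually_extChartAt_symm (hr.eventually_mem_iff hc),
    eventually_extChartAt_symm (hs.eventually_mem_iff hc)] with y h1 h2
  exact h1.symm.trans h2

lemma IsDefiningFunction.mem_boundaryTangent_iff (hr : IsDefiningFunction E Ω r) (hΩ : IsOpen Ω)
    (hp : p ∈ frontier Ω) (v : E) :
    v ∈ boundaryTangent (E := E) Ω p ↔
      fderiv ℝ (inChart p r) (extChartAt 𝓘(ℝ, E) p p) v = 0 := by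
  have hc := frontier_subset_closure hp
  constructor
  · intro h
    rw [← diff_eq_inChart (hr.contMDiffAt hc)]
    exact h r hr
  · intro h s hs
    refine (diff_eq_inChart (hs.contMDiffAt hc) v).trans ?_
    obtain ⟨c, -, h1, -⟩ := hr.second_order_proportional hs hΩ hp
    rw [h1, _root_.smul_apply, h, smul_zero]

lemma IsDefiningFunction.mem_holTangent_iff (hr : IsDefiningFunction E Ω r) (hΩ : IsOpen Ω)
    (hp : p ∈ frontier Ω) (v : E) :
    v ∈ holTangent (E := E) Ω p ↔
      fderiv ℝ (inChart p r) (extChartAt 𝓘(ℝ, E) p p) v = 0 ∧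
      fderiv ℝ (inChart p r) (extChartAt 𝓘(ℝ, E) p p) (Complex.I • v) = 0 :=
  and_congr (hr.mem_boundaryTangent_iff hΩ hp v) (hr.mem_boundaryTangent_iff hΩ hp _)

lemma IsDefiningFunction.mem_leviDistribution_iff (hr : IsDefiningFunction E Ω r) (hΩ : IsOpen Ω)
    (hp : p ∈ frontier Ω) (v : E) :
    v ∈ leviDistribution (E := E) Ω p ↔
      IsNull (inChart p r) (extChartAt 𝓘(ℝ, E) p p) v := by
  constructor
  · rintro ⟨h1, h2⟩
    obtain ⟨h3, h4⟩ := (hr.mem_holTangent_iff hΩ hp v).1 h1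
    refine ⟨h3, h4, fun w hw hIw => ?_⟩
    exact ((complexHessian_eq_zero_iff r p v w).1
      (h2 r hr w ((hr.mem_holTangent_iff hΩ hp w).2 ⟨hw, hIw⟩))).1
  · rintro ⟨h1, h2, h3⟩
    refine ⟨(hr.mem_holTangent_iff hΩ hp v).2 ⟨h1, h2⟩, fun s hs (w : E) hw => ?_⟩
    obtain ⟨hw1, hw2⟩ := (hr.mem_holTangent_iff hΩ hp w).1 hw
    obtain ⟨c, -, -, h4⟩ := hr.second_order_proportional hs hΩ hp
    have hw3 : fderiv ℝ (inChart p r) (extChartAt 𝓘(ℝ, E) p p) (Complex.I • Complex.I • w) = 0 := by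
      rw [I_smul_I_smul, map_neg, hw1, neg_zero]
    refine (complexHessian_eq_zero_iff s p v w).2 ⟨?_, ?_⟩
    · rw [leviB_apply, h4 _ _ h1 hw1, h4 _ _ h2 hw2, ← mul_add, ← leviB_apply, h3 w hw1 hw2,
        mul_zero]
    · rw [leviB_apply, h4 _ _ h1 hw2, h4 _ _ h2 hw3, ← mul_add, ← leviB_apply, h3 _ hw2 hw3,
        mul_zero]

/-- Pseudoconvexity does not depend on the defining function. -/
lemma IsDefiningFunction.leviB_nonneg (hr : IsDefiningFunction E Ω r) (hΩ : IsOpen Ω)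
    (hpsc : IsSmoothPseudoconvex E Ω) (hp : p ∈ frontier Ω) {v : E}
    (hv : fderiv ℝ (inChart p r) (extChartAt 𝓘(ℝ, E) p p) v = 0)
    (hIv : fderiv ℝ (inChart p r) (extChartAt 𝓘(ℝ, E) p p) (Complex.I • v) = 0) :
    0 ≤ leviB (inChart p r) (extChartAt 𝓘(ℝ, E) p p) v v := by
  obtain ⟨s, hs, h⟩ := hpsc
  have h1 := h p hp v ((hr.mem_holTangent_iff hΩ hp v).2 ⟨hv, hIv⟩)
  have h1' : 0 ≤ leviB (inChart p s) (extChartAt 𝓘(ℝ, E) p p) v v / 4 :=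
    h1.trans_eq (complexHessian_self_re s p v)
  obtain ⟨c, hc, -, h4⟩ := hr.second_order_proportional hs hΩ hp
  have h5 : leviB (inChart p s) (extChartAt 𝓘(ℝ, E) p p) v v =
      c * leviB (inChart p r) (extChartAt 𝓘(ℝ, E) p p) v v := by
    rw [leviB_apply, leviB_apply, h4 _ _ hv hv, h4 _ _ hIv hIv, mul_add]
  rw [h5] at h1'
  have := nonneg_of_mul_nonneg_right (by linarith : 0 ≤ c * leviB (inChart p r)
    (extChartAt 𝓘(ℝ, E) p p) v v) hc
  exact this

/-- Pseudoconvexity at the boundary points near `p`, in the chart at `p`. -/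
lemma IsDefiningFunction.eventually_leviB_nonneg (hr : IsDefiningFunction E Ω r) (hΩ : IsOpen Ω)
    (hpsc : IsSmoothPseudoconvex E Ω) (hp : p ∈ frontier Ω) :
    ∀ᶠ y in 𝓝 (extChartAt 𝓘(ℝ, E) p p), inChart p r y = 0 →
      ∀ v, fderiv ℝ (inChart p r) y v = 0 → fderiv ℝ (inChart p r) y (Complex.I • v) = 0 →
        0 ≤ leviB (inChart p r) y v v := by
  have hc := frontier_subset_closure hp
  filter_upwards [eventually_target p,
    eventually_extChartAt_symm (hr.eventually_frontier_iff hΩ hp)] with y hy h1 h0 v hv hIv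
  have hq := (extChartAt 𝓘(ℝ, E) p).map_target hy
  have hfr := h1.2 h0
  have hsm := hr.contMDiffAt (frontier_subset_closure hfr)
  have hy' := (extChartAt 𝓘(ℝ, E) p).right_inv hy
  set q := (extChartAt 𝓘(ℝ, E) p).symm y with hqdef
  have e1 : ∀ u : E, fderiv ℝ (inChart q r) (extChartAt 𝓘(ℝ, E) q q) u =
      fderiv ℝ (inChart p r) y (chartD p q u) := fun u => by
    rw [← diff_eq_inChart hsm, diff_eq hq (hsm.of_le (by simp)), hy']
  have hv' : chartD p q (symmD p y v) = v := chartD_symmD hy v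
  have h2 := hr.leviB_nonneg hΩ hpsc hfr (v := symmD p y v) (by rw [e1, hv', hv])
    (by rw [e1, chartD_J hq, hv', hIv])
  rwa [leviB_inChart_eq hq (hsm.of_le (by norm_cast)), hv', hy'] at h2

/-- Plurisubharmonicity of `-(-r)^δ` at `q`, in the chart at `p`. -/
lemma complexHessian_neg_rpow_nonneg_iff {q : X} {δ : ℝ} (hδ : 0 < δ)
    (hq : q ∈ (extChartAt 𝓘(ℝ, E) p).source) (hr : ContMDiffAt 𝓘(ℝ, E) 𝓘(ℝ, ℝ) ∞ r q)
    (hrq : r q < 0) (v : E) :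
    0 ≤ (complexHessian (fun x => -(-r x) ^ δ) q v v).re ↔
      0 ≤ dfForm (inChart p r) δ (extChartAt 𝓘(ℝ, E) p q) (chartD p q v) := by
  have hF : inChart p r (extChartAt 𝓘(ℝ, E) p q) = r q := by
    rw [inChart, Function.comp_apply, (extChartAt 𝓘(ℝ, E) p).left_inv hq]
  have h1 : ContMDiffAt 𝓘(ℝ, E) 𝓘(ℝ, ℝ) ∞ (fun x => -(-r x) ^ δ) q := by
    have : ContDiffAt ℝ ∞ (fun t : ℝ => -(-t) ^ δ) (r q) :=
      ((contDiffAt_id.neg).rpow_const_of_ne (by simp; linarith)).neg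
    exact (contMDiffAt_iff_contDiffAt.2 this).comp q hr
  rw [complexHessian_self_re, leviB_inChart_eq hq (h1.of_le (by norm_cast)),
    ← leviB_neg_rpow_nonneg_iff hδ ((inChart_contDiffAt (n := ⊤) hq hr).of_le (by norm_cast))
      (by rwa [hF])]
  exact ⟨fun h => by
      linarith [show (0 : ℝ) ≤ leviB (fun z => -(-inChart p r z) ^ δ) _ _ _ / 4 from h],
    fun h => div_nonneg h (by norm_num)⟩

end Boundary

/-! ### Smooth extensions and characteristic fields -/

section Existence

set_option synthInstance.maxHeartbeats 400000

lemma sigmaCompactSpace_of_charted (E : Type*) [NormedAddCommGroup E] [NormedSpace ℂ E]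
    [FiniteDimensional ℂ E] (X : Type*) [TopologicalSpace X] [SecondCountableTopology X]
    [ChartedSpace E X] : SigmaCompactSpace X :=
  have : LocallyCompactSpace X := ChartedSpace.locallyCompactSpace E X
  inferInstance

variable {E : Type*} [NormedAddCommGroup E] [NormedSpace ℂ E]
  {X : Type*} [TopologicalSpace X] [ChartedSpace E X] [IsManifold 𝓘(ℂ, E) ω X]
  {Ω : Set X} {r : X → ℝ} {p : X}

lemma contDiffAt_inChart (hrs : ContMDiff 𝓘(ℝ, E) 𝓘(ℝ, ℝ) ∞ r) {y : E}
    (hy : y ∈ (extChartAt 𝓘(ℝ, E) p).target) : ContDiffAt ℝ ∞ (inChart p r) y := by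
  have := inChart_contDiffAt (n := ⊤) ((extChartAt 𝓘(ℝ, E) p).map_target hy) (hrs _)
  rwa [(extChartAt 𝓘(ℝ, E) p).right_inv hy] at this

lemma fderiv_inChart_chartD (hrs : ContMDiff 𝓘(ℝ, E) 𝓘(ℝ, ℝ) ∞ r) {y : E}
    (hy : y ∈ (extChartAt 𝓘(ℝ, E) p).target) (v : E) :
    fderiv ℝ (inChart p r) y (chartD p ((extChartAt 𝓘(ℝ, E) p).symm y) v) =
      diff r ((extChartAt 𝓘(ℝ, E) p).symm y) v := by
  refine Eq.symm ((diff_eq ((extChartAt 𝓘(ℝ, E) p).map_target hy)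
    ((hrs _).of_le (by simp)) v).trans ?_)
  rw [(extChartAt 𝓘(ℝ, E) p).right_inv hy]

lemma diff_symmD (hrs : ContMDiff 𝓘(ℝ, E) 𝓘(ℝ, ℝ) ∞ r) {q : X}
    (hq : q ∈ (extChartAt 𝓘(ℝ, E) p).source) (w : E) :
    diff r q (symmD p (extChartAt 𝓘(ℝ, E) p q) w : E) =
      fderiv ℝ (inChart p r) (extChartAt 𝓘(ℝ, E) p q) w := by
  refine (diff_eq hq ((hrs _).of_le (by simp)) _).trans ?_
  have := chartD_symmD ((extChartAt 𝓘(ℝ, E) p).map_source hq) w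
  rw [(extChartAt 𝓘(ℝ, E) p).left_inv hq] at this
  rw [this]

lemma symmD_J {q : X} (hq : q ∈ (extChartAt 𝓘(ℝ, E) p).source) (w : E) :
    symmD p (extChartAt 𝓘(ℝ, E) p q) (Complex.I • w) =
      Complex.I • symmD p (extChartAt 𝓘(ℝ, E) p q) w := by
  have h1 := chartD_symmD ((extChartAt 𝓘(ℝ, E) p).map_source hq) w
  rw [(extChartAt 𝓘(ℝ, E) p).left_inv hq] at h1
  rw [← symmD_chartD hq (Complex.I • symmD p (extChartAt 𝓘(ℝ, E) p q) w), chartD_J hq, h1]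

/-- A smooth vector field on `X`, tangent to `M = bΩ` along `M`, and normalized by
`dr(JT) = -1` there; equivalently `θ(T) = 1` for the pseudo-Hermitian structure `θ = -dr ∘ J`. -/
structure IsCharacteristicField (Ω : Set X) (r : X → ℝ)
    (T : Π p : X, TangentSpace 𝓘(ℝ, E) p) : Prop where
  smooth : IsSmoothVectorField T
  tangent : ∀ q ∈ frontier Ω, diff r q (T q) = 0
  normal : ∀ q ∈ frontier Ω, diff r q (J q (T q)) = -1

variable [FiniteDimensional ℂ E] [T2Space X] [SecondCountableTopology X]

/-- A function smooth near a closed set `K` agrees near `K` with a global smooth function. -/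
lemma exists_smooth_extension {K U : Set X} (hK : IsClosed K) (hU : IsOpen U) (hKU : K ⊆ U)
    {f : X → ℝ} (hf : ContMDiffOn 𝓘(ℝ, E) 𝓘(ℝ, ℝ) ∞ f U) :
    ∃ g : X → ℝ, ContMDiff 𝓘(ℝ, E) 𝓘(ℝ, ℝ) ∞ g ∧ ∃ V, IsOpen V ∧ K ⊆ V ∧ V ⊆ U ∧
      EqOn g f V := by
  have : SigmaCompactSpace X := sigmaCompactSpace_of_charted E X
  have : LocallyCompactSpace X := ChartedSpace.locallyCompactSpace E X
  obtain ⟨V, hV, hKV, hVU⟩ := normal_exists_closure_subset hK hU hKU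
  have hconv : ∀ x, Convex ℝ {c : ℝ | x ∈ closure V → c = f x} := by
    intro x a ha b hb s t _ _ hst hx
    rw [ha hx, hb hx, ← add_smul, hst, one_smul]
  obtain ⟨g, hg⟩ := exists_contMDiffMap_forall_mem_convex_of_local (n := ⊤) 𝓘(ℝ, E) hconv (by
    intro x
    by_cases hx : x ∈ U
    · exact ⟨U, hU.mem_nhds hx, f, hf, fun y _ _ => rfl⟩
    · exact ⟨(closure V)ᶜ, isClosed_closure.isOpen_compl.mem_nhds fun h => hx (hVU h), fun _ => 0,
        contMDiffOn_const, fun y hy hy' => absurd hy' hy⟩)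
  exact ⟨g, g.contMDiff, V, hV, hKV, subset_closure.trans hVU,
    fun x hx => hg x (subset_closure hx)⟩

/-- A smooth vector field with prescribed convex constraints exists if the constraints can be
solved locally in charts. -/
lemma exists_smooth_field (t : Π q : X, Set (TangentSpace 𝓘(ℝ, E) q))
    (ht : ∀ q, Convex ℝ (t q))
    (hloc : ∀ p : X, ∃ w : E → E, (∀ᶠ y in 𝓝 (extChartAt 𝓘(ℝ, E) p p), ContDiffAt ℝ ∞ w y) ∧
      ∀ᶠ q in 𝓝 p, (symmD p (extChartAt 𝓘(ℝ, E) p q) (w (extChartAt 𝓘(ℝ, E) p q)) : E) ∈ t q) :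
    ∃ V : Π q : X, TangentSpace 𝓘(ℝ, E) q, IsSmoothVectorField V ∧ ∀ q, V q ∈ t q := by
  have : SigmaCompactSpace X := sigmaCompactSpace_of_charted E X
  obtain ⟨s, hs⟩ := exists_contMDiffSection_forall_mem_convex_of_local (n := ⊤) 𝓘(ℝ, E)
    (F_fiber := E) (fun q : X => TangentSpace 𝓘(ℝ, E) q) t ht (by
    intro p
    obtain ⟨w, hw, hwt⟩ := hloc p
    have h1 := (eventually_extChartAt hw).and (hwt.and (eventually_source (E := E) p))
    obtain ⟨U, hU, hUo, hpU⟩ := eventually_nhds_iff.1 h1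
    refine ⟨U, hUo.mem_nhds hpU,
      fun q => (symmD p (extChartAt 𝓘(ℝ, E) p q) (w (extChartAt 𝓘(ℝ, E) p q)) : E), ?_,
      fun q hq => (hU q hq).2.1⟩
    intro q hq
    obtain ⟨h2, -, h3⟩ := hU q hq
    refine ContMDiffAt.contMDiffWithinAt ?_
    refine (contMDiffAt_field_iff h3 _).2 ?_
    refine (contMDiffAt_of_comp_chart (n := ⊤) h3 h2).congr_of_eventuallyEq ?_
    filter_upwards [(isOpen_extChartAt_source p).mem_nhds h3] with z hz
    have := chartD_symmD ((extChartAt 𝓘(ℝ, E) p).map_source hz) (w (extChartAt 𝓘(ℝ, E) p z))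
    rwa [(extChartAt 𝓘(ℝ, E) p).left_inv hz] at this)
  exact ⟨s, s.contMDiff, hs⟩

/-- Every vector tangent to the boundary extends to a smooth field tangent to the boundary. -/
lemma exists_boundaryField (hr : IsDefiningFunction E Ω r)
    (hrs : ContMDiff 𝓘(ℝ, E) 𝓘(ℝ, ℝ) ∞ r) (hΩ : IsOpen Ω) (hp : p ∈ frontier Ω) (v : E)
    (hv : fderiv ℝ (inChart p r) (extChartAt 𝓘(ℝ, E) p p) v = 0) :
    ∃ V : Π q : X, TangentSpace 𝓘(ℝ, E) q, IsBoundaryField Ω V ∧ V p = v := by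
  obtain ⟨V, hV, hVt⟩ := exists_smooth_field
    (fun q => {w | (q ∈ frontier Ω → diff r q w = 0) ∧ (q = p → (w : E) = v)})
    (by
      intro q a ha b hb s t _ _ hst
      refine ⟨fun hq => ?_, fun hq => ?_⟩
      · rw [map_add, map_smul, map_smul, ha.1 hq, hb.1 hq]; simp
      · rw [ha.2 hq, hb.2 hq]
        exact (add_smul s t v).symm.trans (by rw [hst, one_smul]))
    (by
      intro p'
      by_cases hpp : p' = p
      · subst hpp
        obtain ⟨e, he⟩ : ∃ e, fderiv ℝ (inChart p' r) (extChartAt 𝓘(ℝ, E) p' p') e ≠ 0 := by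
          by_contra! h
          exact hr.fderiv_inChart_ne_zero hp (ContinuousLinearMap.ext h)
        have hsm : ∀ᶠ y in 𝓝 (extChartAt 𝓘(ℝ, E) p' p'),
            ContDiffAt ℝ ∞ (fderiv ℝ (inChart p' r)) y := by
          filter_upwards [eventually_target p'] with y hy
          exact (contDiffAt_inChart hrs hy).fderiv_right (m := ∞) (by norm_cast)
        have hne : ∀ᶠ y in 𝓝 (extChartAt 𝓘(ℝ, E) p' p'), fderiv ℝ (inChart p' r) y e ≠ 0 :=
          (hsm.self_of_nhds.continuousAt.clm_apply continuousAt_const).eventually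
            (isOpen_ne.mem_nhds he)
        refine ⟨fun y => v - (fderiv ℝ (inChart p' r) y v / fderiv ℝ (inChart p' r) y e) • e,
          ?_, ?_⟩
        · filter_upwards [hsm, hne] with y h1 h2
          exact contDiffAt_const.sub (((h1.clm_apply contDiffAt_const).div
            (h1.clm_apply contDiffAt_const) h2).smul contDiffAt_const)
        · filter_upwards [eventually_extChartAt hne, eventually_source (E := E) p'] with q h1 hq
          refine ⟨fun _ => ?_, ?_⟩
          · refine (diff_symmD hrs hq _).trans ?_
            rw [map_sub, map_smul, smul_eq_mul, div_mul_cancel₀ _ h1, sub_self]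
          · rintro rfl
            rw [hv, zero_div, zero_smul, sub_zero]
            have := symmD_chartD hq v
            rwa [chartD_self] at this
      · refine ⟨fun _ => 0, Eventually.of_forall fun _ => contDiffAt_const, ?_⟩
        filter_upwards [isOpen_ne.mem_nhds hpp] with q hq
        rw [map_zero]
        exact ⟨fun _ => map_zero _, fun h => absurd h hq⟩)
  refine ⟨V, ⟨hV, fun q hq => ?_⟩, (hVt p).2 rfl⟩
  exact (hr.mem_boundaryTangent_iff hΩ hq _).2
    ((diff_eq_inChart (hrs q) _).symm.trans ((hVt q).1 hq))

lemma exists_characteristicField (hr : IsDefiningFunction E Ω r)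
    (hrs : ContMDiff 𝓘(ℝ, E) 𝓘(ℝ, ℝ) ∞ r) :
    ∃ T : Π q : X, TangentSpace 𝓘(ℝ, E) q, IsCharacteristicField Ω r T := by
  obtain ⟨T, hT, hTt⟩ := exists_smooth_field
    (fun q => {w | q ∈ frontier Ω → diff r q w = 0 ∧ diff r q (J q w) = -1})
    (by
      intro q a ha b hb s t _ _ hst hq
      obtain ⟨h1, h2⟩ := ha hq
      obtain ⟨h3, h4⟩ := hb hq
      refine ⟨?_, ?_⟩
      · rw [map_add, map_smul, map_smul, h1, h3]; simp
      · rw [map_add, map_add, map_smul, map_smul, map_smul, map_smul, h2, h4, smul_neg, smul_neg,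
          ← neg_add]
        simp [hst])
    (by
      intro p
      by_cases hp : p ∈ frontier Ω
      · obtain ⟨e, he⟩ : ∃ e, fderiv ℝ (inChart p r) (extChartAt 𝓘(ℝ, E) p p) e ≠ 0 := by
          by_contra! h
          exact hr.fderiv_inChart_ne_zero hp (ContinuousLinearMap.ext h)
        have hsm : ∀ᶠ y in 𝓝 (extChartAt 𝓘(ℝ, E) p p),
            ContDiffAt ℝ ∞ (fderiv ℝ (inChart p r)) y := by
          filter_upwards [eventually_target p] with y hy
          exact (contDiffAt_inChart hrs hy).fderiv_right (m := ∞) (by norm_cast)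
        have hne : ∀ᶠ y in 𝓝 (extChartAt 𝓘(ℝ, E) p p), fderiv ℝ (inChart p r) y e ≠ 0 :=
          (hsm.self_of_nhds.continuousAt.clm_apply continuousAt_const).eventually
            (isOpen_ne.mem_nhds he)
        -- With `a = dF(e)` and `b = dF(ie)`, the solution is `(a ie - b e) / (a² + b²)`.
        have hl : ∀ (l : E →L[ℝ] ℝ) (s t : ℝ) (u w : E), l (s • u + t • w) = s * l u + t * l w :=
          fun l s t u w => by rw [map_add, map_smul, map_smul, smul_eq_mul, smul_eq_mul]
        set a : E → ℝ := fun y => fderiv ℝ (inChart p r) y e with ha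
        set b : E → ℝ := fun y => fderiv ℝ (inChart p r) y (Complex.I • e) with hb
        have hpos : ∀ y, a y ≠ 0 → a y ^ 2 + b y ^ 2 ≠ 0 := fun y h => by positivity
        refine ⟨fun y => (-b y / (a y ^ 2 + b y ^ 2)) • e +
          (a y / (a y ^ 2 + b y ^ 2)) • (Complex.I • e), ?_, ?_⟩
        · filter_upwards [hsm, hne] with y h1 h2
          have h3 : ContDiffAt ℝ ∞ a y := h1.clm_apply contDiffAt_const
          have h4 : ContDiffAt ℝ ∞ b y := h1.clm_apply contDiffAt_const
          have h5 : ContDiffAt ℝ ∞ (fun y => a y ^ 2 + b y ^ 2) y := (h3.pow 2).add (h4.pow 2)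
          exact ((h4.neg.div h5 (hpos y h2)).smul contDiffAt_const).add
            ((h3.div h5 (hpos y h2)).smul contDiffAt_const)
        · filter_upwards [eventually_extChartAt hne, eventually_source (E := E) p] with q h1 hq _
          have h2 := hpos _ h1
          refine ⟨(diff_symmD hrs hq _).trans ?_, ?_⟩
          · rw [hl]
            change -b _ / _ * a _ + a _ / _ * b _ = 0
            ring
          · refine (congrArg (diff r q) (symmD_J hq _).symm).trans ((diff_symmD hrs hq _).trans ?_)
            rw [smul_add, smul_comm Complex.I, smul_comm Complex.I, I_smul_I_smul, hl,
              map_neg]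
            change -b _ / _ * b _ + a _ / _ * -a _ = -1
            field_simp
            ring
      · refine ⟨fun _ => 0, Eventually.of_forall fun _ => contDiffAt_const, ?_⟩
        filter_upwards [isClosed_frontier.isOpen_compl.mem_nhds hp] with q hq hq'
        exact absurd hq' hq)
  exact ⟨T, hT, fun q hq => (hTt q hq).1, fun q hq => (hTt q hq).2⟩

end Existence

/-! ### D'Angelo forms of defining functions -/

section DAngelo

set_option synthInstance.maxHeartbeats 400000

variable {E : Type*} [NormedAddCommGroup E] [NormedSpace ℂ E]
  {X : Type*} [TopologicalSpace X] [ChartedSpace E X]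
  {Ω : Set X} {r : X → ℝ} {p : X}

/-- The one-form `V ↦ -4 Re ∂∂̄r(V, JT)`. When `T` is a characteristic field of `r`, it is the
D'Angelo form of the pair `(-dr ∘ J, T)`, see `isDAngeloForm_danForm`. -/
def danForm (r : X → ℝ) (T : Π q : X, TangentSpace 𝓘(ℝ, E) q) :
    Π q : X, TangentSpace 𝓘(ℝ, E) q →L[ℝ] ℝ := fun q =>
  (-(leviB (inChart q r) (extChartAt 𝓘(ℝ, E) q q)).flip (mulI E (T q)) : E →L[ℝ] ℝ)

/-- The one-form `-dr ∘ J`. -/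
def charForm (r : X → ℝ) : Π q : X, TangentSpace 𝓘(ℝ, E) q →L[ℝ] ℝ := fun q =>
  (-(diff r q : E →L[ℝ] ℝ).comp (mulI E) : E →L[ℝ] ℝ)

lemma danForm_apply (r : X → ℝ) (T : Π q : X, TangentSpace 𝓘(ℝ, E) q) (q : X) (v : E) :
    danForm r T q v =
      -leviB (inChart q r) (extChartAt 𝓘(ℝ, E) q q) v (mulI E (T q)) := rfl

lemma charForm_apply (r : X → ℝ) (q : X) (v : E) :
    charForm r q v = -diff r q (J q v) := rfl

variable [IsManifold 𝓘(ℂ, E) ω X]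

lemma isSmoothOneForm_of_chart {α : Π q : X, TangentSpace 𝓘(ℝ, E) q →L[ℝ] ℝ}
    (h : ∀ p, ∃ a : E → E →L[ℝ] ℝ, ContDiffAt ℝ ∞ a (extChartAt 𝓘(ℝ, E) p p) ∧
      ∀ᶠ y in 𝓝 (extChartAt 𝓘(ℝ, E) p p), ∀ u, formInChart p α y u = a y u) :
    IsSmoothOneForm α := by
  intro p
  obtain ⟨a, ha, haα⟩ := h p
  refine (contMDiffAt_form_iff (mem_extChartAt_source p) α).2 ?_
  refine (contMDiffAt_of_comp_chart (n := ⊤) (mem_extChartAt_source p) ha).congr_of_eventuallyEq ?_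
  filter_upwards [eventually_extChartAt haα, eventually_source (E := E) p] with q hq hqs
  rw [← ContinuousLinearMap.ext hq]
  change _ = (α ((extChartAt 𝓘(ℝ, E) p).symm (extChartAt 𝓘(ℝ, E) p q)) : E →L[ℝ] ℝ).comp _
  exact congrArg (fun z => (α z : E →L[ℝ] ℝ).comp (symmD p (extChartAt 𝓘(ℝ, E) p q)))
    ((extChartAt 𝓘(ℝ, E) p).left_inv hqs).symm

lemma formInChart_danForm (hrs : ContMDiff 𝓘(ℝ, E) 𝓘(ℝ, ℝ) ∞ r)
    (T : Π q : X, TangentSpace 𝓘(ℝ, E) q) {y : E} (hy : y ∈ (extChartAt 𝓘(ℝ, E) p).target)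
    (u : E) : formInChart p (danForm r T) y u =
      -leviB (inChart p r) y u (Complex.I • fieldInChart p T y) := by
  have hq := (extChartAt 𝓘(ℝ, E) p).map_target hy
  have key : ∀ w : E, leviB (inChart ((extChartAt 𝓘(ℝ, E) p).symm y) r) _ (symmD p y u)
      (Complex.I • w) = leviB (inChart p r) y u (Complex.I • chartD p _ w) := fun w => by
    rw [leviB_inChart_eq hq ((hrs _).of_le (by norm_cast)), chartD_symmD hy, chartD_J hq,
      (extChartAt 𝓘(ℝ, E) p).right_inv hy]
  exact congrArg Neg.neg (key (T ((extChartAt 𝓘(ℝ, E) p).symm y)))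

lemma formInChart_charForm (hrs : ContMDiff 𝓘(ℝ, E) 𝓘(ℝ, ℝ) ∞ r)
    {y : E} (hy : y ∈ (extChartAt 𝓘(ℝ, E) p).target)
    (u : E) : formInChart p (charForm r) y u = -fderiv ℝ (inChart p r) y (Complex.I • u) := by
  have hq := (extChartAt 𝓘(ℝ, E) p).map_target hy
  refine (charForm_apply r _ _).trans ?_
  have h1 := fderiv_inChart_chartD hrs hy (Complex.I • symmD p y u)
  rw [chartD_J hq, chartD_symmD hy] at h1
  rw [h1]
  rfl

lemma isSmoothOneForm_danForm (hrs : ContMDiff 𝓘(ℝ, E) 𝓘(ℝ, ℝ) ∞ r)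
    {T : Π q : X, TangentSpace 𝓘(ℝ, E) q} (hT : IsSmoothVectorField T) :
    IsSmoothOneForm (danForm r T) := by
  apply isSmoothOneForm_of_chart
  intro p
  refine ⟨fun y => -(leviB (inChart p r) y).flip (Complex.I • fieldInChart p T y), ?_, ?_⟩
  · have h1 : ContDiffAt ℝ ∞ (fderiv ℝ (inChart p r)) (extChartAt 𝓘(ℝ, E) p p) :=
      (contDiffAt_inChart hrs (mem_extChartAt_target p)).fderiv_right (m := ∞) (by norm_cast)
    have h2 : ContDiffAt ℝ ∞ (hess (inChart p r)) (extChartAt 𝓘(ℝ, E) p p) :=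
      h1.fderiv_right (m := ∞) (by norm_cast)
    have h3 : ContDiffAt ℝ ∞ (leviB (inChart p r)) (extChartAt 𝓘(ℝ, E) p p) :=
      (hermPart (E := E)).contDiff.contDiffAt.comp _ h2
    have h4 : ContDiffAt ℝ ∞ (fun y => (leviB (inChart p r) y).flip) (extChartAt 𝓘(ℝ, E) p p) :=
      (ContinuousLinearMap.flipₗᵢ ℝ E E ℝ).contDiff.contDiffAt.comp _ h3
    exact (h4.clm_apply ((mulI E).contDiff.contDiffAt.comp _ (hT.fieldInChart_contDiffAt p))).neg
  · filter_upwards [eventually_target p] with y hy u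
    exact formInChart_danForm hrs T hy u

lemma isSmoothOneForm_charForm (hrs : ContMDiff 𝓘(ℝ, E) 𝓘(ℝ, ℝ) ∞ r) :
    IsSmoothOneForm (charForm (E := E) r) := by
  apply isSmoothOneForm_of_chart
  intro p
  refine ⟨fun y => -(fderiv ℝ (inChart p r) y).comp (mulI E), ?_, ?_⟩
  · have h1 : ContDiffAt ℝ ∞ (fderiv ℝ (inChart p r)) (extChartAt 𝓘(ℝ, E) p p) :=
      (contDiffAt_inChart hrs (mem_extChartAt_target p)).fderiv_right (m := ∞) (by norm_cast)
    exact (h1.clm_comp contDiffAt_const).neg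
  · filter_upwards [eventually_target p] with y hy u
    exact formInChart_charForm hrs hy u

lemma isSmoothOneForm_diff (hrs : ContMDiff 𝓘(ℝ, E) 𝓘(ℝ, ℝ) ∞ r) :
    IsSmoothOneForm (fun q => (diff r q : TangentSpace 𝓘(ℝ, E) q →L[ℝ] ℝ)) := by
  apply isSmoothOneForm_of_chart
  intro p
  refine ⟨fderiv ℝ (inChart p r), ?_, ?_⟩
  · exact (contDiffAt_inChart hrs (mem_extChartAt_target p)).fderiv_right (m := ∞) (by norm_cast)
  · filter_upwards [eventually_target p] with y hy u
    have h1 := fderiv_inChart_chartD hrs hy (symmD p y u)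
    rw [chartD_symmD hy] at h1
    exact h1.symm

lemma fderiv_inChart_fieldInChart (hrs : ContMDiff 𝓘(ℝ, E) 𝓘(ℝ, ℝ) ∞ r)
    (V : Π q : X, TangentSpace 𝓘(ℝ, E) q) {y : E} (hy : y ∈ (extChartAt 𝓘(ℝ, E) p).target) :
    fderiv ℝ (inChart p r) y (fieldInChart p V y) =
      diff r ((extChartAt 𝓘(ℝ, E) p).symm y) (V ((extChartAt 𝓘(ℝ, E) p).symm y)) :=
  fderiv_inChart_chartD hrs hy _

lemma fderiv_inChart_I_fieldInChart (hrs : ContMDiff 𝓘(ℝ, E) 𝓘(ℝ, ℝ) ∞ r)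
    (V : Π q : X, TangentSpace 𝓘(ℝ, E) q) {y : E} (hy : y ∈ (extChartAt 𝓘(ℝ, E) p).target) :
    fderiv ℝ (inChart p r) y (Complex.I • fieldInChart p V y) =
      diff r ((extChartAt 𝓘(ℝ, E) p).symm y) (J _ (V ((extChartAt 𝓘(ℝ, E) p).symm y))) := by
  have hq := (extChartAt 𝓘(ℝ, E) p).map_target hy
  have h := chartD_J hq (V ((extChartAt 𝓘(ℝ, E) p).symm y))
  exact (congrArg (fderiv ℝ (inChart p r) y) h.symm).trans (fderiv_inChart_chartD hrs hy _)

/-- The defining expression of a D'Angelo form, when `θ = -ε dr ∘ J` along `M` near `p`. -/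
lemma form_mlieBracket [CompleteSpace E] (hr : IsDefiningFunction E Ω r)
    (hrs : ContMDiff 𝓘(ℝ, E) 𝓘(ℝ, ℝ) ∞ r) (hΩ : IsOpen Ω) (hp : p ∈ frontier Ω)
    {θ : Π q : X, TangentSpace 𝓘(ℝ, E) q →L[ℝ] ℝ} {T V : Π q : X, TangentSpace 𝓘(ℝ, E) q}
    {ε : ℝ} (hθ : IsSmoothOneForm θ) (hT : IsSmoothVectorField T) (hV : IsSmoothVectorField V)
    (hdT : ∀ q ∈ frontier Ω, diff r q (T q) = 0) (hdV : ∀ q ∈ frontier Ω, diff r q (V q) = 0)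
    (hθT : ∀ q ∈ frontier Ω, θ q (T q) = 1)
    (hθr : ∀ᶠ q in 𝓝 p, q ∈ frontier Ω → ∀ u, diff r q u = 0 → θ q u = -(ε * diff r q (J q u))) :
    θ p (VectorField.mlieBracket 𝓘(ℝ, E) T (fun q => V q - θ q (V q) • T q) p) =
      -(ε * leviB (inChart p r) (extChartAt 𝓘(ℝ, E) p p) (V p) (mulI E (T p))) := by
  have hfr := eventually_extChartAt_symm (E := E) (hr.eventually_frontier_iff hΩ hp)
  have key := pseudoHermitian_lieBracket (F := inChart p r) (x := extChartAt 𝓘(ℝ, E) p p)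
    (θ := formInChart p θ) (T := fieldInChart p T) (V := fieldInChart p V) (ε := ε)
    ((contDiffAt_inChart hrs (mem_extChartAt_target p)).of_le (by norm_cast))
    (hr.inChart_eq_zero hΩ hp) ((hθ.formInChart_contDiffAt p).of_le (by norm_cast))
    ((hT.fieldInChart_contDiffAt p).of_le (by norm_cast))
    ((hV.fieldInChart_contDiffAt p).of_le (by norm_cast))
    (by
      filter_upwards [eventually_target p, hfr] with y hy h1 h0
      rw [fderiv_inChart_fieldInChart hrs T hy]
      exact hdT _ (h1.2 h0))
    (by
      filter_upwards [eventually_target p, hfr] with y hy h1 h0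
      rw [fderiv_inChart_fieldInChart hrs V hy]
      exact hdV _ (h1.2 h0))
    (by
      filter_upwards [eventually_target p, hfr] with y hy h1 h0
      have h2 := formInChart_apply ((extChartAt 𝓘(ℝ, E) p).map_target hy) θ
        (T ((extChartAt 𝓘(ℝ, E) p).symm y))
      rw [(extChartAt 𝓘(ℝ, E) p).right_inv hy] at h2
      exact h2.trans (hθT _ (h1.2 h0)))
    (by
      filter_upwards [eventually_target p, hfr, eventually_extChartAt_symm hθr]
        with y hy h1 h3 h0 u hu
      have hq := (extChartAt 𝓘(ℝ, E) p).map_target hy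
      have h4 : ∀ w : E, diff r ((extChartAt 𝓘(ℝ, E) p).symm y) (symmD p y w : E) =
          fderiv ℝ (inChart p r) y w := fun w => by
        have := fderiv_inChart_chartD hrs hy (symmD p y w)
        rw [chartD_symmD hy] at this
        exact this.symm
      have h5 := symmD_J hq u
      rw [(extChartAt 𝓘(ℝ, E) p).right_inv hy] at h5
      refine (h3 (h1.2 h0) (symmD p y u : E) ((h4 u).trans hu)).trans ?_
      rw [← h4, h5]
      rfl)
  rw [mlieBracket_eq]
  have h1 : fieldInChart p (fun q => V q - θ q (V q) • T q) =ᶠ[𝓝 (extChartAt 𝓘(ℝ, E) p p)]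
      fun y => fieldInChart p V y -
        formInChart p θ y (fieldInChart p V y) • fieldInChart p T y := by
    filter_upwards [eventually_target p] with y hy
    have h2 := formInChart_apply ((extChartAt 𝓘(ℝ, E) p).map_target hy) θ
        (V ((extChartAt 𝓘(ℝ, E) p).symm y))
    rw [(extChartAt 𝓘(ℝ, E) p).right_inv hy] at h2
    change chartD p _ _ = _
    rw [fieldInChart, fieldInChart, h2]
    exact (map_sub _ _ _).trans (congrArg _ (map_smul _ _ _))
  rw [Filter.EventuallyEq.lieBracket_vectorField_eq (𝕜 := ℝ) EventuallyEq.rfl h1]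
  refine (formInChart_self p θ _).symm.trans (key.trans ?_)
  rw [fieldInChart_self, fieldInChart_self]
  rfl

lemma IsDefiningFunction.mem_boundaryTangent_iff_diff (hr : IsDefiningFunction E Ω r)
    (hΩ : IsOpen Ω) (hp : p ∈ frontier Ω) (v : TangentSpace 𝓘(ℝ, E) p) :
    v ∈ boundaryTangent Ω p ↔ diff r p v = 0 := by
  refine (hr.mem_boundaryTangent_iff hΩ hp v).trans (Eq.congr_left ?_)
  exact (diff_eq_inChart (hr.contMDiffAt (frontier_subset_closure hp)) v).symm

/-- The pair `(-dr ∘ J, T)` exhibits `danForm r T` as a D'Angelo form. -/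
lemma isDAngeloForm_danForm [CompleteSpace E] (hr : IsDefiningFunction E Ω r)
    (hrs : ContMDiff 𝓘(ℝ, E) 𝓘(ℝ, ℝ) ∞ r) (hΩ : IsOpen Ω)
    {T : Π q : X, TangentSpace 𝓘(ℝ, E) q} (hT : IsCharacteristicField Ω r T) :
    IsDAngeloForm Ω (danForm r T) := by
  have hmem := fun q (hq : q ∈ frontier Ω) => hr.mem_boundaryTangent_iff_diff hΩ hq
  have hθT : ∀ q ∈ frontier Ω, charForm r q (T q) = 1 := fun q hq => by
    refine (charForm_apply (E := E) r q _).trans ?_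
    rw [neg_eq_iff_eq_neg]
    exact hT.normal q hq
  refine ⟨isSmoothOneForm_danForm hrs hT.smooth, charForm r, T,
    ⟨isSmoothOneForm_charForm hrs, fun q hq => ⟨fun v hv => ?_, T q, ?_, ?_⟩⟩,
    ⟨hT.smooth, fun q hq => (hmem q hq _).2 (hT.tangent q hq)⟩, hθT, ?_⟩
  · refine (charForm_apply (E := E) r q v).trans (neg_eq_zero.2 ?_)
    exact (hmem q hq _).1 hv.2
  · exact (hmem q hq _).2 (hT.tangent q hq)
  · rw [hθT q hq]; exact one_ne_zero
  · intro V hV p hp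
    rw [form_mlieBracket hr hrs hΩ hp (ε := 1) (isSmoothOneForm_charForm hrs) hT.smooth hV.1
      hT.tangent (fun q hq => (hmem q hq _).1 (hV.2 q hq)) hθT
      (Eventually.of_forall fun q _ u _ => by
        rw [one_mul]; exact charForm_apply (E := E) r q u), one_mul]
    exact danForm_apply r T p _

end DAngelo

/-! ### Strictly plurisubharmonic weights -/

section Perturbation

set_option synthInstance.maxHeartbeats 400000

variable {E : Type*} [NormedAddCommGroup E] [NormedSpace ℂ E]

lemma leviB_congr {F G : E → ℝ} {y : E} (h : F =ᶠ[𝓝 y] G) : leviB F y = leviB G y := by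
  rw [leviB, leviB, hess, hess, h.fderiv.fderiv_eq]

lemma gradSq_congr {F G : E → ℝ} {y : E} (h : F =ᶠ[𝓝 y] G) : gradSq F y = gradSq G y := by
  funext v
  rw [gradSq, gradSq, h.fderiv_eq]

variable {X : Type*} [TopologicalSpace X] [ChartedSpace E X]
  {Ω : Set X} {r : X → ℝ} {p : X}

lemma norm_onHol_sq (l : TangentSpace 𝓘(ℝ, E) p →L[ℝ] ℝ) (v : TangentSpace 𝓘(ℝ, E) p) :
    ‖onHol l v‖ ^ 2 = (l v ^ 2 + l (J p v) ^ 2) / 4 := by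
  rw [Complex.sq_norm, Complex.normSq_apply]
  simp only [onHol, Complex.div_ofNat_re, Complex.div_ofNat_im, Complex.sub_re, Complex.sub_im,
    Complex.mul_re, Complex.mul_im, Complex.ofReal_re, Complex.ofReal_im, Complex.I_re,
    Complex.I_im]
  ring

lemma onHol_add_of_eq {l l₁ l₂ : TangentSpace 𝓘(ℝ, E) p →L[ℝ] ℝ} {v : TangentSpace 𝓘(ℝ, E) p}
    (h : l v = l₁ v + l₂ v) (hJ : l (J p v) = l₁ (J p v) + l₂ (J p v)) :
    onHol l v = onHol l₁ v + onHol l₂ v := by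
  rw [onHol, onHol, onHol, h, hJ]
  push_cast
  ring

lemma norm_onHol_sq_eq_leviSq {n v : E} (hr : IsNull (inChart p r) (extChartAt 𝓘(ℝ, E) p p) v)
    {l : TangentSpace 𝓘(ℝ, E) p →L[ℝ] ℝ}
    (hl : ∀ v : E, fderiv ℝ (inChart p r) (extChartAt 𝓘(ℝ, E) p p) v = 0 →
        l v = -leviB (inChart p r) (extChartAt 𝓘(ℝ, E) p p) v n) :
    ‖onHol l v‖ ^ 2 = leviSq (inChart p r) (extChartAt 𝓘(ℝ, E) p p) n v / 4 := by
  refine (norm_onHol_sq l v).trans ?_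
  have h1 : l (J p v) = -leviB (inChart p r) (extChartAt 𝓘(ℝ, E) p p) (Complex.I • v) n :=
    hl _ hr.2.1
  rw [hl v hr.1, h1, leviSq]
  ring

/-- A smooth function whose germ along `M` is plurisubharmonic, strictly so on `M`, with
`|∂ψ(Z)|² ≤ ∂∂̄ψ(Z, Z̄)`. -/
structure IsStrictWeight (Ω : Set X) (ψ : X → ℝ) : Prop where
  smooth : ContMDiff 𝓘(ℝ, E) 𝓘(ℝ, ℝ) ∞ ψ
  gradSq_le : ∀ p ∈ frontier Ω, ∀ᶠ y in 𝓝 (extChartAt 𝓘(ℝ, E) p p), ∀ v,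
    gradSq (inChart p ψ) y v ≤ leviB (inChart p ψ) y v v
  pos : ∀ p ∈ frontier Ω, ∀ v, v ≠ 0 →
    0 < leviB (inChart p ψ) (extChartAt 𝓘(ℝ, E) p p) v v

lemma IsDefiningFunction.congr {s : X → ℝ} (hr : IsDefiningFunction E Ω r) {V : Set X}
    (hV : IsOpen V) (hΩV : closure Ω ⊆ V) (h : EqOn s r V) : IsDefiningFunction E Ω s := by
  obtain ⟨U, hU, hΩU, hs, hΩ, hd⟩ := hr
  refine ⟨U ∩ V, hU.inter hV, subset_inter hΩU hΩV,
    (hs.mono inter_subset_left).congr fun x hx => h hx.2, ?_, fun p hp => ?_⟩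
  · ext x
    rw [hΩ]
    constructor
    · intro hx
      have hxV : x ∈ V := hΩV (subset_closure (by rw [hΩ]; exact hx))
      exact ⟨⟨hx.1, hxV⟩, (h hxV).trans_lt hx.2⟩
    · rintro ⟨⟨h1, h2⟩, h3⟩
      exact ⟨h1, (h h2).symm.trans_lt h3⟩
  · have h1 : s =ᶠ[𝓝 p] r := eventually_of_mem (hV.mem_nhds (hΩV (frontier_subset_closure hp))) h
    intro h0
    exact hd p hp ((h1.mfderiv_eq).symm.trans h0)

lemma contMDiff_exp_mul {f : X → ℝ} (hf : ContMDiff 𝓘(ℝ, E) 𝓘(ℝ, ℝ) ∞ f)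
    (hrs : ContMDiff 𝓘(ℝ, E) 𝓘(ℝ, ℝ) ∞ r) :
    ContMDiff 𝓘(ℝ, E) 𝓘(ℝ, ℝ) ∞ (fun x => Real.exp (f x) * r x) :=
  (Real.contDiff_exp.contMDiff.comp hf).mul hrs

variable [IsManifold 𝓘(ℂ, E) ω X]

/-- If `ψ` is strictly plurisubharmonic and `ψ < B` on `M`, then `e^(ψ - B)` is a strict weight. -/
lemma exists_isStrictWeight [FiniteDimensional ℂ E] [T2Space X] [SecondCountableTopology X]
    (hcpt : IsCompact (frontier Ω)) {ψ : X → ℝ} {W : Set X} (hW : IsOpen W)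
    (hΩW : frontier Ω ⊆ W) (hψ : IsSmoothStrictlyPlurisubharmonicOn E ψ W) :
    ∃ g : X → ℝ, IsStrictWeight (E := E) Ω g := by
  obtain ⟨hψs, hψp⟩ := hψ
  obtain ⟨B, hB⟩ : ∃ B, ∀ p ∈ frontier Ω, ψ p < B := by
    obtain ⟨B, hB⟩ := hcpt.bddAbove_image (hψs.continuousOn.mono hΩW)
    exact ⟨B + 1, fun p hp => (hB (mem_image_of_mem _ hp)).trans_lt (lt_add_one B)⟩
  obtain ⟨g, hg, V, hV, hΩV, hVW, hgV⟩ := exists_smooth_extension (E := E)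
    (f := fun x => Real.exp (ψ x - B)) isClosed_frontier
    (hψs.continuousOn.isOpen_inter_preimage hW isOpen_Iio)
    (fun p hp => ⟨hΩW hp, hB p hp⟩)
    (by
      have h1 : ContDiff ℝ ∞ (fun t : ℝ => Real.exp (t - B)) := by fun_prop
      exact (h1.contMDiff.comp_contMDiffOn hψs).mono inter_subset_left)
  have key : ∀ p ∈ frontier Ω, ∀ᶠ y in 𝓝 (extChartAt 𝓘(ℝ, E) p p), ∀ v,
      gradSq (inChart p g) y v ≤ leviB (inChart p g) y v v ∧
      (v ≠ 0 → 0 < leviB (inChart p g) y v v) := by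
    intro p hp
    have hpV : ∀ᶠ q in 𝓝 p, q ∈ V := hV.mem_nhds (hΩV hp)
    have h1 := (eventually_extChartAt_symm (E := E) hpV).eventually_nhds
    filter_upwards [eventually_target p, h1] with y hy hyV v
    have hq := (extChartAt 𝓘(ℝ, E) p).map_target hy
    have hqV := hyV.self_of_nhds
    have hy' := (extChartAt 𝓘(ℝ, E) p).right_inv hy
    set q := (extChartAt 𝓘(ℝ, E) p).symm y with hqdef
    obtain ⟨hqW, hqB⟩ := hVW hqV
    have hψq : ContMDiffAt 𝓘(ℝ, E) 𝓘(ℝ, ℝ) ∞ ψ q := hψs.contMDiffAt (hW.mem_nhds hqW)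
    have hψy : ContDiffAt ℝ 2 (inChart p ψ) y := by
      have := inChart_contDiffAt (n := ⊤) hq hψq
      rw [hy'] at this
      exact this.of_le (by norm_cast)
    have hgψ : inChart p g =ᶠ[𝓝 y] fun z => Real.exp (inChart p ψ z - B) := by
      filter_upwards [hyV] with z hz
      exact hgV hz
    have hexp : ∀ t : ℝ, HasDerivAt (fun t => Real.exp (t - B)) (Real.exp (t - B)) t := fun t => by
      simpa using ((hasDerivAt_id t).sub_const B).exp
    have hlev := leviB_comp_real hψy (Eventually.of_forall hexp) (hexp _) v
    have hgr : gradSq (fun z => Real.exp (inChart p ψ z - B)) y v =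
        Real.exp (inChart p ψ y - B) ^ 2 * gradSq (inChart p ψ) y v := by
      rw [gradSq, fderiv_comp_real (hψy.differentiableAt (by simp)) (hexp _),
        fderiv_comp_real (hψy.differentiableAt (by simp)) (hexp _), gradSq]
      ring
    have hval : inChart p ψ y < B := hqB
    have he0 := Real.exp_pos (inChart p ψ y - B)
    have he1 : Real.exp (inChart p ψ y - B) ≤ 1 := Real.exp_le_one_iff.2 (by linarith)
    have hG : 0 ≤ gradSq (inChart p ψ) y v := by rw [gradSq]; positivity
    have hLpos : v ≠ 0 → 0 < leviB (inChart p ψ) y v v := by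
      intro hv
      have hv' : chartD p q (symmD p y v) = v := chartD_symmD hy v
      have h2 := hψp q hqW (symmD p y v) (fun h => hv (by
        rw [← hv']
        exact (congrArg (fun u : E => chartD (E := E) p q u) h).trans
          (map_zero (chartD (E := E) p q))))
      have h3 : 0 < leviB (inChart q ψ) (extChartAt 𝓘(ℝ, E) q q) (symmD p y v) (symmD p y v) / 4 :=
        h2.trans_eq (complexHessian_self_re ψ q _)
      rw [leviB_inChart_eq hq (hψq.of_le (by norm_cast)), hv', hy'] at h3
      linarith
    have hL : 0 ≤ leviB (inChart p ψ) y v v := by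
      rcases eq_or_ne v 0 with rfl | hv
      · simp
      · exact (hLpos hv).le
    rw [gradSq_congr hgψ, leviB_congr hgψ, hlev, hgr]
    refine ⟨?_, fun hv => ?_⟩
    · have : Real.exp (inChart p ψ y - B) ^ 2 ≤ Real.exp (inChart p ψ y - B) := by nlinarith
      nlinarith [mul_le_mul_of_nonneg_right this hG, mul_nonneg he0.le hL]
    · have := mul_pos he0 (hLpos hv)
      have := mul_nonneg he0.le hG
      linarith
  exact ⟨g, hg, fun p hp => (key p hp).mono fun y hy v => (hy v).1,
    fun p hp v => ((key p hp).self_of_nhds v).2⟩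

lemma IsDefiningFunction.exists_global [FiniteDimensional ℂ E] [T2Space X]
    [SecondCountableTopology X] (hr : IsDefiningFunction E Ω r) :
    ∃ s : X → ℝ, IsDefiningFunction E Ω s ∧ ContMDiff 𝓘(ℝ, E) 𝓘(ℝ, ℝ) ∞ s ∧
      ∃ V, IsOpen V ∧ closure Ω ⊆ V ∧ EqOn s r V := by
  obtain ⟨U, hU, hΩU, hs, -⟩ := id hr
  obtain ⟨g, hg, V, hV, hΩV, -, hgV⟩ := exists_smooth_extension isClosed_closure hU hΩU hs
  exact ⟨g, hr.congr hV hΩV hgV, hg, V, hV, hΩV, hgV⟩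

lemma diff_exp_mul {f : X → ℝ} (hf : ContMDiffAt 𝓘(ℝ, E) 𝓘(ℝ, ℝ) ∞ f p)
    (hr : ContMDiffAt 𝓘(ℝ, E) 𝓘(ℝ, ℝ) ∞ r p) (h0 : r p = 0) (v : E) :
    diff (fun x => Real.exp (f x) * r x) p v = Real.exp (f p) * diff r p v := by
  have hF := inChart_contDiffAt (n := ⊤) (mem_extChartAt_source p) hr
  have hf' := inChart_contDiffAt (n := ⊤) (mem_extChartAt_source p) hf
  have hF0 : inChart p r (extChartAt 𝓘(ℝ, E) p p) = 0 := by
    rw [inChart, Function.comp_apply, extChartAt_to_inv, h0]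
  have hfv : inChart p f (extChartAt 𝓘(ℝ, E) p p) = f p := by
    rw [inChart, Function.comp_apply, extChartAt_to_inv]
  have hexp : ContMDiffAt 𝓘(ℝ, E) 𝓘(ℝ, ℝ) ∞ (fun x => Real.exp (f x) * r x) p :=
    ((Real.contDiff_exp.contMDiff.contMDiffAt).comp p hf).mul hr
  rw [diff_eq_inChart hexp, diff_eq_inChart hr]
  have h1 : HasFDerivAt (fun z => Real.exp (inChart p f z) * inChart p r z) _
      (extChartAt 𝓘(ℝ, E) p p) :=
    (hf'.differentiableAt (by simp)).hasFDerivAt.exp.mul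
      (hF.differentiableAt (by simp)).hasFDerivAt
  refine (DFunLike.congr_fun h1.fderiv v).trans ?_
  rw [hF0, hfv, zero_smul, add_zero]
  rfl

lemma IsDefiningFunction.exp_mul (hr : IsDefiningFunction E Ω r) (hΩ : IsOpen Ω)
    (hrs : ContMDiff 𝓘(ℝ, E) 𝓘(ℝ, ℝ) ∞ r) {f : X → ℝ} (hf : ContMDiff 𝓘(ℝ, E) 𝓘(ℝ, ℝ) ∞ f) :
    IsDefiningFunction E Ω (fun x => Real.exp (f x) * r x) := by
  have h0 := fun p (hp : p ∈ frontier Ω) => hr.eq_zero hΩ hp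
  obtain ⟨U, hU, hΩU, hs, hUr, hd⟩ := hr
  refine ⟨U, hU, hΩU, (contMDiff_exp_mul hf hrs).contMDiffOn, ?_, fun p hp hz => hd p hp ?_⟩
  · rw [hUr]
    ext x
    simp only [mem_ofPred_eq]
    rw [mul_neg_iff]
    simp [Real.exp_pos, (Real.exp_pos _).not_gt]
  · refine ContinuousLinearMap.ext fun v => ?_
    have h1 := diff_exp_mul (hf p) (hrs p) (h0 p hp) v
    have h2 : diff (fun x => Real.exp (f x) * r x) p v = 0 := DFunLike.congr_fun hz v
    rw [h2] at h1
    exact (mul_eq_zero.1 h1.symm).resolve_left (Real.exp_pos _).ne'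

/-- A form `α` that agrees on `TM`, near a boundary point, with `ε` times the one-form
`danForm r T`: with the normal vector `n = ε J T`, the values of `α` and of `∂̄α` on the Levi
distribution are given by the second and third order derivatives of `r`. -/
lemma exists_normal_dbar_eq [CompleteSpace E] (hr : IsDefiningFunction E Ω r)
    (hrs : ContMDiff 𝓘(ℝ, E) 𝓘(ℝ, ℝ) ∞ r) (hΩ : IsOpen Ω) (hp : p ∈ frontier Ω)
    {α : Π q : X, TangentSpace 𝓘(ℝ, E) q →L[ℝ] ℝ} {T : Π q : X, TangentSpace 𝓘(ℝ, E) q} {ε : ℝ}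
    (hα : IsSmoothOneForm α) (hT : IsSmoothVectorField T)
    (hdT : ∀ q ∈ frontier Ω, diff r q (T q) = 0)
    (hε : ∀ᶠ q in 𝓝 p, q ∈ frontier Ω → ε * diff r q (J q (T q)) = -1)
    (hag : ∀ᶠ q in 𝓝 p, q ∈ frontier Ω → ∀ u, diff r q u = 0 → α q u = ε * danForm r T q u) :
    ∃ n : E, fderiv ℝ (inChart p r) (extChartAt 𝓘(ℝ, E) p p) n = -1 ∧
      fderiv ℝ (inChart p r) (extChartAt 𝓘(ℝ, E) p p) (Complex.I • n) = 0 ∧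
      (∀ v : E, fderiv ℝ (inChart p r) (extChartAt 𝓘(ℝ, E) p p) v = 0 →
        α p v = -leviB (inChart p r) (extChartAt 𝓘(ℝ, E) p p) v n) ∧
      ∀ v : E, IsNull (inChart p r) (extChartAt 𝓘(ℝ, E) p p) v →
        dbar α p v = (normalVariation (inChart p r) (extChartAt 𝓘(ℝ, E) p p) n v -
          leviSq (inChart p r) (extChartAt 𝓘(ℝ, E) p p) n v) / 4 := by
  have hfr := eventually_extChartAt_symm (E := E) (hr.eventually_frontier_iff hΩ hp)
  have hF0 := hr.inChart_eq_zero hΩ hp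
  have hn : ∀ᶠ y in 𝓝 (extChartAt 𝓘(ℝ, E) p p), inChart p r y = 0 →
      fderiv ℝ (inChart p r) y (ε • Complex.I • fieldInChart p T y) = -1 := by
    filter_upwards [eventually_target p, hfr, eventually_extChartAt_symm (E := E) hε]
      with y hy h1 h2 h0
    rw [map_smul, fderiv_inChart_I_fieldInChart hrs T hy]
    exact h2 (h1.2 h0)
  have hIn : ∀ᶠ y in 𝓝 (extChartAt 𝓘(ℝ, E) p p), inChart p r y = 0 →
      fderiv ℝ (inChart p r) y (Complex.I • ε • Complex.I • fieldInChart p T y) = 0 := by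
    filter_upwards [eventually_target p, hfr] with y hy h1 h0
    rw [smul_comm Complex.I, I_smul_I_smul, map_smul, map_neg,
      fderiv_inChart_fieldInChart hrs T hy, hdT _ (h1.2 h0), neg_zero, smul_zero]
  have ha : ∀ᶠ y in 𝓝 (extChartAt 𝓘(ℝ, E) p p), inChart p r y = 0 → ∀ u,
      fderiv ℝ (inChart p r) y u = 0 → formInChart p α y u =
        -leviB (inChart p r) y u (ε • Complex.I • fieldInChart p T y) := by
    filter_upwards [eventually_target p, hfr, eventually_extChartAt_symm (E := E) hag]
      with y hy h1 h2 h0 u hu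
    have h3 := fderiv_inChart_chartD hrs hy (symmD p y u)
    rw [chartD_symmD hy, hu] at h3
    refine (h2 (h1.2 h0) (symmD p y u : E) h3.symm).trans ?_
    have h4 := formInChart_danForm hrs T hy u
    rw [map_smul, smul_eq_mul, ← mul_neg, ← h4]
    rfl
  have hnsm : ContDiffAt ℝ 1 (fun y => ε • Complex.I • fieldInChart p T y)
      (extChartAt 𝓘(ℝ, E) p p) :=
    ((mulI E).contDiff.contDiffAt.comp _
      ((hT.fieldInChart_contDiffAt p).of_le (by norm_cast))).const_smul ε
  refine ⟨_, hn.self_of_nhds hF0, hIn.self_of_nhds hF0, fun v hv => ?_, fun v hv => ?_⟩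
  · exact (formInChart_self p α v).symm.trans (ha.self_of_nhds hF0 v hv)
  · rw [dbar_eq_formInChart]
    rw [dbar_eq ((contDiffAt_inChart hrs (mem_extChartAt_target p)).of_le (by norm_cast)) hF0
      ((hα.formInChart_contDiffAt p).of_le (by norm_cast)) hnsm hn hIn ha hv]

end Perturbation

/-! ### From plurisubharmonic powers to D'Angelo forms -/

section LowerBound

set_option synthInstance.maxHeartbeats 400000

variable {E : Type*} [NormedAddCommGroup E] [NormedSpace ℂ E]
  {X : Type*} [TopologicalSpace X] [ChartedSpace E X] [IsManifold 𝓘(ℂ, E) ω X]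
  {Ω : Set X} {r : X → ℝ} {p : X}

/-- Plurisubharmonicity of `-(-r)^δ` on `Ω`, in the chart at a boundary point. -/
lemma IsDFPair.eventually_dfForm_nonneg {δ : ℝ} (hr : IsDFPair E Ω δ r) (hδ : 0 < δ)
    (hp : p ∈ frontier Ω) :
    ∀ᶠ y in 𝓝 (extChartAt 𝓘(ℝ, E) p p), inChart p r y < 0 →
      ∀ v, 0 ≤ dfForm (inChart p r) δ y v := by
  have hc := frontier_subset_closure hp
  filter_upwards [eventually_target p,
    eventually_extChartAt_symm (E := E) (hr.1.eventually_mem_iff hc),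
    eventually_extChartAt_symm (E := E) (hr.1.eventually_contMDiffAt hc)] with y hy h1 h2 h0 v
  have hq := (extChartAt 𝓘(ℝ, E) p).map_target hy
  have h3 := (complexHessian_neg_rpow_nonneg_iff hδ hq h2 h0 (symmD p y v)).1
    (hr.2.2 _ (h1.2 h0) _)
  rwa [(extChartAt 𝓘(ℝ, E) p).right_inv hy, chartD_symmD hy] at h3

/-- If `-(-r)^δ` is plurisubharmonic then, after multiplication of `r` by the factor `e^(-εψ)`
with `ε = (δ - δ') / 2` and `ψ` a strict weight, its D'Angelo form satisfies the strict inequality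
with the constant `(1 - δ') / δ'`, for any `δ' < δ`. -/
lemma nForm_danForm_le [FiniteDimensional ℂ E] {δ δ' : ℝ} (hr : IsDFPair E Ω δ r) (hΩ : IsOpen Ω)
    (hrs : ContMDiff 𝓘(ℝ, E) 𝓘(ℝ, ℝ) ∞ r) (hδ' : 0 < δ') (hδδ' : δ' < δ) (hδ : δ ≤ 1)
    {ψ : X → ℝ} (hψ : IsStrictWeight (E := E) Ω ψ) {T : Π q : X, TangentSpace 𝓘(ℝ, E) q}
    (hT : IsCharacteristicField Ω (fun x => Real.exp (-((δ - δ') / 2) * ψ x) * r x) T) :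
    nForm Ω (leviDistribution (E := E) Ω)
      (danForm (fun x => Real.exp (-((δ - δ') / 2) * ψ x) * r x) T) ≤
      ENNReal.ofReal ((1 - δ') / δ') := by
  have : CompleteSpace E := FiniteDimensional.complete ℂ E
  set ε := (δ - δ') / 2 with hε
  have hε0 : 0 < ε := by rw [hε]; linarith
  set r' : X → ℝ := fun x => Real.exp (-ε * ψ x) * r x with hr'
  have hf : ContMDiff 𝓘(ℝ, E) 𝓘(ℝ, ℝ) ∞ (fun x => -ε * ψ x) := contMDiff_const.mul hψ.smooth
  have hrs' : ContMDiff 𝓘(ℝ, E) 𝓘(ℝ, ℝ) ∞ r' := contMDiff_exp_mul hf hrs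
  have hr'd : IsDefiningFunction E Ω r' := hr.1.exp_mul hΩ hrs hf
  have ht : 0 < (1 - δ') / δ' := div_pos (by linarith) hδ'
  refine iInf_le_of_le _ (iInf_le_of_le ht (iInf_le_of_le ?_ le_rfl))
  intro p hp v hv hv0
  obtain ⟨n, hn, hIn, hαn, hdbar⟩ := exists_normal_dbar_eq hr'd hrs' hΩ hp (ε := 1)
    (isSmoothOneForm_danForm hrs' hT.smooth) hT.smooth hT.tangent
    (Eventually.of_forall fun q hq => by rw [one_mul]; exact hT.normal q hq)
    (Eventually.of_forall fun q _ u _ => by rw [one_mul])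
  have hnull := (hr'd.mem_leviDistribution_iff hΩ hp v).1 hv
  rw [norm_onHol_sq_eq_leviSq hnull hαn, hdbar v hnull]
  have hψ2 : ContDiffAt ℝ 2 (inChart p ψ) (extChartAt 𝓘(ℝ, E) p p) :=
    (contDiffAt_inChart hψ.smooth (mem_extChartAt_target p)).of_le (by norm_cast)
  have hκ : ContinuousAt (Function.uncurry fun y Z : E => ε / 2 * leviB (inChart p ψ) y Z Z)
      (extChartAt 𝓘(ℝ, E) p p, (v : E)) := by
    have h1 : ContinuousAt (fun z : E × E => leviB (inChart p ψ) z.1)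
        (extChartAt 𝓘(ℝ, E) p p, (v : E)) :=
      ContinuousAt.comp (x := (extChartAt 𝓘(ℝ, E) p p, (v : E))) (g := leviB (inChart p ψ))
        (continuousAt_leviB hψ2) continuousAt_fst
    exact continuousAt_const.mul ((h1.clm_apply continuousAt_snd).clm_apply continuousAt_snd)
  have key := le_normalVariation_of_dfForm (F := inChart p r') (δ := δ')
    (κ := fun y Z => ε / 2 * leviB (inChart p ψ) y Z Z)
    ((contDiffAt_inChart hrs' (mem_extChartAt_target p)).of_le (by norm_cast))
    (hr'd.inChart_eq_zero hΩ hp) hn hIn (by linarith) hnull hκ (by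
      filter_upwards [hr.eventually_dfForm_nonneg (hδ'.trans hδδ') hp, hψ.gradSq_le p hp,
        eventually_target p] with y h1 h2 hy h0 Z
      have h0' : inChart p r y < 0 := by
        have : Real.exp (-ε * inChart p ψ y) * inChart p r y < 0 := h0
        exact (mul_neg_iff.1 this).elim (fun h => h.2) (fun h => absurd h.1 (Real.exp_pos _).not_gt)
      have h3 := dfForm_exp_mul (ε := ε) ((contDiffAt_inChart hrs hy).of_le (by norm_cast))
        ((contDiffAt_inChart hψ.smooth hy).of_le (by norm_cast)) h0' hδ hε0
        (by rw [hε]; linarith) (h1 h0' Z) (h2 Z)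
      rw [show δ - 2 * ε = δ' by rw [hε]; ring] at h3
      exact h3)
  have hpos : 0 < ε / 2 * leviB (inChart p ψ) (extChartAt 𝓘(ℝ, E) p p) v v :=
    mul_pos (half_pos hε0) (hψ.pos p hp v hv0)
  set N := normalVariation (inChart p r') (extChartAt 𝓘(ℝ, E) p p) n v
  set L := leviSq (inChart p r') (extChartAt 𝓘(ℝ, E) p p) n v
  have h1 : L / (1 - δ') < N := by linarith
  have h2 : 0 < 1 - δ' := by linarith
  rw [div_lt_iff₀ h2] at h1
  have h3 : L * δ' < (1 - δ') * (N - L) := by linarith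
  have h4 : L < (1 - δ') / δ' * (N - L) := by
    rw [div_mul_eq_mul_div, lt_div_iff₀ hδ']
    exact h3
  linarith

lemma IsCharacteristicField.fderiv_normal {T : Π q : X, TangentSpace 𝓘(ℝ, E) q}
    (hT : IsCharacteristicField Ω r T) (hrs : ContMDiff 𝓘(ℝ, E) 𝓘(ℝ, ℝ) ∞ r)
    (hp : p ∈ frontier Ω) :
    fderiv ℝ (inChart p r) (extChartAt 𝓘(ℝ, E) p p) (mulI E (T p)) = -1 ∧
    fderiv ℝ (inChart p r) (extChartAt 𝓘(ℝ, E) p p) (Complex.I • mulI E (T p)) = 0 := by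
  refine ⟨(diff_eq_inChart (hrs p) _).symm.trans (hT.normal p hp), ?_⟩
  have h2 : fderiv ℝ (inChart p r) (extChartAt 𝓘(ℝ, E) p p) (T p) = 0 :=
    (diff_eq_inChart (hrs p) _).symm.trans (hT.tangent p hp)
  refine Eq.trans ?_ ((map_neg (fderiv ℝ (inChart p r) (extChartAt 𝓘(ℝ, E) p p)) (T p)).trans
    (neg_eq_zero.2 h2))
  exact congrArg _ (I_smul_I_smul (E := E) (T p))

/-- Multiplication of the defining function by `e^f` changes its D'Angelo form by `df` along the
Levi distribution. -/
lemma danForm_exp_mul (hr : IsDefiningFunction E Ω r) (hΩ : IsOpen Ω)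
    (hrs : ContMDiff 𝓘(ℝ, E) 𝓘(ℝ, ℝ) ∞ r) {f : X → ℝ} (hf : ContMDiff 𝓘(ℝ, E) 𝓘(ℝ, ℝ) ∞ f)
    {T : Π q : X, TangentSpace 𝓘(ℝ, E) q} (hT : IsCharacteristicField Ω r T)
    (hp : p ∈ frontier Ω) {n v : E} (hv : v ∈ leviDistribution (E := E) Ω p)
    (hn : fderiv ℝ (inChart p fun x => Real.exp (f x) * r x) (extChartAt 𝓘(ℝ, E) p p) n = -1)
    (hIn : fderiv ℝ (inChart p fun x => Real.exp (f x) * r x) (extChartAt 𝓘(ℝ, E) p p)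
      (Complex.I • n) = 0) :
    -leviB (inChart p fun x => Real.exp (f x) * r x) (extChartAt 𝓘(ℝ, E) p p) v n =
      danForm r T p v + diff f p v := by
  have h1 := leviB_exp_mul (F := inChart p r) (f := inChart p f) (n := mulI E (T p)) (n' := n)
    ((contDiffAt_inChart hrs (mem_extChartAt_target p)).of_le (by norm_cast))
    ((contDiffAt_inChart hf (mem_extChartAt_target p)).of_le (by norm_cast))
    (hr.inChart_eq_zero hΩ hp) ((hr.mem_leviDistribution_iff hΩ hp v).1 hv)
    (hT.fderiv_normal hrs hp).1 (hT.fderiv_normal hrs hp).2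
    hn hIn
  have h4 : diff f p v = _ := diff_eq_inChart (hf p) v
  rw [h4]
  refine (congrArg Neg.neg h1).trans ?_
  rw [neg_sub, sub_eq_neg_add]
  rfl

end LowerBound

/-! ### Modification of a defining function inside the domain -/

section UpperBound

set_option synthInstance.maxHeartbeats 400000

/-- A smooth convex function which is the identity near `[0, ∞)` and has zero derivative on
`(-∞, -c]`. -/
lemma exists_convex_cutoff {c : ℝ} (hc : 0 < c) :
    ∃ χ χ' χ'' : ℝ → ℝ, ContDiff ℝ ∞ χ ∧ (∀ u, HasDerivAt χ (χ' u) u) ∧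
      (∀ u, HasDerivAt χ' (χ'' u) u) ∧ (∀ u, 0 ≤ χ' u) ∧ (∀ u, 0 ≤ χ'' u) ∧
      (∀ u ≤ -c, χ' u = 0) ∧ (∀ u, -(c / 2) ≤ u → χ u = u) ∧ ∀ u < 0, χ u < 0 := by
  set s : ℝ → ℝ := fun u => Real.smoothTransition ((u + c) / (c / 2)) with hs
  have hsm : ContDiff ℝ ∞ s := Real.smoothTransition.contDiff.comp (by fun_prop)
  have hmono : Monotone s := fun u w h => Real.smoothTransition.monotone (by gcongr)
  have hs0 : ∀ u, 0 ≤ s u := fun u => Real.smoothTransition.nonneg _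
  have hs1 : ∀ u, -(c / 2) ≤ u → s u = 1 := fun u hu =>
    Real.smoothTransition.one_of_one_le (by rw [le_div_iff₀ (half_pos hc)]; linarith)
  have hder : ∀ u, HasDerivAt (fun u => (∫ t in (-(c / 2))..u, s t) - c / 2) (s u) u := fun u =>
    (intervalIntegral.integral_hasDerivAt_right (hsm.continuous.intervalIntegrable _ _)
      (hsm.continuous.stronglyMeasurableAtFilter _ _) hsm.continuous.continuousAt).sub_const _
  have hid : ∀ u, -(c / 2) ≤ u → (∫ t in (-(c / 2))..u, s t) - c / 2 = u := by
    intro u hu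
    rw [intervalIntegral.integral_congr (g := fun _ => (1 : ℝ)) (fun t ht => ?_)]
    · simp
    · rw [uIcc_of_le hu] at ht
      exact hs1 t ht.1
  refine ⟨fun u => (∫ t in (-(c / 2))..u, s t) - c / 2, s, deriv s, ?_, hder,
    fun u => (hsm.differentiable (by simp) u).hasDerivAt, hs0, fun u => hmono.deriv_nonneg, ?_,
    hid, ?_⟩
  · refine contDiff_infty_iff_deriv.2 ⟨fun u => (hder u).differentiableAt, ?_⟩
    rw [show deriv (fun u => (∫ t in (-(c / 2))..u, s t) - c / 2) = s from
      funext fun u => (hder u).deriv]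
    exact hsm
  · intro u hu
    exact Real.smoothTransition.zero_of_nonpos (div_nonpos_of_nonpos_of_nonneg (by linarith)
      (half_pos hc).le)
  · intro u hu
    rcases le_total (-(c / 2)) u with h | h
    · exact (hid u h).trans_lt hu
    · have h1 : Monotone (fun u => (∫ t in (-(c / 2))..u, s t) - c / 2) :=
        monotone_of_deriv_nonneg (fun u => (hder u).differentiableAt) fun u => by
          rw [(hder u).deriv]; exact hs0 u
      have h2 := h1 h
      simp only [intervalIntegral.integral_same] at h2
      linarith

variable {E : Type*} [NormedAddCommGroup E] [NormedSpace ℂ E]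
  {X : Type*} [TopologicalSpace X] [ChartedSpace E X]
  {Ω : Set X} {r : X → ℝ} {p : X}

lemma complexHessian_self_re_congr {f g : X → ℝ} {q : X} (h : f =ᶠ[𝓝 q] g) (v : E) :
    (complexHessian f q v v).re = (complexHessian g q v v).re := by
  have h1 : inChart q f =ᶠ[𝓝 (extChartAt 𝓘(ℝ, E) q q)] inChart q g :=
    eventually_extChartAt_symm (E := E) h
  rw [complexHessian_self_re, complexHessian_self_re, leviB_congr h1]

variable [IsManifold 𝓘(ℂ, E) ω X]

/-- A defining function for which `-(-r)^δ` is plurisubharmonic near the boundary can be modified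
inside `Ω`, by composition with a convex function, so that plurisubharmonicity holds on `Ω`. -/
lemma exists_isDFPair_of_near_frontier (hr : IsDefiningFunction E Ω r) (hΩ : IsOpen Ω)
    (hrs : ContMDiff 𝓘(ℝ, E) 𝓘(ℝ, ℝ) ∞ r) (hcpt : IsCompact (closure Ω)) {δ : ℝ} (hδ : 0 < δ)
    {W : Set X} (hW : IsOpen W) (hΩW : frontier Ω ⊆ W)
    (hpsh : ∀ q ∈ W ∩ Ω, ∀ v : E, 0 ≤ (complexHessian (fun x => -(-r x) ^ δ) q v v).re) :
    ∃ s : X → ℝ, IsDFPair E Ω δ s ∧ ∃ V, IsOpen V ∧ frontier Ω ⊆ V ∧ EqOn s r V := by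
  classical
  -- The new function `s` is given inside `Ω` by `-(-s)^δ = χ(-(-r)^δ)` with a convex cutoff `χ`
  -- whose derivative vanishes where `-(-r)^δ` is not known to be plurisubharmonic.
  have hneg : ∀ q ∈ Ω, r q < 0 := fun q hq =>
    (hr.eventually_mem_iff (subset_closure hq)).self_of_nhds.1 hq
  have hsub : closure Ω \ W ⊆ Ω := fun q hq => by
    by_contra h
    exact hq.2 (hΩW (by rw [hΩ.frontier_eq]; exact ⟨hq.1, h⟩))
  obtain ⟨c₀, hc₀, hK⟩ : ∃ c₀ : ℝ, 0 < c₀ ∧ ∀ q ∈ closure Ω \ W, r q ≤ -c₀ := by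
    rcases (closure Ω \ W).eq_empty_or_nonempty with h | h
    · exact ⟨1, one_pos, by simp [h]⟩
    · obtain ⟨q, hq, hmax⟩ := (hcpt.diff hW).exists_isMaxOn h hrs.continuous.continuousOn
      exact ⟨-r q, by linarith [hneg q (hsub hq)], fun z hz => by
        rw [neg_neg]; exact hmax hz⟩
  have hc : 0 < c₀ ^ δ := Real.rpow_pos_of_pos hc₀ _
  obtain ⟨χ, χ', χ'', hχ, hχd, hχdd, hχ0, hχ2, hχc, hχid, hχneg⟩ := exists_convex_cutoff hc
  set ρ : X → ℝ := fun x => -(-r x) ^ δ with hρ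
  have hρneg : ∀ q ∈ Ω, ρ q < 0 := fun q hq =>
    neg_lt_zero.2 (Real.rpow_pos_of_pos (by linarith [hneg q hq]) _)
  have hρs : ∀ q ∈ Ω, ContMDiffAt 𝓘(ℝ, E) 𝓘(ℝ, ℝ) ∞ ρ q := by
    intro q hq
    have : ContDiffAt ℝ ∞ (fun t : ℝ => -(-t) ^ δ) (r q) :=
      ((contDiffAt_id.neg).rpow_const_of_ne (by simp; linarith [hneg q hq])).neg
    exact (contMDiffAt_iff_contDiffAt.2 this).comp q (hrs q)
  have hχρ : ∀ q ∈ Ω, ContMDiffAt 𝓘(ℝ, E) 𝓘(ℝ, ℝ) ∞ (fun x => χ (ρ x)) q := fun q hq =>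
    (hχ.contMDiff.contMDiffAt).comp q (hρs q hq)
  set s : X → ℝ := fun x => if x ∈ Ω then -(-χ (ρ x)) ^ (1 / δ) else r x with hs
  have hsΩ : ∀ q ∈ Ω, s q = -(-χ (ρ q)) ^ (1 / δ) := fun q hq => if_pos hq
  have hsdf : EqOn (fun x => -(-s x) ^ δ) (fun x => χ (ρ x)) Ω := by
    intro q hq
    have h1 : 0 ≤ -χ (ρ q) := by linarith [hχneg _ (hρneg q hq)]
    change -(-s q) ^ δ = χ (ρ q)
    rw [hsΩ q hq, neg_neg, ← Real.rpow_mul h1, one_div_mul_cancel hδ.ne', Real.rpow_one, neg_neg]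
  obtain ⟨U, hU, hΩU, -, hUΩ, hd⟩ := id hr
  set V : Set X := U ∩ {x | -(c₀ ^ δ / 2) ^ (1 / δ) < r x} with hV
  have hVo : IsOpen V := hU.inter (isOpen_lt continuous_const hrs.continuous)
  have hfrV : frontier Ω ⊆ V := fun q hq => ⟨hΩU (frontier_subset_closure hq), by
    rw [mem_ofPred_eq, hr.eq_zero hΩ hq]
    exact neg_lt_zero.2 (Real.rpow_pos_of_pos (half_pos hc) _)⟩
  have hsV : EqOn s r V := by
    rintro x ⟨-, hx⟩
    by_cases hxΩ : x ∈ Ω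
    · have h1 : 0 < -r x := by linarith [hneg x hxΩ]
      have h2 : (-r x) ^ δ ≤ c₀ ^ δ / 2 := by
        have h3 : -r x ≤ (c₀ ^ δ / 2) ^ (1 / δ) := by
          have : -(c₀ ^ δ / 2) ^ (1 / δ) < r x := hx
          linarith
        have h4 := Real.rpow_le_rpow h1.le h3 hδ.le
        rwa [← Real.rpow_mul (half_pos hc).le, one_div_mul_cancel hδ.ne', Real.rpow_one] at h4
      rw [hsΩ x hxΩ, hχid (ρ x) (neg_le_neg h2)]
      simp only [hρ, neg_neg]
      rw [← Real.rpow_mul h1.le, mul_one_div_cancel hδ.ne', Real.rpow_one, neg_neg]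
    · exact if_neg hxΩ
  have hsd : IsDefiningFunction E Ω s := by
    refine ⟨Ω ∪ V, hΩ.union hVo, ?_, ?_, ?_, fun p hp hz => hd p hp ?_⟩
    · rw [closure_eq_self_union_frontier]
      exact union_subset_union_right _ hfrV
    · intro q hq
      refine ContMDiffAt.contMDiffWithinAt ?_
      rcases hq with hq | hq
      · have h1 : ContDiffAt ℝ ∞ (fun t : ℝ => -(-t) ^ (1 / δ)) (χ (ρ q)) :=
          ((contDiffAt_id.neg).rpow_const_of_ne (by simp; linarith [hχneg _ (hρneg q hq)])).neg
        refine ((contMDiffAt_iff_contDiffAt.2 h1).comp q (hχρ q hq)).congr_of_eventuallyEq ?_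
        exact eventually_of_mem (hΩ.mem_nhds hq) hsΩ
      · exact (hrs q).congr_of_eventuallyEq (eventually_of_mem (hVo.mem_nhds hq) hsV)
    · ext x
      constructor
      · intro hx
        refine ⟨Or.inl hx, ?_⟩
        rw [hsΩ x hx]
        exact neg_lt_zero.2 (Real.rpow_pos_of_pos (by linarith [hχneg _ (hρneg x hx)]) _)
      · rintro ⟨hx | hx, hx0⟩
        · exact hx
        · rw [hUΩ]
          exact ⟨hx.1, (hsV hx).symm.trans_lt hx0⟩
    · have h1 : s =ᶠ[𝓝 p] r := eventually_of_mem (hVo.mem_nhds (hfrV hp)) hsV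
      exact (h1.mfderiv_eq).symm.trans hz
  refine ⟨s, ⟨hsd, fun q hq => ?_, fun q hq v => ?_⟩, V, hVo, hfrV, hsV⟩
  · exact ((hχρ q hq).congr_of_eventuallyEq
      (eventually_of_mem (hΩ.mem_nhds hq) hsdf)).contMDiffWithinAt
  · have hρF : ContDiffAt ℝ 2 (inChart q ρ) (extChartAt 𝓘(ℝ, E) q q) :=
      (inChart_contDiffAt (n := ⊤) (mem_extChartAt_source q) (hρs q hq)).of_le (by norm_cast)
    have hval : inChart q ρ (extChartAt 𝓘(ℝ, E) q q) = ρ q := by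
      rw [inChart, Function.comp_apply, extChartAt_to_inv]
    refine le_of_le_of_eq ?_ (complexHessian_self_re_congr (E := E)
      (eventually_of_mem (hΩ.mem_nhds hq) hsdf) v).symm
    refine le_of_le_of_eq ?_ (complexHessian_self_re (E := E) _ q v).symm
    have h1 := leviB_comp_real hρF (Eventually.of_forall hχd) (hχdd _) v
    have h2 : 0 ≤ χ' (ρ q) * leviB (inChart q ρ) (extChartAt 𝓘(ℝ, E) q q) v v := by
      rcases le_or_gt (ρ q) (-c₀ ^ δ) with h | h
      · rw [hχc _ h, zero_mul]
      · have hqW : q ∈ W := by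
          by_contra hqW
          have h3 := hK q ⟨subset_closure hq, hqW⟩
          have h4 := Real.rpow_le_rpow hc₀.le (by linarith : c₀ ≤ -r q) hδ.le
          simp only [hρ] at h
          linarith
        have h3 : 0 ≤ leviB (inChart q ρ) (extChartAt 𝓘(ℝ, E) q q) v v / 4 :=
          (hpsh q ⟨hqW, hq⟩ v).trans_eq (complexHessian_self_re (E := E) ρ q v)
        exact mul_nonneg (hχ0 _) (by linarith)
    have h3 : 0 ≤ χ'' (ρ q) * gradSq (inChart q ρ) (extChartAt 𝓘(ℝ, E) q q) v :=
      mul_nonneg (hχ2 _) (add_nonneg (sq_nonneg _) (sq_nonneg _))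
    refine div_nonneg ?_ (by norm_num)
    refine le_of_le_of_eq ?_ h1.symm
    rw [hval]
    exact add_nonneg h2 h3

end UpperBound

/-! ### From D'Angelo forms to plurisubharmonic powers -/

section FromForms

set_option synthInstance.maxHeartbeats 400000

variable {E : Type*} [NormedAddCommGroup E] [NormedSpace ℂ E]
  {X : Type*} [TopologicalSpace X] [ChartedSpace E X] [IsManifold 𝓘(ℂ, E) ω X]
  {Ω : Set X} {r : X → ℝ} {p : X}

lemma contMDiff_charForm_apply (hrs : ContMDiff 𝓘(ℝ, E) 𝓘(ℝ, ℝ) ∞ r)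
    {T : Π q : X, TangentSpace 𝓘(ℝ, E) q} (hT : IsSmoothVectorField T) :
    ContMDiff 𝓘(ℝ, E) 𝓘(ℝ, ℝ) ∞ (fun q => charForm r q (T q)) := by
  intro p
  have h1 : ContDiffAt ℝ ∞ (fun y => formInChart p (charForm r) y (fieldInChart p T y))
      (extChartAt 𝓘(ℝ, E) p p) :=
    ((isSmoothOneForm_charForm hrs).formInChart_contDiffAt p).clm_apply
      (hT.fieldInChart_contDiffAt p)
  refine (contMDiffAt_of_comp_chart (n := ⊤) (mem_extChartAt_source p) h1).congr_of_eventuallyEq ?_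
  filter_upwards [eventually_source (E := E) p] with q hq
  have h2 := formInChart_apply hq (charForm r) (T q)
  refine h2.symm.trans ?_
  exact congrArg (fun z => formInChart (E := E) p (charForm r) (extChartAt 𝓘(ℝ, E) p q)
    (chartD (E := E) p z (T z))) ((extChartAt 𝓘(ℝ, E) p).left_inv hq).symm

/-- A pseudo-Hermitian structure is `±(-dr ∘ J)` for some defining function `r`; accordingly every
D'Angelo form is locally, along `TM`, the form `danForm r (±T)` of some defining function. -/
lemma IsDAngeloForm.exists_exp_mul [FiniteDimensional ℂ E] [T2Space X]
    [SecondCountableTopology X] {α : Π q : X, TangentSpace 𝓘(ℝ, E) q →L[ℝ] ℝ}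
    (hα : IsDAngeloForm Ω α) (hr : IsDefiningFunction E Ω r) (hΩ : IsOpen Ω)
    (hrs : ContMDiff 𝓘(ℝ, E) 𝓘(ℝ, ℝ) ∞ r) :
    ∃ (f : X → ℝ) (T : Π q : X, TangentSpace 𝓘(ℝ, E) q),
      ContMDiff 𝓘(ℝ, E) 𝓘(ℝ, ℝ) ∞ f ∧ IsSmoothVectorField T ∧
      (∀ q ∈ frontier Ω, diff (fun x => Real.exp (f x) * r x) q (T q) = 0) ∧
      ∀ p ∈ frontier Ω, ∃ ε : ℝ,
        (∀ᶠ q in 𝓝 p, q ∈ frontier Ω →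
          ε * diff (fun x => Real.exp (f x) * r x) q (J q (T q)) = -1) ∧
        ∀ᶠ q in 𝓝 p, q ∈ frontier Ω → ∀ u, diff (fun x => Real.exp (f x) * r x) q u = 0 →
          α q u = ε * danForm (fun x => Real.exp (f x) * r x) T q u := by
  have : CompleteSpace E := FiniteDimensional.complete ℂ E
  obtain ⟨hαs, θ, T, ⟨hθs, hθ⟩, hT, hθT, hαV⟩ := hα
  have hmem := fun q (hq : q ∈ frontier Ω) => hr.mem_boundaryTangent_iff_diff hΩ hq
  set τ : X → ℝ := fun q => charForm r q (T q) with hτ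
  have hτs : ContMDiff 𝓘(ℝ, E) 𝓘(ℝ, ℝ) ∞ τ := contMDiff_charForm_apply hrs hT.1
  have hτd : ∀ q, diff r q (J q (T q)) = -τ q := fun q =>
    (neg_eq_iff_eq_neg.1 (charForm_apply (E := E) r q (T q)).symm)
  have hdT : ∀ q ∈ frontier Ω, diff r q (T q) = 0 := fun q hq => (hmem q hq _).1 (hT.2 q hq)
  have hτ0 : ∀ q ∈ frontier Ω, τ q ≠ 0 := by
    intro q hq h0
    have h1 : diff r q (J q (T q)) = 0 := by rw [hτd, h0, neg_zero]
    have h2 := (hθ q hq).1 (T q) ⟨hT.2 q hq, (hmem q hq _).2 h1⟩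
    rw [hθT q hq] at h2
    exact one_ne_zero h2
  -- The factor `e^f = 1 / |τ|` normalizes `d(e^f r)(JT)` to `±1`; note that `log τ = log |τ|`.
  obtain ⟨f, hf, V, hV, hΩV, -, hfV⟩ := exists_smooth_extension (E := E)
    (f := fun q => -Real.log (τ q)) isClosed_frontier
    (isOpen_ne_fun hτs.continuous continuous_const) hτ0
    (fun q hq => ((contMDiffAt_iff_contDiffAt.2 (Real.contDiffAt_log.2 hq)).comp q
      (hτs q)).neg.contMDiffWithinAt)
  set r' : X → ℝ := fun x => Real.exp (f x) * r x with hr'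
  have hrs' : ContMDiff 𝓘(ℝ, E) 𝓘(ℝ, ℝ) ∞ r' := contMDiff_exp_mul hf hrs
  have hr'd : IsDefiningFunction E Ω r' := hr.exp_mul hΩ hrs hf
  have hmem' := fun q (hq : q ∈ frontier Ω) => hr'd.mem_boundaryTangent_iff_diff hΩ hq
  have hdr' : ∀ q ∈ frontier Ω, ∀ u : TangentSpace 𝓘(ℝ, E) q,
      diff r' q u = |τ q|⁻¹ * diff r q u := by
    intro q hq u
    refine (diff_exp_mul (hf q) (hrs q) (hr.eq_zero hΩ hq) u).trans ?_
    rw [hfV (hΩV hq), Real.exp_neg, Real.exp_log_eq_abs (hτ0 q hq)]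
  have hdT' : ∀ q ∈ frontier Ω, diff r' q (T q) = 0 := fun q hq => by
    rw [hdr' q hq, hdT q hq, mul_zero]
  refine ⟨f, T, hf, hT.1, hdT', fun p hp => ?_⟩
  obtain ⟨ε, hε⟩ : ∃ ε : ℝ, ∀ᶠ q in 𝓝 p, ε * τ q = |τ q| := by
    rcases lt_or_gt_of_ne (hτ0 p hp) with h | h
    · refine ⟨-1, ?_⟩
      filter_upwards [hτs.continuous.continuousAt.eventually (gt_mem_nhds h)] with q hq
      rw [abs_of_neg hq, neg_one_mul]
    · refine ⟨1, ?_⟩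
      filter_upwards [hτs.continuous.continuousAt.eventually (lt_mem_nhds h)] with q hq
      rw [abs_of_pos hq, one_mul]
  have hnorm : ∀ᶠ q in 𝓝 p, q ∈ frontier Ω → ε * diff r' q (J q (T q)) = -1 := by
    filter_upwards [hε] with q hq hqf
    rw [hdr' q hqf, hτd, mul_neg, mul_neg, mul_left_comm, hq,
      inv_mul_cancel₀ (abs_ne_zero.2 (hτ0 q hqf))]
  have hθr : ∀ᶠ q in 𝓝 p, q ∈ frontier Ω → ∀ u, diff r' q u = 0 →
      θ q u = -(ε * diff r' q (J q u)) := by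
    filter_upwards [hnorm] with q hq hqf u hu
    have h1 : diff r' q (u - (-(ε * diff r' q (J q u))) • T q) = 0 := by
      rw [map_sub, map_smul, hu, hdT' q hqf, smul_zero, sub_zero]
    have h2 : diff r' q (J q (u - (-(ε * diff r' q (J q u))) • T q)) = 0 := by
      rw [map_sub, map_sub, map_smul, map_smul, smul_eq_mul]
      linear_combination diff r' q (J q u) * hq hqf
    have h3 := (hθ q hqf).1 _ ⟨(hmem' q hqf _).2 h1, (hmem' q hqf _).2 h2⟩
    rw [map_sub, map_smul, hθT q hqf, smul_eq_mul, mul_one] at h3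
    exact sub_eq_zero.1 h3
  refine ⟨ε, hnorm, ?_⟩
  filter_upwards [hθr.eventually_nhds] with q hq hqf u hu
  obtain ⟨V, hV, hVq⟩ := exists_boundaryField hr'd hrs' hΩ hqf u
    ((diff_eq_inChart (hrs' q) u).symm.trans hu)
  have h1 := hαV V hV q hqf
  rw [form_mlieBracket hr'd hrs' hΩ hqf hθs hT.1 hV.1 hdT'
    (fun z hz => (hmem' z hz _).1 (hV.2 z hz)) hθT hq] at h1
  rw [← hVq, h1]
  exact (mul_neg ε _).symm

/-- A D'Angelo form with `|α|² < t ∂̄α` on the Levi distribution produces a defining function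
with a plurisubharmonic power of exponent `1 / (1 + t)`. -/
lemma exists_isDFPair_of_lt [FiniteDimensional ℂ E] [T2Space X] [SecondCountableTopology X]
    (hr : IsDefiningFunction E Ω r) (hΩ : IsOpen Ω) (hrs : ContMDiff 𝓘(ℝ, E) 𝓘(ℝ, ℝ) ∞ r)
    (hcpt : IsCompact (closure Ω)) (hpsc : IsSmoothPseudoconvex E Ω)
    {T₀ : Π q : X, TangentSpace 𝓘(ℝ, E) q} (hT₀ : IsCharacteristicField Ω r T₀)
    {α : Π q : X, TangentSpace 𝓘(ℝ, E) q →L[ℝ] ℝ} (hα : IsDAngeloForm Ω α) {t : ℝ} (ht : 0 < t)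
    (hαt : ∀ p ∈ frontier Ω, ∀ v ∈ leviDistribution (E := E) Ω p, v ≠ 0 →
      ‖onHol (α p) v‖ ^ 2 < t * dbar α p v) :
    ∃ f s : X → ℝ, ContMDiff 𝓘(ℝ, E) 𝓘(ℝ, ℝ) ∞ f ∧ IsDFPair E Ω (1 / (1 + t)) s ∧
      (∃ V, IsOpen V ∧ frontier Ω ⊆ V ∧ EqOn s (fun x => Real.exp (f x) * r x) V) ∧
      ∀ p ∈ frontier Ω, ∀ v ∈ leviDistribution (E := E) Ω p,
        α p v = danForm r T₀ p v + diff f p v := by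
  have : CompleteSpace E := FiniteDimensional.complete ℂ E
  have : ProperSpace E := FiniteDimensional.proper ℂ E
  obtain ⟨f, T, hf, hT, hdT, hloc⟩ := hα.exists_exp_mul hr hΩ hrs
  set r' : X → ℝ := fun x => Real.exp (f x) * r x with hr'
  have hrs' : ContMDiff 𝓘(ℝ, E) 𝓘(ℝ, ℝ) ∞ r' := contMDiff_exp_mul hf hrs
  have hr'd : IsDefiningFunction E Ω r' := hr.exp_mul hΩ hrs hf
  have hδ : 0 < 1 / (1 + t) := by positivity
  have hδ1 : 1 / (1 + t) < 1 := by rw [div_lt_one (by linarith)]; linarith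
  have hnear : ∀ p ∈ frontier Ω, ∀ᶠ q in 𝓝 p, q ∈ Ω → ∀ v : E,
      0 ≤ (complexHessian (fun x => -(-r' x) ^ (1 / (1 + t))) q v v).re := by
    intro p hp
    obtain ⟨ε, hε, hag⟩ := hloc p hp
    obtain ⟨n, hn, hIn, hαn, hdbar⟩ := exists_normal_dbar_eq hr'd hrs' hΩ hp hα.1 hT hdT hε hag
    have key := eventually_dfForm_nonneg (F := inChart p r') (n := n) (δ := 1 / (1 + t))
      ((contDiffAt_inChart hrs' (mem_extChartAt_target p)).of_le (by norm_cast))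
      (hr'd.inChart_eq_zero hΩ hp) hn hIn hδ1 (hr'd.eventually_leviB_nonneg hΩ hpsc hp) (by
        intro v hv0 hv
        have h1 := hαt p hp v ((hr'd.mem_leviDistribution_iff hΩ hp v).2 hv) hv0
        rw [norm_onHol_sq_eq_leviSq hv hαn, hdbar v hv] at h1
        have h2 : 1 - 1 / (1 + t) = t / (1 + t) := by field_simp; ring
        rw [h2, sub_pos, div_div_eq_mul_div, div_lt_iff₀ ht]
        linarith)
    filter_upwards [eventually_extChartAt (E := E) key, eventually_source (E := E) p,
      hr'd.eventually_mem_iff (frontier_subset_closure hp)] with q h1 hq h2 hqΩ v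
    refine (complexHessian_neg_rpow_nonneg_iff hδ hq (hrs' q) (h2.1 hqΩ) v).2 (h1 ?_ _)
    rw [inChart, Function.comp_apply, (extChartAt 𝓘(ℝ, E) p).left_inv hq]
    exact h2.1 hqΩ
  have hW : ∀ p ∈ frontier Ω, ∃ W, IsOpen W ∧ p ∈ W ∧ ∀ q ∈ W, q ∈ Ω → ∀ v : E,
      0 ≤ (complexHessian (fun x => -(-r' x) ^ (1 / (1 + t))) q v v).re := fun p hp => by
    obtain ⟨W, h1, h2, h3⟩ := eventually_nhds_iff.1 (hnear p hp)
    exact ⟨W, h2, h3, h1⟩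
  choose! W hWo hpW hWp using hW
  obtain ⟨s, hs, V, hV, hΩV, hsV⟩ := exists_isDFPair_of_near_frontier hr'd hΩ hrs' hcpt hδ
    (W := ⋃ p ∈ frontier Ω, W p) (isOpen_biUnion hWo)
    (fun p hp => mem_biUnion hp (hpW p hp)) (by
      rintro q ⟨hq, hqΩ⟩ v
      obtain ⟨p, hp, hqp⟩ := mem_iUnion₂.1 hq
      exact hWp p hp q hqp hqΩ v)
  refine ⟨f, s, hf, hs, ⟨V, hV, hΩV, hsV⟩, fun p hp v hv => ?_⟩
  obtain ⟨ε, hε, hag⟩ := hloc p hp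
  obtain ⟨n, hn, hIn, hαn, -⟩ := exists_normal_dbar_eq hr'd hrs' hΩ hp hα.1 hT hdT hε hag
  refine (hαn v ((hr'd.mem_leviDistribution_iff hΩ hp v).1 hv).1).trans ?_
  exact danForm_exp_mul hr hΩ hrs hf hT₀ hp hv hn hIn

end FromForms

/-! ### Sizes of one-forms on the Levi distribution -/

section Size

set_option synthInstance.maxHeartbeats 400000

variable {E : Type*} [NormedAddCommGroup E] [NormedSpace ℂ E]
  {X : Type*} [TopologicalSpace X] [ChartedSpace E X] {Ω : Set X} {r : X → ℝ} {p : X}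

lemma norm_onHol_le (l : TangentSpace 𝓘(ℝ, E) p →L[ℝ] ℝ) {v : TangentSpace 𝓘(ℝ, E) p} {C : ℝ}
    (h : |l v| ≤ C) (hJ : |l (J p v)| ≤ C) : ‖onHol l v‖ ≤ C := by
  have hC : 0 ≤ C := (abs_nonneg _).trans h
  have h1 := sq_le_sq' (neg_le_of_abs_le h) (le_of_abs_le h)
  have h2 := sq_le_sq' (neg_le_of_abs_le hJ) (le_of_abs_le hJ)
  refine abs_le_of_sq_le_sq' ?_ hC |>.2
  rw [norm_onHol_sq]
  nlinarith [sq_nonneg C]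

variable [IsManifold 𝓘(ℂ, E) ω X]

/-- The coordinates of the unit vectors near `p` are bounded. -/
lemma HermitianMetric.eventually_norm_chartD_le (h : HermitianMetric E X) (p : X) :
    ∃ C : ℝ, ∀ᶠ q in 𝓝 p, ∀ v : TangentSpace 𝓘(ℝ, E) q, h.inner q v v = 1 →
      ‖chartD (E := E) p q v‖ ≤ C := by
  let : RiemannianBundle (fun q : X => TangentSpace 𝓘(ℝ, E) q) :=
    ⟨h.toContMDiffRiemannianMetric.toRiemannianMetric⟩
  have : IsContinuousRiemannianBundle E (fun q : X => TangentSpace 𝓘(ℝ, E) q) :=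
    ⟨⟨h.inner, h.contMDiff.continuous, fun b v w => rfl⟩⟩
  obtain ⟨C, hC, hev⟩ := eventually_norm_trivializationAt_lt E
    (fun q : X => TangentSpace 𝓘(ℝ, E) q) p
  refine ⟨C, ?_⟩
  filter_upwards [hev, eventually_source (E := E) p] with q hq hqs v hv
  have hq' : q ∈ (chartAt E p).source := by simpa using hqs
  have h1 : ‖v‖ = 1 := by
    have h2 : ‖v‖ ^ 2 = 1 := (real_inner_self_eq_norm_sq v).symm.trans hv
    nlinarith [norm_nonneg v]
  have h2 := ContinuousLinearMap.le_of_opNorm_le _ hq.le v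
  rw [h1, mul_one] at h2
  have h3 := DFunLike.congr_fun (TangentBundle.continuousLinearMapAt_trivializationAt
    (I := 𝓘(ℝ, E)) hq') v
  exact (congrArg norm h3).symm.trans_le h2

variable {𝒟 : Π p : X, Set (TangentSpace 𝓘(ℝ, E) p)}
  {α β γ : Π q : X, TangentSpace 𝓘(ℝ, E) q →L[ℝ] ℝ}

lemma size_le {h : HermitianMetric E X} {C : ℝ≥0∞} (hC : ∀ p ∈ frontier Ω, ∀ v ∈ 𝒟 p,
    h.inner p v v = 1 → ENNReal.ofReal ‖onHol (α p) v‖ ≤ C) : size h Ω 𝒟 α ≤ C :=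
  iSup₂_le fun p hp => iSup₂_le fun v hv => iSup_le fun h1 => hC p hp v hv h1

lemma le_size {h : HermitianMetric E X} {v : TangentSpace 𝓘(ℝ, E) p} (hp : p ∈ frontier Ω)
    (hv : v ∈ 𝒟 p) (h1 : h.inner p v v = 1) :
    ENNReal.ofReal ‖onHol (α p) v‖ ≤ size h Ω 𝒟 α :=
  le_iSup₂_of_le p hp (le_iSup₂_of_le v hv (le_iSup_of_le h1 le_rfl))

lemma size_lt_top (h : HermitianMetric E X) (hcpt : IsCompact (frontier Ω))
    (hα : IsSmoothOneForm α) : size h Ω 𝒟 α < ⊤ := by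
  obtain ⟨C, hC⟩ : ∃ C : ℝ, ∀ q ∈ frontier Ω, ∀ v : TangentSpace 𝓘(ℝ, E) q, h.inner q v v = 1 →
      ‖onHol (α q) v‖ ≤ C := by
    refine hcpt.induction_on (p := fun s => ∃ C : ℝ, ∀ q ∈ s, ∀ v : TangentSpace 𝓘(ℝ, E) q,
      h.inner q v v = 1 → ‖onHol (α q) v‖ ≤ C) ⟨0, by simp⟩ ?_ ?_ ?_
    · rintro s t hst ⟨C, hC⟩
      exact ⟨C, fun q hq => hC q (hst hq)⟩
    · rintro s t ⟨C, hC⟩ ⟨D, hD⟩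
      exact ⟨max C D, fun q hq v hv => hq.elim (fun hq => (hC q hq v hv).trans (le_max_left _ _))
        fun hq => (hD q hq v hv).trans (le_max_right _ _)⟩
    · intro p _
      obtain ⟨C, hC⟩ := h.eventually_norm_chartD_le p
      have hb : ∀ᶠ y in 𝓝 (extChartAt 𝓘(ℝ, E) p p), ‖formInChart p α y‖ <
          ‖formInChart p α (extChartAt 𝓘(ℝ, E) p p)‖ + 1 :=
        (hα.formInChart_contDiffAt p).continuousAt.norm.eventually
          (gt_mem_nhds (lt_add_one _))
      set A := ‖formInChart p α (extChartAt 𝓘(ℝ, E) p p)‖ + 1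
      have hev : ∀ᶠ q in 𝓝 p, ∀ v : TangentSpace 𝓘(ℝ, E) q, h.inner q v v = 1 →
          ‖onHol (α q) v‖ ≤ A * C := by
        filter_upwards [hC, eventually_extChartAt (E := E) hb, eventually_source (E := E) p]
          with q hq1 hq2 hq v hv
        have key : ∀ w : TangentSpace 𝓘(ℝ, E) q, h.inner q w w = 1 → |α q w| ≤ A * C := by
          intro w hw
          have h1 := formInChart_apply hq α w
          rw [← h1, ← Real.norm_eq_abs]
          exact (ContinuousLinearMap.le_opNorm _ _).trans
            (mul_le_mul hq2.le (hq1 w hw) (norm_nonneg _) ((norm_nonneg _).trans hq2.le))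
        exact norm_onHol_le _ (key v hv) (key _ ((h.inner_J q v v).trans hv))
      exact ⟨_, nhdsWithin_le_nhds hev, A * C, fun q hq => hq⟩
  exact (size_le fun p hp v _ h1 => ENNReal.ofReal_le_ofReal (hC p hp v h1)).trans_lt
    ENNReal.ofReal_lt_top

lemma size_le_add {h : HermitianMetric E X} (hle : ∀ p ∈ frontier Ω, ∀ v ∈ 𝒟 p,
    ‖onHol (α p) v‖ ≤ ‖onHol (β p) v‖ + ‖onHol (γ p) v‖) :
    size h Ω 𝒟 α ≤ size h Ω 𝒟 β + size h Ω 𝒟 γ :=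
  size_le fun p hp v hv h1 => (ENNReal.ofReal_le_ofReal (hle p hp v hv)).trans
    ((ENNReal.ofReal_add (norm_nonneg _) (norm_nonneg _)).trans_le
      (add_le_add (le_size hp hv h1) (le_size hp hv h1)))

lemma IsDefiningFunction.J_mem_leviDistribution (hr : IsDefiningFunction E Ω r) (hΩ : IsOpen Ω)
    (hp : p ∈ frontier Ω) {v : TangentSpace 𝓘(ℝ, E) p} (hv : v ∈ leviDistribution Ω p) :
    J p v ∈ leviDistribution Ω p :=
  (hr.mem_leviDistribution_iff hΩ hp _).2
    (isNull_I ((hr.mem_leviDistribution_iff hΩ hp v).1 hv))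

/-- The D'Angelo forms of two defining functions differ by an exact form on the Levi
distribution. -/
lemma danForm_eq_add_diff {r' f : X → ℝ} {T T' : Π q : X, TangentSpace 𝓘(ℝ, E) q}
    (hr : IsDefiningFunction E Ω r) (hΩ : IsOpen Ω)
    (hrs : ContMDiff 𝓘(ℝ, E) 𝓘(ℝ, ℝ) ∞ r) (hf : ContMDiff 𝓘(ℝ, E) 𝓘(ℝ, ℝ) ∞ f)
    (hT : IsCharacteristicField Ω r T) (hrs' : ContMDiff 𝓘(ℝ, E) 𝓘(ℝ, ℝ) ∞ r')
    (hT' : IsCharacteristicField Ω r' T') {V : Set X} (hV : IsOpen V) (hΩV : frontier Ω ⊆ V)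
    (h : EqOn r' (fun x => Real.exp (f x) * r x) V) (hp : p ∈ frontier Ω)
    {v : TangentSpace 𝓘(ℝ, E) p} (hv : v ∈ leviDistribution Ω p) :
    danForm r' T' p v = danForm r T p v + diff f p v := by
  have h1 : inChart p r' =ᶠ[𝓝 (extChartAt 𝓘(ℝ, E) p p)]
      inChart p fun x => Real.exp (f x) * r x :=
    eventually_extChartAt_symm (E := E) (eventually_of_mem (hV.mem_nhds (hΩV hp)) h)
  have h2 := danForm_exp_mul hr hΩ hrs hf hT hp (n := mulI E (T' p)) hv
    (by rw [← h1.fderiv_eq]; exact (hT'.fderiv_normal hrs' hp).1)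
    (by rw [← h1.fderiv_eq]; exact (hT'.fderiv_normal hrs' hp).2)
  refine Eq.trans ?_ h2
  rw [← leviB_congr h1]
  rfl

lemma diff_add_const_mul {f g : X → ℝ} (hf : ContMDiff 𝓘(ℝ, E) 𝓘(ℝ, ℝ) ∞ f)
    (hg : ContMDiff 𝓘(ℝ, E) 𝓘(ℝ, ℝ) ∞ g) (c : ℝ) (v : TangentSpace 𝓘(ℝ, E) p) :
    diff (fun x => f x + c * g x) p v = diff f p v + c * diff g p v := by
  have h0 : ContMDiff 𝓘(ℝ, E) 𝓘(ℝ, ℝ) ∞ (fun x => f x + c * g x) :=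
    hf.add (contMDiff_const.mul hg)
  have hF := (contDiffAt_inChart (p := p) hf (mem_extChartAt_target p)).differentiableAt (by simp)
  have hG := (contDiffAt_inChart (p := p) hg (mem_extChartAt_target p)).differentiableAt (by simp)
  refine (diff_eq_inChart (h0 p) v).trans (Eq.trans ?_ (congrArg₂ (fun a b => a + c * b)
    (diff_eq_inChart (hf p) v) (diff_eq_inChart (hg p) v)).symm)
  have h1 : HasFDerivAt (fun z => inChart p f z + c * inChart p g z) _
      (extChartAt 𝓘(ℝ, E) p p) := hF.hasFDerivAt.add (hG.hasFDerivAt.const_mul c)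
  exact DFunLike.congr_fun h1.fderiv v

end Size

/-! ### The Diederich–Fornæss index -/

section Index

set_option synthInstance.maxHeartbeats 400000

variable {E : Type*} [NormedAddCommGroup E] [NormedSpace ℂ E] [FiniteDimensional ℂ E]
  {X : Type*} [TopologicalSpace X] [T2Space X] [SecondCountableTopology X] [ChartedSpace E X]
  [IsManifold 𝓘(ℂ, E) ω X] {Ω : Set X} {r : X → ℝ} {δ δ' : ℝ}

lemma IsDFPair.exists_global (hr : IsDFPair E Ω δ r) (hΩ : IsOpen Ω) :
    ∃ s : X → ℝ, IsDFPair E Ω δ s ∧ ContMDiff 𝓘(ℝ, E) 𝓘(ℝ, ℝ) ∞ s ∧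
      ∃ V, IsOpen V ∧ closure Ω ⊆ V ∧ EqOn s r V := by
  obtain ⟨s, hs, hss, V, hV, hΩV, hsV⟩ := hr.1.exists_global
  have h1 : EqOn (fun x => -(-s x) ^ δ) (fun x => -(-r x) ^ δ) Ω := fun x hx => by
    simp only [hsV (hΩV (subset_closure hx))]
  refine ⟨s, ⟨hs, hr.2.1.congr h1, fun q hq v => ?_⟩, hss, V, hV, hΩV, hsV⟩
  exact (hr.2.2 q hq v).trans_eq (complexHessian_self_re_congr (E := E)
    (eventually_of_mem (hΩ.mem_nhds hq) h1) v).symm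

/-- A pair `(r, δ)` with `-(-r)^δ` plurisubharmonic gives, for every `δ' < δ`, a D'Angelo form
`α` with `𝔫(α) ≤ (1 - δ') / δ'`, which differs from that of `r` by a controlled exact form. -/
lemma IsDFPair.exists_isDAngeloForm (hr : IsDFPair E Ω δ r) (hΩ : IsOpen Ω) (hδ' : 0 < δ')
    (hδδ' : δ' < δ) (hδ : δ ≤ 1) {ψ : X → ℝ} (hψ : IsStrictWeight (E := E) Ω ψ) :
    ∃ (s : X → ℝ) (T : Π q : X, TangentSpace 𝓘(ℝ, E) q),
      ContMDiff 𝓘(ℝ, E) 𝓘(ℝ, ℝ) ∞ s ∧ IsCharacteristicField Ω s T ∧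
      (∃ V, IsOpen V ∧ frontier Ω ⊆ V ∧
        EqOn s (fun x => Real.exp (-((δ - δ') / 2) * ψ x) * r x) V) ∧
      IsDAngeloForm Ω (danForm s T) ∧
      nForm Ω (leviDistribution (E := E) Ω) (danForm s T) ≤ ENNReal.ofReal ((1 - δ') / δ') := by
  have : CompleteSpace E := FiniteDimensional.complete ℂ E
  obtain ⟨s, hs, hss, V, hV, hΩV, hsV⟩ := hr.exists_global hΩ
  have hf : ContMDiff 𝓘(ℝ, E) 𝓘(ℝ, ℝ) ∞ (fun x => -((δ - δ') / 2) * ψ x) :=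
    contMDiff_const.mul hψ.smooth
  have h1 := contMDiff_exp_mul hf hss
  have h2 := hs.1.exp_mul hΩ hss hf
  obtain ⟨T, hT⟩ := exists_characteristicField h2 h1
  exact ⟨_, T, h1, hT, ⟨V, hV, frontier_subset_closure.trans hΩV, fun x hx => by
    simp only [hsV hx]⟩, isDAngeloForm_danForm h2 h1 hΩ hT,
    nForm_danForm_le hs hΩ hss hδ' hδδ' hδ hψ hT⟩

/-- Exponents `δ` for which `-(-r)^δ` is plurisubharmonic satisfy `δ ≤ 1 / (1 + 𝔫)`. -/
lemma dfIndex_le (hΩ : IsOpen Ω) {ψ : X → ℝ} (hψ : IsStrictWeight (E := E) Ω ψ) :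
    dfIndex E Ω ≤ 1 / (1 + nTotal (E := E) Ω (leviDistribution Ω)) := by
  refine iSup₂_le fun δ hδ => iSup_le fun ⟨r, hr⟩ => ?_
  refine le_of_forall_lt fun c hc => ?_
  have hc' := hc.ne_top
  obtain ⟨δ', hcδ', hδ'⟩ : ∃ δ', c.toReal < δ' ∧ δ' < δ :=
    exists_between ((ENNReal.lt_ofReal_iff_toReal_lt hc').1 hc)
  have hδ'0 : 0 < δ' := ENNReal.toReal_nonneg.trans_lt hcδ'
  obtain ⟨s, T, -, -, -, hα, hn⟩ := hr.exists_isDAngeloForm hΩ hδ'0 hδ' hδ.2 hψ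
  have h1 : nTotal (E := E) Ω (leviDistribution Ω) ≤ ENNReal.ofReal ((1 - δ') / δ') :=
    (iInf₂_le _ hα).trans hn
  have h2 : 1 + nTotal (E := E) Ω (leviDistribution Ω) ≤ ENNReal.ofReal δ'⁻¹ := by
    refine (add_le_add_right h1 1).trans ?_
    rw [← ENNReal.ofReal_one, ← ENNReal.ofReal_add zero_le_one
      (div_nonneg (by linarith [hδ.2]) hδ'0.le)]
    refine ENNReal.ofReal_le_ofReal (le_of_eq ?_)
    field_simp
    ring
  calc c < ENNReal.ofReal δ' := (ENNReal.lt_ofReal_iff_toReal_lt hc').2 hcδ'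
    _ = (ENNReal.ofReal δ'⁻¹)⁻¹ := by rw [ENNReal.ofReal_inv_of_pos hδ'0, inv_inv]
    _ ≤ 1 / (1 + nTotal (E := E) Ω (leviDistribution Ω)) := by
      rw [one_div]
      exact ENNReal.inv_le_inv' h2

/-- If `𝔫(α) < t` then the exponent `1 / (1 + t)` is attained by some defining function. -/
lemma le_dfIndex (hΩ : IsOpen Ω) (hcpt : IsCompact (closure Ω))
    (hpsc : IsSmoothPseudoconvex E Ω) :
    1 / (1 + nTotal (E := E) Ω (leviDistribution Ω)) ≤ dfIndex E Ω := by
  obtain ⟨r₀, hr₀, -⟩ := id hpsc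
  obtain ⟨r, hr, hrs, -⟩ := hr₀.exists_global
  obtain ⟨T, hT⟩ := exists_characteristicField hr hrs
  rw [one_div, ENNReal.inv_le_iff_inv_le]
  refine tsub_le_iff_left.1 ?_
  refine le_iInf₂ fun α hα => le_iInf₂ fun t ht => le_iInf fun hαt => ?_
  refine tsub_le_iff_left.2 ?_
  obtain ⟨-, s, -, hs, -⟩ := exists_isDFPair_of_lt hr hΩ hrs hcpt hpsc hT hα ht hαt
  have h1 : ENNReal.ofReal (1 / (1 + t)) ≤ dfIndex E Ω :=
    le_iSup₂_of_le (1 / (1 + t)) ⟨by positivity, by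
      rw [div_le_one (by linarith)]; linarith⟩ (le_iSup_of_le ⟨s, hs⟩ le_rfl)
  refine (ENNReal.inv_le_inv' h1).trans (le_of_eq ?_)
  rw [one_div, ENNReal.ofReal_inv_of_pos (by linarith), inv_inv,
    ENNReal.ofReal_add zero_le_one ht.le, ENNReal.ofReal_one]

/-- The D'Angelo forms constructed from the defining functions `r k` differ from a fixed one by the
logarithmic differential of `r k` relative to `r 0`, up to a bounded term, and are therefore bounded
in size. -/
lemma exists_nBounded_eq_zero (h : HermitianMetric E X) (hΩ : IsOpen Ω)
    (hcpt : IsCompact (closure Ω)) {ψ : X → ℝ} (hψ : IsStrictWeight (E := E) Ω ψ)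
    (hreg : HasRegularizedDFIndexOne h Ω) :
    ∃ K : ℝ≥0∞, 0 < K ∧ K < ⊤ ∧ nBounded h Ω K (leviDistribution Ω) = 0 := by
  have hfr : IsCompact (frontier Ω) := hcpt.of_isClosed_subset isClosed_frontier
    frontier_subset_closure
  obtain ⟨δ, r, hδ, hlim, hr, C, hC⟩ := hreg
  obtain ⟨r₀, hr₀, hrs₀, V₀, hV₀, hΩV₀, hrV₀⟩ := (hr 0).1.exists_global
  obtain ⟨T₀, hT₀⟩ := exists_characteristicField hr₀ hrs₀
  set A := size h Ω (leviDistribution Ω) (danForm r₀ T₀)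
  set B := size h Ω (leviDistribution Ω) (fun q => diff ψ q)
  have hA : A < ⊤ := size_lt_top h hfr (isSmoothOneForm_danForm hrs₀ hT₀.smooth)
  have hB : B < ⊤ := size_lt_top h hfr (isSmoothOneForm_diff hψ.smooth)
  have hAB : A + ((C + 1 : ℝ≥0∞) + B) < ⊤ :=
    ENNReal.add_lt_top.2 ⟨hA, ENNReal.add_lt_top.2 ⟨ENNReal.add_lt_top.2
      ⟨ENNReal.coe_lt_top, ENNReal.one_lt_top⟩, hB⟩⟩
  have key : ∀ δ' : ℝ, 0 < δ' → δ' < 1 →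
      nBounded h Ω (A + ((C + 1 : ℝ≥0∞) + B) + 1) (leviDistribution Ω) ≤
        ENNReal.ofReal ((1 - δ') / δ') := by
    intro δ' h0 h1
    obtain ⟨k, hk⟩ := (hlim.eventually (lt_mem_nhds h1)).exists
    obtain ⟨s, T, hs, hT, ⟨V, hV, hΩV, hsV⟩, hα, hn⟩ :=
      (hr k).exists_isDAngeloForm hΩ h0 hk (hδ k).2 hψ
    refine (iInf_le_of_le _ (iInf₂_le_of_le hα ?_ hn))
    -- The logarithmic ratio `f` of `r 0` and `r k` is controlled by the pseudodistance.
    obtain ⟨f, ⟨V₁, hV₁, hΩV₁, hfs, hf⟩, hfC⟩ : ∃ f : X → ℝ, ∃ _ : IsLogRatio E Ω (r 0) (r k) f,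
        size h Ω (leviDistribution (E := E) Ω) (fun p => diff f p) < C + 1 := by
      have h2 : sigma h Ω (r 0) (r k) < C + 1 := (hC 0 k).trans_lt
        (ENNReal.lt_add_right ENNReal.coe_ne_top one_ne_zero)
      simpa only [sigma, iInf_lt_iff] using h2
    obtain ⟨g, hg, V₂, hV₂, hΩV₂, -, hgf⟩ := exists_smooth_extension isClosed_frontier hV₁ hΩV₁ hfs
    have hsr : EqOn s (fun x => Real.exp (g x + -((δ k - δ') / 2) * ψ x) * r₀ x)
        (V ∩ V₀ ∩ V₁ ∩ V₂) := by
      rintro x ⟨⟨⟨h3, h4⟩, h5⟩, h6⟩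
      simp only [hsV h3, hf x h5, hgf h6, hrV₀ h4, Real.exp_add]
      ring
    have hG : ContMDiff 𝓘(ℝ, E) 𝓘(ℝ, ℝ) ∞ (fun x => g x + -((δ k - δ') / 2) * ψ x) :=
      hg.add (contMDiff_const.mul hψ.smooth)
    have hdα : ∀ p ∈ frontier Ω, ∀ v ∈ leviDistribution (E := E) Ω p,
        danForm s T p v = danForm r₀ T₀ p v +
          diff (fun x => g x + -((δ k - δ') / 2) * ψ x) p v := fun p hp v hv =>
      danForm_eq_add_diff hr₀ hΩ hrs₀ hG hT₀ hs hT
        (((hV.inter hV₀).inter hV₁).inter hV₂)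
        (fun q hq => ⟨⟨⟨hΩV hq, hΩV₀ (frontier_subset_closure hq)⟩, hΩV₁ hq⟩, hΩV₂ hq⟩) hsr hp hv
    have hdf : ∀ p ∈ frontier Ω, (diff g p : TangentSpace 𝓘(ℝ, E) p →L[ℝ] ℝ) = diff f p :=
      fun p hp => Filter.EventuallyEq.mfderiv_eq
        (eventually_of_mem (hV₂.mem_nhds (hΩV₂ hp)) hgf)
    have hε : |-((δ k - δ') / 2)| ≤ 1 := by
      rw [abs_le]
      constructor <;> linarith [(hδ k).2]
    have h4 : size h Ω (leviDistribution (E := E) Ω)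
        (fun q => diff (fun x => g x + -((δ k - δ') / 2) * ψ x) q) ≤ (C + 1) + B := by
      refine (size_le_add fun p hp v hv => ?_).trans (add_le_add hfC.le le_rfl)
      have h5 : onHol (diff (fun x => g x + -((δ k - δ') / 2) * ψ x) p) v =
          onHol (diff f p) v + (-((δ k - δ') / 2) : ℝ) * onHol (diff ψ p) v := by
        simp only [onHol, diff_add_const_mul hg hψ.smooth, hdf p hp]
        push_cast
        ring
      rw [h5]
      refine (norm_add_le _ _).trans ?_
      rw [norm_mul, Complex.norm_real, Real.norm_eq_abs]
      have := mul_le_mul_of_nonneg_right hε (norm_nonneg (onHol (diff ψ p) v))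
      rw [one_mul] at this
      linarith
    have h3 : size h Ω (leviDistribution Ω) (danForm s T) ≤ A + ((C + 1) + B) := by
      refine (size_le_add fun p hp v hv => ?_).trans (add_le_add le_rfl h4)
      rw [onHol_add_of_eq (hdα p hp v hv)
        (hdα p hp _ (hr₀.J_mem_leviDistribution hΩ hp hv))]
      exact norm_add_le _ _
    exact h3.trans_lt (ENNReal.lt_add_right hAB.ne one_ne_zero)
  refine ⟨A + ((C + 1) + B) + 1, by positivity,
    ENNReal.add_lt_top.2 ⟨hAB, ENNReal.one_lt_top⟩, le_antisymm ?_ zero_le⟩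
  have h1 : Tendsto (fun δ' : ℝ => ENNReal.ofReal ((1 - δ') / δ')) (𝓝[<] 1) (𝓝 0) := by
    have : ContinuousAt (fun δ' : ℝ => ENNReal.ofReal ((1 - δ') / δ')) 1 :=
      ENNReal.continuous_ofReal.continuousAt.comp
        ((continuousAt_const.sub continuousAt_id).div continuousAt_id one_ne_zero)
    have h2 := this.tendsto
    simp only [sub_self, zero_div, ENNReal.ofReal_zero] at h2
    exact h2.mono_left nhdsWithin_le_nhds
  refine ge_of_tendsto h1 ?_
  filter_upwards [self_mem_nhdsWithin, nhdsWithin_le_nhds (lt_mem_nhds zero_lt_one)]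
    with δ' h2 h3
  exact key δ' h3 h2

/-- The defining functions constructed from D'Angelo forms `α k` of size less than `K` have
logarithmic ratios whose differentials are `α k - α j` on the Levi distribution. -/
lemma hasRegularizedDFIndexOne_of_nBounded (h : HermitianMetric E X) (hΩ : IsOpen Ω)
    (hcpt : IsCompact (closure Ω)) (hpsc : IsSmoothPseudoconvex E Ω) {K : ℝ≥0∞} (hK : K < ⊤)
    (hK0 : nBounded h Ω K (leviDistribution Ω) = 0) : HasRegularizedDFIndexOne h Ω := by
  obtain ⟨r₀, hr₀, -⟩ := id hpsc
  obtain ⟨r, hr, hrs, -⟩ := hr₀.exists_global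
  obtain ⟨T, hT⟩ := exists_characteristicField hr hrs
  have key : ∀ k : ℕ, ∃ (t : ℝ) (α : Π q : X, TangentSpace 𝓘(ℝ, E) q →L[ℝ] ℝ) (f s : X → ℝ)
      (V : Set X),
      0 < t ∧ t < 1 / ((k : ℝ) + 1) ∧ size h Ω (leviDistribution Ω) α < K ∧
      ContMDiff 𝓘(ℝ, E) 𝓘(ℝ, ℝ) ∞ f ∧ IsDFPair E Ω (1 / (1 + t)) s ∧
      IsOpen V ∧ frontier Ω ⊆ V ∧ EqOn s (fun x => Real.exp (f x) * r x) V ∧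
      ∀ p ∈ frontier Ω, ∀ v ∈ leviDistribution (E := E) Ω p,
        α p v = danForm r T p v + diff f p v := by
    intro k
    have h1 : nBounded h Ω K (leviDistribution Ω) < ENNReal.ofReal (1 / ((k : ℝ) + 1)) := by
      rw [hK0]
      exact ENNReal.ofReal_pos.2 (by positivity)
    simp only [nBounded, nForm, iInf_lt_iff] at h1
    obtain ⟨α, hα, hαK, t, ht, hαt, htk⟩ := h1
    obtain ⟨f, s, hf, hs, ⟨V, hV, hΩV, hsV⟩, hαf⟩ :=
      exists_isDFPair_of_lt hr hΩ hrs hcpt hpsc hT hα ht hαt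
    exact ⟨t, α, f, s, V, ht, (ENNReal.ofReal_lt_ofReal_iff (by positivity)).1 htk, hαK, hf, hs, hV,
      hΩV, hsV, hαf⟩
  choose t α f s V ht htk hαK hf hs hV hΩV hsV hαf using key
  refine ⟨fun k => 1 / (1 + t k), s, fun k => ⟨by have := ht k; positivity, ?_⟩, ?_, hs,
    2 * K.toNNReal, fun j k => ?_⟩
  · rw [div_le_one (by linarith [ht k])]
    linarith [ht k]
  · have h1 : Tendsto t atTop (𝓝 0) := squeeze_zero (fun k => (ht k).le) (fun k => (htk k).le)
      tendsto_one_div_add_atTop_nhds_zero_nat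
    have h2 : Tendsto (fun k => 1 / (1 + t k)) atTop (𝓝 (1 / (1 + 0))) :=
      tendsto_const_nhds.div (h1.const_add 1) (by norm_num)
    simpa using h2
  · have hlog : IsLogRatio E Ω (s j) (s k) (fun x => f k x + -1 * f j x) := by
      refine ⟨V j ∩ V k, (hV j).inter (hV k), subset_inter (hΩV j) (hΩV k),
        ((hf k).add (contMDiff_const.mul (hf j))).contMDiffOn, fun x hx => ?_⟩
      rw [hsV j hx.1, hsV k hx.2]
      simp only
      rw [← mul_assoc, ← Real.exp_add]
      congr 2
      ring
    refine (iInf₂_le _ hlog).trans ?_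
    have h1 : size h Ω (leviDistribution (E := E) Ω)
        (fun p => diff (fun x => f k x + -1 * f j x) p) ≤
        size h Ω (leviDistribution Ω) (α k) + size h Ω (leviDistribution Ω) (α j) := by
      refine size_le_add fun p hp v hv => ?_
      have hd : ∀ w ∈ leviDistribution (E := E) Ω p,
          α k p w - α j p w = diff (fun x => f k x + -1 * f j x) p w := fun w hw => by
        rw [diff_add_const_mul (hf k) (hf j), hαf k p hp w hw, hαf j p hp w hw]
        ring
      have h2 : onHol (diff (fun x => f k x + -1 * f j x) p) v =
          onHol (α k p) v - onHol (α j p) v := by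
        rw [onHol, ← hd v hv, ← hd _ (hr.J_mem_leviDistribution hΩ hp hv), onHol, onHol]
        push_cast
        ring
      rw [h2]
      exact norm_sub_le _ _
    refine h1.trans ((add_le_add (hαK k).le (hαK j).le).trans (le_of_eq ?_))
    rw [ENNReal.coe_mul, ENNReal.coe_toNNReal hK.ne, ENNReal.coe_ofNat, two_mul]

end Index

end DFIndex

end

theorem mainTheorem3 {E : Type*} [NormedAddCommGroup E] [NormedSpace ℂ E] [FiniteDimensional ℂ E]
    {X : Type*} [TopologicalSpace X] [T2Space X] [SecondCountableTopology X] [ChartedSpace E X]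
    [IsManifold 𝓘(ℂ, E) ω X] (h : DFIndex.HermitianMetric E X)
    (Ω : Set X) (hopen : IsOpen Ω) (hconn : IsConnected Ω) (hcpt : IsCompact (closure Ω))
    (hpsc : DFIndex.IsSmoothPseudoconvex E Ω)
    (hpsh : ∃ (ψ : X → ℝ) (W : Set X), IsOpen W ∧ frontier Ω ⊆ W ∧
      DFIndex.IsSmoothStrictlyPlurisubharmonicOn E ψ W) :
    DFIndex.dfIndex E Ω = 1 / (1 + DFIndex.nTotal (E := E) Ω (DFIndex.leviDistribution Ω)) ∧
    (DFIndex.HasRegularizedDFIndexOne h Ω ↔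
      ∃ K : ℝ≥0∞, 0 < K ∧ K < ⊤ ∧ DFIndex.nBounded h Ω K (DFIndex.leviDistribution Ω) = 0) := by
  obtain ⟨ψ₀, W, hW, hΩW, hψ₀⟩ := hpsh
  obtain ⟨ψ, hψ⟩ := DFIndex.exists_isStrictWeight
    (hcpt.of_isClosed_subset isClosed_frontier frontier_subset_closure) hW hΩW hψ₀
  refine ⟨le_antisymm (DFIndex.dfIndex_le hopen hψ) (DFIndex.le_dfIndex hopen hcpt hpsc),
    DFIndex.exists_nBounded_eq_zero h hopen hcpt hψ, ?_⟩
  rintro ⟨K, -, hK, hK0⟩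
  exact DFIndex.hasRegularizedDFIndexOne_of_nBounded h hopen hcpt hpsc hK hK0
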